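/- Let $\lambda>0$ and $c>0$. For $s>0$ and $(x,y)\in\mathbb R^2$ let $$\mathfrak r(x,y,s)=\frac{\lambda e^{-\lambda s}}{2\pi c}\;\frac{e^{\frac{\lambda}{c}\sqrt{c^2s^2-(x^2+y^2)}}+e^{-\frac{\lambda}{c}\sqrt{c^2s^2-(x^2+y^2)}}}{\sqrt{c^2s^2-(x^2+y^2)}}\quad\text{if }x^2+y^2<c^2s^2,\qquad \mathfrak r(x,y,s)=0\quad\text{otherwise}$$ (the distribution of the modified planar motion with velocity $c$ and Poisson rate $\lambda$ in which only odd-order displacements are kept), and let $p_{|B|}(s,t)=e^{-s^2/(4t)}/\sqrt{\pi t}$, $s,t>0$, be the density of the reflecting Brownian motion $|B(t)|$, where $B(t)$ has variance $2t$. Put $$\mathfrak q(x,y,t)=\int_0^\infty \mathfrak r(x,y,s)\Big[p_{|B|}(s,t)+\frac1{2\lambda}\frac{\partial^{1/2}}{\partial t^{1/2}}p_{|B|}(s,t)\Big]\,ds ,\qquad t>0,$$ where $\frac{\partial^{1/2}}{\partial t^{1/2}}f(t)=\frac1{\Gamma(1/2)}\frac{d}{dt}\int_0^t\frac{f(\tau)}{(t-\tau)^{1/2}}\,d\tau$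 is the Riemann–Liouville derivative, and let $\frac{{}^C\partial^{1/2}}{\partial t^{1/2}}f(t)=\frac1{\Gamma(1/2)}\int_0^t\frac{f'(\tau)}{(t-\tau)^{1/2}}\,d\tau$ be the Dzerbayshan–Caputo derivative. Then the fractional derivative of $p_{|B|}$ exists for all $s,t>0$, the integral defining $\mathfrak q(x,y,t)$ converges absolutely and is nonnegative for all $(x,y)\neq(0,0)$, $t>0$, and the following hold. (a) The function $\mathfrak q$ satisfies $$\Big(\frac{\partial}{\partial t}+2\lambda\frac{{}^C\partial^{1/2}}{\partial t^{1/2}}\Big)\mathfrak q(x,y,t)=c^2\Big(\frac{\partial^2}{\partial x^2}+\frac{\partial^2}{\partial y^2}\Big)\mathfrak q(x,y,t),$$ pointwise (all derivatives involved existing, with $\mathfrak q(\cdot,\cdot,t)$ of class $C^2$ near $(x,y)$) for all $(x,y)\ne(0,0)$ and $t>0$, and on the whole plane in the distributional sense with initial datum $\delta$: for every $t>0$ the function $\mathfrak q(\cdot,\cdot,t)$ is locally integrable, and for every $\varphi\in C_c^\infty(\mathbb R^2)$ the function $F_\varphi(t)=\iint\mathfrak q(x,y,t)\varphi(x,y)\,dx\,dy$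 is differentiable on $(0,\infty)$, has a Caputo derivative of order $1/2$ at every $t>0$, satisfies $F_\varphi'(t)+2\lambda\frac{{}^C\partial^{1/2}}{\partial t^{1/2}}F_\varphi(t)=c^2F_{\Delta\varphi}(t)$ for all $t>0$, and $F_\varphi(t)\to\varphi(0,0)$ as $t\downarrow0$. (b) Let $H^{1/2}$ be a stable subordinator of index $1/2$, that is, a non-decreasing right-continuous process with $H^{1/2}(0)=0$, independent stationary increments and $\mathbb E e^{-\mu H^{1/2}(t)}=e^{-t\sqrt\mu}$ for $\mu\ge 0$; let $\mathscr L^{1/2}(t)=\inf\{s>0:\ s+(2\lambda)^2H^{1/2}(s)\ge t\}$; and let $\boldsymbol B_2$ be a planar Brownian motion independent of $H^{1/2}$, normalised so that $\mathbb E e^{i\xi\cdot \boldsymbol B_2(s)}=e^{-s\|\xi\|^2}$. Then for every $t>0$ the random vector $\boldsymbol B_2(c^2\mathscr L^{1/2}(t))$ has law $\mathfrak q(x,y,t)\,dx\,dy$ on $\mathbb R^2$. -/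

import Mathlib

open MeasureTheory ProbabilityTheory Set Filter Topology
open scoped NNReal ENNReal

noncomputable section

namespace PlanarTelegraph

/-! ### Fractional derivatives of order `ν ∈ (0, 1)` with base point `0` -/

/-- Riemann–Liouville derivative
`(1 / Γ(1 - ν)) d/dt ∫₀ᵗ f(τ) (t - τ)^(-ν) dτ`. -/
def rlDeriv (ν : ℝ) (f : ℝ → ℝ) (t : ℝ) : ℝ :=
  1 / Real.Gamma (1 - ν) * deriv (fun u ↦ ∫ τ in (0 : ℝ)..u, f τ / (u - τ) ^ ν) t

/-- The integral and the derivative in `rlDeriv ν f t` exist. -/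
structure HasRLDeriv (ν : ℝ) (f : ℝ → ℝ) (t : ℝ) : Prop where
  integrable : IntervalIntegrable (fun τ ↦ f τ / (t - τ) ^ ν) volume 0 t
  differentiableAt : DifferentiableAt ℝ (fun u ↦ ∫ τ in (0 : ℝ)..u, f τ / (u - τ) ^ ν) t

/-- Dzerbayshan–Caputo derivative `(1 / Γ(1 - ν)) ∫₀ᵗ f'(τ) (t - τ)^(-ν) dτ`. -/
def caputoDeriv (ν : ℝ) (f : ℝ → ℝ) (t : ℝ) : ℝ :=
  1 / Real.Gamma (1 - ν) * ∫ τ in (0 : ℝ)..t, deriv f τ / (t - τ) ^ ν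

/-- The derivative `f'` on `(0, t)` and the integral in `caputoDeriv ν f t` exist. -/
structure HasCaputoDeriv (ν : ℝ) (f : ℝ → ℝ) (t : ℝ) : Prop where
  differentiableAt : ∀ τ ∈ Ioo 0 t, DifferentiableAt ℝ f τ
  integrable : IntervalIntegrable (fun τ ↦ deriv f τ / (t - τ) ^ ν) volume 0 t

/-- `∂²f/∂x² + ∂²f/∂y²` at the point `z = (x, y)`. -/
def laplacian (f : ℝ × ℝ → ℝ) (z : ℝ × ℝ) : ℝ :=
  iteratedDeriv 2 (fun x ↦ f (x, z.2)) z.1 + iteratedDeriv 2 (fun y ↦ f (z.1, y)) z.2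

/-! ### The functions `p_{|B|}`, `𝔯` and `𝔮` -/

/-- Density at `s > 0` of the reflecting Brownian motion `|B(t)|`, where `B(t)` is centred with
variance `2t`. -/
def reflDensity (s t : ℝ) : ℝ :=
  Real.exp (-s ^ 2 / (4 * t)) / √(Real.pi * t)

/-- The law `𝔯(x, y, s)` of the modified planar motion with velocity `c` and rate `lam`. It lives
on the open disc of radius `c s`. -/
def modifiedLaw (lam c : ℝ) (z : ℝ × ℝ) (s : ℝ) : ℝ :=
  if z.1 ^ 2 + z.2 ^ 2 < c ^ 2 * s ^ 2 then
    lam * Real.exp (-lam * s) / (2 * Real.pi * c) *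
      ((Real.exp (lam / c * √(c ^ 2 * s ^ 2 - (z.1 ^ 2 + z.2 ^ 2))) +
          Real.exp (-(lam / c * √(c ^ 2 * s ^ 2 - (z.1 ^ 2 + z.2 ^ 2))))) /
        √(c ^ 2 * s ^ 2 - (z.1 ^ 2 + z.2 ^ 2)))
  else 0

/-- The integrand of `𝔮`; the fractional derivative acts on `t ↦ p_{|B|}(s, t)`. -/
def composedIntegrand (lam c : ℝ) (z : ℝ × ℝ) (t s : ℝ) : ℝ :=
  modifiedLaw lam c z s *
    (reflDensity s t + 1 / (2 * lam) * rlDeriv (1 / 2) (fun τ ↦ reflDensity s τ) t)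

/-- The function `𝔮(x, y, t)`. -/
def composedLaw (lam c : ℝ) (z : ℝ × ℝ) (t : ℝ) : ℝ :=
  ∫ s in Ioi (0 : ℝ), composedIntegrand lam c z t s

/-! ### The two senses of `(∂_t + 2 lam ᶜ∂_t^{1/2}) u = c² Δ u` -/

/-- The equation holds pointwise at `(z, t)`, all derivatives existing in the ordinary sense. -/
structure SolvesAt (lam c : ℝ) (u : ℝ × ℝ → ℝ → ℝ) (z : ℝ × ℝ) (t : ℝ) : Prop where
  time : DifferentiableAt ℝ (u z) t
  caputo : HasCaputoDeriv (1 / 2) (u z) t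
  space : ContDiffAt ℝ 2 (fun w ↦ u w t) z
  eqn : deriv (u z) t + 2 * lam * caputoDeriv (1 / 2) (u z) t
    = c ^ 2 * laplacian (fun w ↦ u w t) z

/-- `∫∫ u(x, y, t) φ(x, y) dx dy`. -/
def pairing (u : ℝ × ℝ → ℝ → ℝ) (φ : ℝ × ℝ → ℝ) (t : ℝ) : ℝ :=
  ∫ z, u z t * φ z

/-- The equation holds on the whole plane in the sense of distributions in the space variables,
with initial datum the Dirac mass at the origin. -/
structure SolvesWeakly (lam c : ℝ) (u : ℝ × ℝ → ℝ → ℝ) : Prop where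
  locallyIntegrable : ∀ t, 0 < t → LocallyIntegrable (fun z ↦ u z t) volume
  time : ∀ φ : ℝ × ℝ → ℝ, ContDiff ℝ (⊤ : ℕ∞) φ → HasCompactSupport φ → ∀ t, 0 < t →
    DifferentiableAt ℝ (pairing u φ) t
  caputo : ∀ φ : ℝ × ℝ → ℝ, ContDiff ℝ (⊤ : ℕ∞) φ → HasCompactSupport φ → ∀ t, 0 < t →
    HasCaputoDeriv (1 / 2) (pairing u φ) t
  eqn : ∀ φ : ℝ × ℝ → ℝ, ContDiff ℝ (⊤ : ℕ∞) φ → HasCompactSupport φ → ∀ t, 0 < t →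
    deriv (pairing u φ) t + 2 * lam * caputoDeriv (1 / 2) (pairing u φ) t
      = c ^ 2 * pairing u (laplacian φ) t
  initial : ∀ φ : ℝ × ℝ → ℝ, ContDiff ℝ (⊤ : ℕ∞) φ → HasCompactSupport φ →
    Tendsto (pairing u φ) (𝓝[>] 0) (𝓝 (φ 0))

/-! ### The processes -/

/-- Planar Brownian motion, normalised so that `B(s)` has characteristic function
`exp (-s ‖ξ‖²)`, that is, each coordinate of `B(s)` has variance `2 s`. -/
structure IsPlanarBrownian {Ω : Type*} [MeasurableSpace Ω] (B : ℝ≥0 → Ω → ℝ × ℝ)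
    (P : Measure Ω) : Prop where
  measurable : ∀ s, Measurable (B s)
  fst : IsBrownianReal (fun s ω ↦ (B s ω).1 / √2) P
  snd : IsBrownianReal (fun s ω ↦ (B s ω).2 / √2) P
  indep : IndepFun (fun ω s ↦ (B s ω).1) (fun ω s ↦ (B s ω).2) P

/-- Stable subordinator of index `ν ∈ (0, 1)`: a non-decreasing right-continuous process started
at `0` with stationary independent increments and `E exp (-μ H(t)) = exp (-t μ^ν)`. -/
structure IsStableSubordinator {Ω : Type*} [MeasurableSpace Ω] (ν : ℝ) (H : ℝ≥0 → Ω → ℝ)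
    (P : Measure Ω) : Prop where
  measurable : ∀ s, Measurable (H s)
  zero : ∀ᵐ ω ∂P, H 0 ω = 0
  mono : ∀ᵐ ω ∂P, Monotone (fun s ↦ H s ω)
  rightCont : ∀ᵐ ω ∂P, ∀ s, ContinuousWithinAt (fun r ↦ H r ω) (Ici s) s
  indepIncrements : HasIndepIncrements H P
  laplace : ∀ s t : ℝ≥0, s ≤ t → ∀ μ : ℝ, 0 ≤ μ →
    ∫ ω, Real.exp (-μ * (H t ω - H s ω)) ∂P = Real.exp (-((t : ℝ) - s) * μ ^ ν)

/-- The inverse process `𝓛(t) = inf {s > 0 : s + (2 lam)² H(s) ≥ t}`. -/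
def inverseTime {Ω : Type*} (lam : ℝ) (H : ℝ≥0 → Ω → ℝ) (t : ℝ) (ω : Ω) : ℝ≥0 :=
  sInf {s : ℝ≥0 | 0 < s ∧ t ≤ (s : ℝ) + (2 * lam) ^ 2 * H s ω}

/-- The time-changed process `B(c² 𝓛(t))`. -/
def timeChanged {Ω : Type*} (lam c : ℝ) (B : ℝ≥0 → Ω → ℝ × ℝ) (H : ℝ≥0 → Ω → ℝ) (t : ℝ)
    (ω : Ω) : ℝ × ℝ :=
  B (Real.toNNReal (c ^ 2) * inverseTime lam H t ω) ω

end PlanarTelegraph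

end

namespace PlanarTelegraph

/-! ### The fundamental theorem of calculus for nonnegative derivatives -/

/-! Write $p=p_{|B|}$ and let $h(s,t)=\frac{s}{2t}p(s,t)$, the density of $H^{1/2}(s)$. Both come
from $S(s,t)=\operatorname{erfc}(s/(2\sqrt t))$: $p=-\partial_sS$ and $h=\partial_tS$. The
half-order integral of $h$ is $p$ and that of $p$ is $S$, so the Riemann–Liouville derivative of $p$
is $h$ (`rlDeriv_reflDensity`). The tail of $\mathscr L^{1/2}(t)$ is $P(\mathscr
L(t)>\ell)=P(\ell+(2\lambda)^2H(\ell)<t)=S(2\lambda\ell,t-\ell)$, hence its density is $2\lambda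
p+h$ at $(2\lambda\ell,t-\ell)$.

Relaxation. For $u(t)=\mathbb E\,G(\mathscr L(t))$, integration by parts and Fubini give $u'(t)=\int
h(2\lambda\ell,t-\ell)G'(\ell)\,d\ell$, while the half-order Caputo derivative is $\int
p(2\lambda\ell,t-\ell)G'(\ell)\,d\ell$. The combination $\partial_t+2\lambda\,{}^C\partial_t^{1/2}$
restores the density, so it maps $\mathbb E\,G(\mathscr L(t))$ to $\mathbb E\,G'(\mathscr L(t))$
(`relax_equation`). If $G$ solves the heat equation in $\ell$, the fractional equation follows.

Identification. The function $\mathfrak q$ is the average of the heat kernel at time $c^2\mathscr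
L(t)$ (`composedLaw_eq_relax`). With $w=(x^2+y^2)/c^2$, the substitution $s=(u+w/u)/2$ merges the
two exponentials of $\mathfrak r$ into one integral over $u>0$. Its Laplace transform in $t$ matches
that of the average after $u=2\sqrt\mu\,\ell$, and uniqueness of Laplace transforms with continuity
gives equality for every $t>0$.

Conclusion. Off the origin, $G$ is the heat kernel at a fixed point, and spatial smoothness comes
from a moment generating function. Weakly, $G$ is the heat semigroup applied to a test function. For
the law, independence is used along a countably valued approximation of $\mathscr L(t)$ and path
continuity of $\boldsymbol B_2$ passes to the limit; this gives the same averages. -/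

theorem integrableOn_Ioo_of_hasDerivAt_nonneg {g g' : ℝ → ℝ} {a b la lb : ℝ} (hab : a < b)
    (hderiv : ∀ x ∈ Ioo a b, HasDerivAt g (g' x) x) (hpos : ∀ x ∈ Ioo a b, 0 ≤ g' x)
    (ha : Tendsto g (𝓝[>] a) (𝓝 la)) (hb : Tendsto g (𝓝[<] b) (𝓝 lb)) :
    IntegrableOn g' (Ioo a b) ∧ ∫ x in Ioo a b, g' x = lb - la := by
  -- Replacing the endpoint values of `g` by its one-sided limits gives continuity on the closed
  -- interval; the sign of the derivative then yields integrability without a bound.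
  have hcont : ContinuousOn (Function.update (Function.update g a la) b lb) (Icc a b) := by
    rw [continuousOn_update_iff, continuousOn_update_iff, Icc_sdiff_right, Ico_sdiff_left]
    refine ⟨⟨fun z hz ↦ (hderiv z hz).continuousAt.continuousWithinAt,
      fun _ ↦ ha.mono_left (nhdsWithin_mono _ Ioo_subset_Ioi_self)⟩, fun _ ↦ ?_⟩
    refine (hb.congr' ?_).mono_left (nhdsWithin_mono _ Ico_subset_Iio_self)
    filter_upwards [Ioo_mem_nhdsLT hab] with _ hz using (Function.update_of_ne hz.1.ne' _ _).symm
  have hd : ∀ x ∈ Ioo a b,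
      HasDerivAt (Function.update (Function.update g a la) b lb) (g' x) x := by
    intro x hx
    refine (hderiv x hx).congr_of_eventuallyEq ?_
    filter_upwards [Ioo_mem_nhds hx.1 hx.2] with y hy
    rw [Function.update_of_ne hy.2.ne, Function.update_of_ne hy.1.ne']
  have hint : IntegrableOn g' (Ioc a b) :=
    intervalIntegral.integrableOn_deriv_of_nonneg hcont hd hpos
  refine ⟨hint.mono_set Ioo_subset_Ioc_self, ?_⟩
  rw [← integral_Ioc_eq_integral_Ioo, ← intervalIntegral.integral_of_le hab.le]
  exact intervalIntegral.integral_eq_sub_of_hasDerivAt_of_tendsto hab hderiv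
    ((intervalIntegrable_iff_integrableOn_Ioc_of_le hab.le).2 hint) ha hb

theorem integrableOn_Ioi_of_hasDerivAt_nonneg {g g' : ℝ → ℝ} {a la l : ℝ}
    (hderiv : ∀ x ∈ Ioi a, HasDerivAt g (g' x) x) (hpos : ∀ x ∈ Ioi a, 0 ≤ g' x)
    (ha : Tendsto g (𝓝[>] a) (𝓝 la)) (hl : Tendsto g atTop (𝓝 l)) :
    IntegrableOn g' (Ioi a) ∧ ∫ x in Ioi a, g' x = l - la := by
  have hcont : ContinuousWithinAt (Function.update g a la) (Ici a) a := by
    rw [continuousWithinAt_update_same]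
    simpa using ha
  have hd : ∀ x ∈ Ioi a, HasDerivAt (Function.update g a la) (g' x) x := by
    intro x hx
    refine (hderiv x hx).congr_of_eventuallyEq ?_
    filter_upwards [Ioi_mem_nhds hx] with y hy
    rw [Function.update_of_ne (ne_of_gt hy)]
  have hl' : Tendsto (Function.update g a la) atTop (𝓝 l) := by
    refine hl.congr' ?_
    filter_upwards [Ioi_mem_atTop a] with y hy
    rw [Function.update_of_ne (ne_of_gt hy)]
  refine ⟨integrableOn_Ioi_deriv_of_nonneg hcont hd hpos hl', ?_⟩
  simpa using integral_Ioi_of_hasDerivAt_of_nonneg hcont hd hpos hl'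

/-! ### The complementary error function -/

/-- The complementary error function. -/
noncomputable def erfc (x : ℝ) : ℝ :=
  1 - 2 / √Real.pi * ∫ y in (0 : ℝ)..x, Real.exp (-y ^ 2)

theorem erfc_zero : erfc 0 = 1 := by simp [erfc]

theorem hasDerivAt_erfc (x : ℝ) :
    HasDerivAt erfc (-(2 / √Real.pi * Real.exp (-x ^ 2))) x := by
  have hc : Continuous fun y : ℝ ↦ Real.exp (-y ^ 2) := by fun_prop
  have := intervalIntegral.integral_hasDerivAt_right (hc.intervalIntegrable 0 x)
    (hc.stronglyMeasurableAtFilter _ _) hc.continuousAt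
  exact (this.const_mul _).const_sub 1

theorem continuous_erfc : Continuous erfc :=
  continuous_iff_continuousAt.2 fun x ↦ (hasDerivAt_erfc x).continuousAt

theorem erfc_neg (x : ℝ) : erfc (-x) = 2 - erfc x := by
  have h : ∫ y in (0 : ℝ)..(-x), Real.exp (-y ^ 2) = -∫ y in (0 : ℝ)..x, Real.exp (-y ^ 2) := by
    have := intervalIntegral.integral_comp_neg (a := 0) (b := x) fun y : ℝ ↦ Real.exp (-y ^ 2)
    simp only [neg_sq, neg_zero] at this
    rw [intervalIntegral.integral_symm, ← this]
  rw [erfc, erfc, h]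
  ring

theorem tendsto_erfc_atTop : Tendsto erfc atTop (𝓝 0) := by
  have hi : IntegrableOn (fun y : ℝ ↦ Real.exp (-y ^ 2)) (Ioi 0) := by
    simpa using (integrable_exp_neg_mul_sq (b := 1) one_pos).integrableOn
  have h := intervalIntegral_tendsto_integral_Ioi 0 hi tendsto_id
  have hv : ∫ y in Ioi (0 : ℝ), Real.exp (-y ^ 2) = √Real.pi / 2 := by
    simpa using integral_gaussian_Ioi 1
  rw [hv] at h
  have h2 := (h.const_mul (2 / √Real.pi)).const_sub 1
  have hpi : √Real.pi ≠ 0 := by positivity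
  have : (1 : ℝ) - 2 / √Real.pi * (√Real.pi / 2) = 0 := by field_simp; norm_num
  rw [this] at h2
  exact h2

theorem tendsto_erfc_atBot : Tendsto erfc atBot (𝓝 2) := by
  have h := (tendsto_erfc_atTop.comp tendsto_neg_atBot_atTop).const_sub 2
  rw [sub_zero] at h
  refine h.congr fun x ↦ ?_
  simp [erfc_neg]

/-! ### Densities of reflecting Brownian motion and of its hitting times -/

/-- Density at `t` of the hitting time of level `s` by a Brownian motion of variance `2t`. -/
noncomputable def hitDensity (s t : ℝ) : ℝ := s / (2 * t) * reflDensity s t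

theorem reflDensity_nonneg (s t : ℝ) : 0 ≤ reflDensity s t := by
  unfold reflDensity; positivity

/-- The conventions for square roots of nonpositive numbers and for division by zero make the
densities vanish at nonpositive times. Convolutions over `ℓ > 0` are therefore cut off at `ℓ = t`
automatically. -/
theorem reflDensity_of_nonpos (s : ℝ) {t : ℝ} (ht : t ≤ 0) : reflDensity s t = 0 := by
  rw [reflDensity, Real.sqrt_eq_zero_of_nonpos, div_zero]
  exact mul_nonpos_of_nonneg_of_nonpos Real.pi_pos.le ht

theorem hitDensity_of_nonpos (s : ℝ) {t : ℝ} (ht : t ≤ 0) : hitDensity s t = 0 := by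
  rw [hitDensity, reflDensity_of_nonpos s ht, mul_zero]

theorem hitDensity_nonneg {s : ℝ} (hs : 0 ≤ s) (t : ℝ) : 0 ≤ hitDensity s t := by
  rcases le_or_gt t 0 with ht | ht
  · rw [hitDensity_of_nonpos s ht]
  · have := reflDensity_nonneg s t
    unfold hitDensity; positivity

theorem measurable_reflDensity : Measurable fun x : ℝ × ℝ ↦ reflDensity x.1 x.2 := by
  unfold reflDensity; fun_prop

theorem measurable_hitDensity : Measurable fun x : ℝ × ℝ ↦ hitDensity x.1 x.2 := by
  unfold hitDensity
  exact (by fun_prop : Measurable fun x : ℝ × ℝ ↦ x.1 / (2 * x.2)).mul measurable_reflDensity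

/-- Together with `hasDerivAt_erfc_time`, this makes `p` and `h` the two partial derivatives, up to
sign, of one function, from which most of the integrals are read off. -/
theorem hasDerivAt_erfc_space (s : ℝ) {t : ℝ} (ht : 0 < t) :
    HasDerivAt (fun σ ↦ erfc (σ / (2 * √t))) (-reflDensity s t) s := by
  have h := (hasDerivAt_erfc (s / (2 * √t))).comp s ((hasDerivAt_id s).div_const (2 * √t))
  refine h.congr_deriv ?_
  have h1 : √t ≠ 0 := by positivity
  have h2 : √Real.pi ≠ 0 := by positivity
  rw [reflDensity, div_pow, mul_pow, Real.sq_sqrt ht.le, Real.sqrt_mul Real.pi_pos.le, neg_div,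
    show (2 : ℝ) ^ 2 = 4 by norm_num]
  field_simp

theorem hasDerivAt_div_sqrt (s : ℝ) {t : ℝ} (ht : 0 < t) :
    HasDerivAt (fun τ ↦ s / (2 * √τ)) (-(s / (4 * t * √t))) t := by
  have h1 : √t ≠ 0 := by positivity
  have h := (((hasDerivAt_id t).sqrt ht.ne').const_mul 2).fun_inv (by simp [h1]) |>.const_mul s
  simp only [id] at h
  refine (h.congr_deriv ?_)
  rw [mul_pow, Real.sq_sqrt ht.le]
  field_simp
  norm_num

theorem hasDerivAt_erfc_time (s : ℝ) {t : ℝ} (ht : 0 < t) :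
    HasDerivAt (fun τ ↦ erfc (s / (2 * √τ))) (hitDensity s t) t := by
  have h := (hasDerivAt_erfc (s / (2 * √t))).comp t (hasDerivAt_div_sqrt s ht)
  refine h.congr_deriv ?_
  have h1 : √t ≠ 0 := by positivity
  have h2 : √Real.pi ≠ 0 := by positivity
  rw [hitDensity, reflDensity, div_pow, mul_pow, Real.sq_sqrt ht.le, Real.sqrt_mul Real.pi_pos.le,
    neg_div, show (2 : ℝ) ^ 2 = 4 by norm_num]
  field_simp
  ring

theorem tendsto_div_sqrt_atTop {s : ℝ} (hs : 0 < s) :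
    Tendsto (fun τ ↦ s / (2 * √τ)) (𝓝[>] 0) atTop := by
  have h : Tendsto (fun τ : ℝ ↦ 2 * √τ) (𝓝[>] 0) (𝓝[>] 0) := by
    refine tendsto_nhdsWithin_iff.2 ⟨?_, ?_⟩
    · have : Continuous fun τ : ℝ ↦ 2 * √τ := by fun_prop
      simpa using (this.tendsto 0).mono_left nhdsWithin_le_nhds
    · filter_upwards [self_mem_nhdsWithin] with τ hτ
      have : 0 < √τ := Real.sqrt_pos.2 hτ
      simpa using this
  exact (tendsto_inv_nhdsGT_zero.comp h).const_mul_atTop hs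

theorem tendsto_erfc_time_zero {s : ℝ} (hs : 0 < s) :
    Tendsto (fun τ ↦ erfc (s / (2 * √τ))) (𝓝[>] 0) (𝓝 0) :=
  tendsto_erfc_atTop.comp (tendsto_div_sqrt_atTop hs)

theorem integral_hitDensity_Ioo {s t : ℝ} (hs : 0 < s) (ht : 0 < t) :
    IntegrableOn (hitDensity s) (Ioo 0 t) ∧
      ∫ τ in Ioo 0 t, hitDensity s τ = erfc (s / (2 * √t)) := by
  have h := integrableOn_Ioo_of_hasDerivAt_nonneg ht
    (fun τ hτ ↦ hasDerivAt_erfc_time s hτ.1) (fun τ _ ↦ hitDensity_nonneg hs.le τ)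
    (tendsto_erfc_time_zero hs)
    ((hasDerivAt_erfc_time s ht).continuousAt.tendsto.mono_left nhdsWithin_le_nhds)
  simpa using h

/-! ### Laplace transforms in time -/

/-- Completing the square, with `e = ±1` the sign of the cross term. -/
theorem exp_mul_exp_neg_sq {s t μ : ℝ} (ht : 0 < t) (hμ : 0 ≤ μ) (e : ℝ) (he : e ^ 2 = 1) :
    Real.exp (e * (s * √μ)) * Real.exp (-(s / (2 * √t) + e * (√μ * √t)) ^ 2)
      = Real.exp (-μ * t) * Real.exp (-s ^ 2 / (4 * t)) := by
  rw [← Real.exp_add, ← Real.exp_add]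
  congr 1
  have h1 : √t ≠ 0 := by positivity
  have h2 : (s / (2 * √t)) * (√μ * √t) = s * √μ / 2 := by field_simp
  have h3 : (s / (2 * √t)) ^ 2 = s ^ 2 / (4 * t) := by
    rw [div_pow, mul_pow, Real.sq_sqrt ht.le]; norm_num
  have h4 : (√μ * √t) ^ 2 = μ * t := by rw [mul_pow, Real.sq_sqrt ht.le, Real.sq_sqrt hμ]
  have : (s / (2 * √t) + e * (√μ * √t)) ^ 2 = s ^ 2 / (4 * t) + e * (s * √μ) + μ * t := by
    rw [add_sq, h3, mul_pow, he, h4]; linear_combination (2 * e) * h2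
  rw [this]
  ring

/-- The sum over `e = ±1` is a primitive of the Laplace integrand of `h`, and the difference one for
`p`, up to constants. -/
theorem hasDerivAt_exp_mul_erfc {s t μ : ℝ} (ht : 0 < t) (hμ : 0 ≤ μ) (e : ℝ) (he : e ^ 2 = 1) :
    HasDerivAt (fun τ ↦ Real.exp (e * (s * √μ)) * erfc (s / (2 * √τ) + e * (√μ * √τ)))
      (Real.exp (-μ * t) * (hitDensity s t - e * √μ * reflDensity s t)) t := by
  have hd : HasDerivAt (fun τ ↦ s / (2 * √τ) + e * (√μ * √τ))
      (-(s / (4 * t * √t)) + e * (√μ * (1 / (2 * √t)))) t := by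
    have h := (((hasDerivAt_id t).sqrt ht.ne').const_mul √μ).const_mul e
    exact (hasDerivAt_div_sqrt s ht).add h
  have h := ((hasDerivAt_erfc _).comp t hd).const_mul (Real.exp (e * (s * √μ)))
  refine h.congr_deriv ?_
  have h1 : √t ≠ 0 := by positivity
  have h2 : √Real.pi ≠ 0 := by positivity
  have hE := exp_mul_exp_neg_sq (s := s) ht hμ e he
  rw [hitDensity, reflDensity, Real.sqrt_mul Real.pi_pos.le]
  trans -(2 / √Real.pi) * (-(s / (4 * t * √t)) + e * (√μ * (1 / (2 * √t)))) *
    (Real.exp (e * (s * √μ)) * Real.exp (-(s / (2 * √t) + e * (√μ * √t)) ^ 2))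
  · ring
  rw [hE]
  field_simp
  ring

theorem tendsto_add_sqrt_zero {s : ℝ} (hs : 0 < s) (b : ℝ) :
    Tendsto (fun τ ↦ s / (2 * √τ) + b * √τ) (𝓝[>] 0) atTop := by
  have : Continuous fun τ : ℝ ↦ b * √τ := by fun_prop
  have h0 : Tendsto (fun τ : ℝ ↦ b * √τ) (𝓝[>] 0) (𝓝 0) := by
    simpa using (this.tendsto 0).mono_left nhdsWithin_le_nhds
  exact (tendsto_div_sqrt_atTop hs).atTop_add h0

theorem tendsto_div_sqrt_zero (s : ℝ) : Tendsto (fun τ ↦ s / (2 * √τ)) atTop (𝓝 0) :=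
  (Real.tendsto_sqrt_atTop.const_mul_atTop (by norm_num : (0 : ℝ) < 2)).const_div_atTop s

theorem tendsto_exp_mul_erfc_zero {s : ℝ} (hs : 0 < s) (μ e : ℝ) :
    Tendsto (fun τ ↦ Real.exp (e * (s * √μ)) * erfc (s / (2 * √τ) + e * (√μ * √τ)))
      (𝓝[>] 0) (𝓝 0) := by
  have h := (tendsto_erfc_atTop.comp (tendsto_add_sqrt_zero hs (e * √μ))).const_mul
    (Real.exp (e * (s * √μ)))
  simpa [Function.comp_def, mul_assoc] using h

theorem tendsto_exp_mul_erfc_add {μ : ℝ} (hμ : 0 < μ) (s : ℝ) :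
    Tendsto (fun τ ↦ Real.exp (1 * (s * √μ)) * erfc (s / (2 * √τ) + 1 * (√μ * √τ)))
      atTop (𝓝 0) := by
  have h : Tendsto (fun τ ↦ s / (2 * √τ) + 1 * (√μ * √τ)) atTop atTop := by
    refine (tendsto_div_sqrt_zero s).add_atTop ?_
    simpa using Real.tendsto_sqrt_atTop.const_mul_atTop (Real.sqrt_pos.2 hμ)
  simpa using (tendsto_erfc_atTop.comp h).const_mul (Real.exp (1 * (s * √μ)))

theorem tendsto_exp_mul_erfc_sub {μ : ℝ} (hμ : 0 < μ) (s : ℝ) :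
    Tendsto (fun τ ↦ Real.exp (-1 * (s * √μ)) * erfc (s / (2 * √τ) + -1 * (√μ * √τ)))
      atTop (𝓝 (2 * Real.exp (-(s * √μ)))) := by
  have h : Tendsto (fun τ ↦ s / (2 * √τ) + -1 * (√μ * √τ)) atTop atBot := by
    refine (tendsto_div_sqrt_zero s).add_atBot ?_
    simpa using (Real.tendsto_sqrt_atTop.const_mul_atTop (Real.sqrt_pos.2 hμ))
  have := (tendsto_erfc_atBot.comp h).const_mul (Real.exp (-1 * (s * √μ)))
  rw [mul_comm 2]
  simpa using this

theorem laplace_hitDensity {s μ : ℝ} (hs : 0 < s) (hμ : 0 < μ) :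
    IntegrableOn (fun t ↦ Real.exp (-μ * t) * hitDensity s t) (Ioi 0) ∧
      ∫ t in Ioi 0, Real.exp (-μ * t) * hitDensity s t = Real.exp (-(s * √μ)) := by
  have h := integrableOn_Ioi_of_hasDerivAt_nonneg (a := 0) (g' := fun t ↦
      Real.exp (-μ * t) * hitDensity s t)
    (fun t ht ↦ ((((hasDerivAt_exp_mul_erfc (s := s) ht hμ.le 1 (by norm_num)).add
      (hasDerivAt_exp_mul_erfc (s := s) ht hμ.le (-1) (by norm_num))).const_mul
        (1 / 2)).congr_deriv (by ring)))
    (fun t _ ↦ mul_nonneg (Real.exp_pos _).le (hitDensity_nonneg hs.le t))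
    (((tendsto_exp_mul_erfc_zero hs μ 1).add (tendsto_exp_mul_erfc_zero hs μ (-1))).const_mul
      (1 / 2))
    (((tendsto_exp_mul_erfc_add hμ s).add (tendsto_exp_mul_erfc_sub hμ s)).const_mul (1 / 2))
  refine ⟨h.1, h.2.trans (by ring)⟩

theorem laplace_reflDensity {s μ : ℝ} (hs : 0 < s) (hμ : 0 < μ) :
    IntegrableOn (fun t ↦ Real.exp (-μ * t) * reflDensity s t) (Ioi 0) ∧
      ∫ t in Ioi 0, Real.exp (-μ * t) * reflDensity s t = Real.exp (-(s * √μ)) / √μ := by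
  have hm : √μ ≠ 0 := by positivity
  have h := integrableOn_Ioi_of_hasDerivAt_nonneg (a := 0) (g' := fun t ↦
      Real.exp (-μ * t) * reflDensity s t)
    (fun t ht ↦ ((((hasDerivAt_exp_mul_erfc (s := s) ht hμ.le (-1) (by norm_num)).sub
      (hasDerivAt_exp_mul_erfc (s := s) ht hμ.le 1 (by norm_num))).const_mul
        (1 / (2 * √μ))).congr_deriv (by field_simp; ring)))
    (fun t _ ↦ mul_nonneg (Real.exp_pos _).le (reflDensity_nonneg s t))
    (((tendsto_exp_mul_erfc_zero hs μ (-1)).sub (tendsto_exp_mul_erfc_zero hs μ 1)).const_mul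
      (1 / (2 * √μ)))
    (((tendsto_exp_mul_erfc_sub hμ s).sub (tendsto_exp_mul_erfc_add hμ s)).const_mul
      (1 / (2 * √μ)))
  refine ⟨h.1, h.2.trans (by field_simp; ring)⟩

theorem integral_hitDensity_Ioi {s : ℝ} (hs : 0 < s) :
    IntegrableOn (hitDensity s) (Ioi 0) ∧ ∫ t in Ioi 0, hitDensity s t = 1 := by
  have h := integrableOn_Ioi_of_hasDerivAt_nonneg
    (fun τ hτ ↦ hasDerivAt_erfc_time s hτ) (fun τ _ ↦ hitDensity_nonneg hs.le τ)
    (tendsto_erfc_time_zero hs)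
    ((continuous_erfc.tendsto 0).comp (tendsto_div_sqrt_zero s))
  simpa [erfc_zero] using h

/-! ### Half-order integrals of the densities -/

theorem integrable_prod_restrict_of_nonneg {f : ℝ → ℝ → ℝ} {S T : Set ℝ} (hS : MeasurableSet S)
    (hT : MeasurableSet T) (hf : Measurable (Function.uncurry f))
    (hpos : ∀ x ∈ S, ∀ y ∈ T, 0 ≤ f x y) (h₁ : ∀ x ∈ S, IntegrableOn (f x) T)
    (h₂ : IntegrableOn (fun x ↦ ∫ y in T, f x y) S) :
    Integrable (Function.uncurry f) ((volume.restrict S).prod (volume.restrict T)) := by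
  refine (integrable_prod_iff hf.aestronglyMeasurable).2 ⟨?_, ?_⟩
  · filter_upwards [ae_restrict_mem hS] with x hx using h₁ x hx
  · refine h₂.congr ?_
    filter_upwards [ae_restrict_mem hS] with x hx
    refine setIntegral_congr_fun hT fun y hy ↦ ?_
    exact (Real.norm_of_nonneg (hpos x hx y hy)).symm

/-- In Laplace variables this is $e^{-s\sqrt\mu}\cdot\sqrt{\pi/\mu}$. The primitive comes from
$y=\frac s2\sqrt{1/\tau-1/t}$, since $e^{-s^2/(4\tau)}=e^{-s^2/(4t)}e^{-y^2}$ turns the integrand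
into a Gaussian. -/
theorem halfIntegral_hitDensity {s t : ℝ} (hs : 0 < s) (ht : 0 < t) :
    IntegrableOn (fun τ ↦ hitDensity s τ / (t - τ) ^ (1 / 2 : ℝ)) (Ioo 0 t) ∧
      ∫ τ in Ioo 0 t, hitDensity s τ / (t - τ) ^ (1 / 2 : ℝ) = √Real.pi * reflDensity s t := by
  have hpi : √Real.pi ≠ 0 := by positivity
  have hst : √t ≠ 0 := by positivity
  have h := integrableOn_Ioo_of_hasDerivAt_nonneg
    (g := fun τ ↦ √Real.pi * reflDensity s t * erfc (s / 2 * √(1 / τ - 1 / t)))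
    (g' := fun τ ↦ hitDensity s τ / (t - τ) ^ (1 / 2 : ℝ)) (la := 0)
    (lb := √Real.pi * reflDensity s t) ht ?_ ?_ ?_ ?_
  · simpa using h
  · intro τ hτ
    have h0 := hτ.1
    have hd : 0 < t - τ := sub_pos.2 hτ.2
    have hx : 1 / τ - 1 / t = (t - τ) / (t * τ) := by field_simp
    have hx0 : 0 < 1 / τ - 1 / t := by rw [hx]; positivity
    have h1 : HasDerivAt (fun τ : ℝ ↦ 1 / τ - 1 / t) (-(τ ^ 2)⁻¹) τ := by
      simpa using (hasDerivAt_inv h0.ne').sub_const (1 / t)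
    have h2 := ((hasDerivAt_erfc _).comp τ ((h1.sqrt hx0.ne').const_mul (s / 2))).const_mul
      (√Real.pi * reflDensity s t)
    refine h2.congr_deriv ?_
    have hsτ : √τ ≠ 0 := by positivity
    have hsd : √(t - τ) ≠ 0 := by positivity
    have hE : Real.exp (-s ^ 2 / (4 * t)) * Real.exp (-(s / 2 * √(1 / τ - 1 / t)) ^ 2)
        = Real.exp (-s ^ 2 / (4 * τ)) := by
      rw [← Real.exp_add, mul_pow, Real.sq_sqrt hx0.le]
      congr 1
      field_simp
      ring
    rw [hitDensity, reflDensity, reflDensity, ← hE, ← Real.sqrt_eq_rpow,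
      Real.sqrt_mul Real.pi_pos.le, Real.sqrt_mul Real.pi_pos.le, hx, Real.sqrt_div hd.le,
      Real.sqrt_mul ht.le]
    field_simp
    rw [Real.sq_sqrt h0.le]
  · intro τ hτ
    have hd : 0 ≤ t - τ := sub_nonneg.2 hτ.2.le
    exact div_nonneg (hitDensity_nonneg hs.le τ) (Real.rpow_nonneg hd _)
  · have h1 : Tendsto (fun τ : ℝ ↦ 1 / τ - 1 / t) (𝓝[>] 0) atTop := by
      simpa [sub_eq_add_neg] using tendsto_atTop_add_const_right _ (-(1 / t))
        (tendsto_inv_nhdsGT_zero (𝕜 := ℝ))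
    have h2 := (tendsto_erfc_atTop.comp ((Real.tendsto_sqrt_atTop.comp h1).const_mul_atTop
      (half_pos hs))).const_mul (√Real.pi * reflDensity s t)
    simpa using h2
  · have h1 : ContinuousAt (fun τ : ℝ ↦ √Real.pi * reflDensity s t *
        erfc (s / 2 * √(1 / τ - 1 / t))) t := by
      have := continuous_erfc
      have h3 : ContinuousAt (fun τ : ℝ ↦ 1 / τ) t := by
        simpa using continuousAt_inv₀ ht.ne'
      fun_prop
    have h2 := h1.tendsto.mono_left (nhdsWithin_le_nhds (s := Iio t))
    simpa [erfc_zero] using h2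

theorem integral_reflDensity_Ioi (s : ℝ) {t : ℝ} (ht : 0 < t) :
    IntegrableOn (fun σ ↦ reflDensity σ t) (Ioi s) ∧
      ∫ σ in Ioi s, reflDensity σ t = erfc (s / (2 * √t)) := by
  have hl : Tendsto (fun σ ↦ -erfc (σ / (2 * √t))) atTop (𝓝 (-0)) :=
    (tendsto_erfc_atTop.comp (tendsto_id.atTop_div_const (by positivity))).neg
  have h := integrableOn_Ioi_of_hasDerivAt_nonneg (a := s)
    (fun σ _ ↦ ((hasDerivAt_erfc_space σ ht).neg).congr_deriv (neg_neg _))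
    (fun σ _ ↦ reflDensity_nonneg σ t)
    ((hasDerivAt_erfc_space s ht).neg.continuousAt.tendsto.mono_left nhdsWithin_le_nhds) hl
  simpa using h

theorem hasDerivAt_reflDensity_space (s t : ℝ) :
    HasDerivAt (fun σ ↦ reflDensity σ t) (-hitDensity s t) s := by
  have h : HasDerivAt (fun σ : ℝ ↦ -σ ^ 2 / (4 * t)) (-(s / (2 * t))) s := by
    refine (((hasDerivAt_pow 2 s).neg).div_const (4 * t)).congr_deriv ?_
    rcases eq_or_ne t 0 with rfl | ht
    · simp
    · field_simp; ring
  refine (h.exp.div_const √(Real.pi * t)).congr_deriv ?_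
  rw [hitDensity, reflDensity]
  ring

theorem tendsto_reflDensity_space {t : ℝ} (ht : 0 < t) :
    Tendsto (fun σ ↦ reflDensity σ t) atTop (𝓝 0) := by
  have h : Tendsto (fun σ : ℝ ↦ -σ ^ 2 / (4 * t)) atTop atBot := by
    refine Tendsto.atBot_div_const (by positivity) ?_
    exact tendsto_neg_atTop_atBot.comp (tendsto_pow_atTop two_ne_zero)
  simpa [reflDensity] using (Real.tendsto_exp_atBot.comp h).div_const √(Real.pi * t)

theorem integral_hitDensity_space {s t : ℝ} (hs : 0 ≤ s) (ht : 0 < t) :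
    IntegrableOn (fun σ ↦ hitDensity σ t) (Ioi s) ∧
      ∫ σ in Ioi s, hitDensity σ t = reflDensity s t := by
  have h := integrableOn_Ioi_of_hasDerivAt_nonneg (a := s)
    (fun σ _ ↦ ((hasDerivAt_reflDensity_space σ t).neg).congr_deriv (neg_neg _))
    (fun σ hσ ↦ hitDensity_nonneg (hs.trans (le_of_lt hσ)) t)
    ((hasDerivAt_reflDensity_space s t).neg.continuousAt.tendsto.mono_left nhdsWithin_le_nhds)
    (tendsto_reflDensity_space ht).neg
  simpa using h

/-- Since $p(s,\tau)=\int_s^\infty h(\sigma,\tau)\,d\sigma$, Fubini reduces this to the half-order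
integral of `h` and to the spatial tail of `p`. -/
theorem halfIntegral_reflDensity {s t : ℝ} (hs : 0 < s) (ht : 0 < t) :
    IntegrableOn (fun τ ↦ reflDensity s τ / (t - τ) ^ (1 / 2 : ℝ)) (Ioo 0 t) ∧
      ∫ τ in Ioo 0 t, reflDensity s τ / (t - τ) ^ (1 / 2 : ℝ)
        = √Real.pi * erfc (s / (2 * √t)) := by
  have hpos : ∀ σ ∈ Ioi s, ∀ τ ∈ Ioo 0 t, 0 ≤ hitDensity σ τ / (t - τ) ^ (1 / 2 : ℝ) :=
    fun σ hσ τ hτ ↦ div_nonneg (hitDensity_nonneg (hs.le.trans (le_of_lt hσ)) τ)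
      (Real.rpow_nonneg (sub_nonneg.2 hτ.2.le) _)
  have hval : ∀ σ ∈ Ioi s, ∫ τ in Ioo 0 t, hitDensity σ τ / (t - τ) ^ (1 / 2 : ℝ)
      = √Real.pi * reflDensity σ t :=
    fun σ hσ ↦ (halfIntegral_hitDensity (hs.trans hσ) ht).2
  have hint : Integrable (Function.uncurry fun σ τ ↦ hitDensity σ τ / (t - τ) ^ (1 / 2 : ℝ))
      ((volume.restrict (Ioi s)).prod (volume.restrict (Ioo 0 t))) := by
    refine integrable_prod_restrict_of_nonneg measurableSet_Ioi measurableSet_Ioo ?_ hpos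
      (fun σ hσ ↦ (halfIntegral_hitDensity (hs.trans hσ) ht).1) ?_
    · exact measurable_hitDensity.div
        (by fun_prop : Measurable fun x : ℝ × ℝ ↦ (t - x.2) ^ (1 / 2 : ℝ))
    · exact (((integral_reflDensity_Ioi s ht).1.const_mul √Real.pi).congr
        ((ae_restrict_mem measurableSet_Ioi).mono fun σ hσ ↦ (hval σ hσ).symm))
  have hinner : ∀ τ ∈ Ioo 0 t, ∫ σ in Ioi s, hitDensity σ τ / (t - τ) ^ (1 / 2 : ℝ)
      = reflDensity s τ / (t - τ) ^ (1 / 2 : ℝ) := by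
    intro τ hτ
    rw [integral_div, (integral_hitDensity_space hs.le hτ.1).2]
  constructor
  · refine hint.integral_prod_right.congr ?_
    filter_upwards [ae_restrict_mem measurableSet_Ioo] with τ hτ using hinner τ hτ
  · rw [← setIntegral_congr_fun measurableSet_Ioo hinner, ← integral_integral_swap hint,
      setIntegral_congr_fun measurableSet_Ioi hval, integral_const_mul,
      (integral_reflDensity_Ioi s ht).2]

theorem intervalIntegral_reflDensity {s t : ℝ} (hs : 0 < s) (ht : 0 < t) :
    ∫ τ in (0 : ℝ)..t, reflDensity s τ / (t - τ) ^ (1 / 2 : ℝ) = √Real.pi * erfc (s / (2 * √t)) := by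
  rw [intervalIntegral.integral_of_le ht.le, integral_Ioc_eq_integral_Ioo,
    (halfIntegral_reflDensity hs ht).2]

theorem hasDerivAt_halfIntegral_reflDensity {s t : ℝ} (hs : 0 < s) (ht : 0 < t) :
    HasDerivAt (fun u ↦ ∫ τ in (0 : ℝ)..u, reflDensity s τ / (u - τ) ^ (1 / 2 : ℝ))
      (√Real.pi * hitDensity s t) t := by
  refine ((hasDerivAt_erfc_time s ht).const_mul √Real.pi).congr_of_eventuallyEq ?_
  filter_upwards [Ioi_mem_nhds ht] with u hu using intervalIntegral_reflDensity hs hu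

theorem hasRLDeriv_reflDensity {s t : ℝ} (hs : 0 < s) (ht : 0 < t) :
    HasRLDeriv (1 / 2) (fun τ ↦ reflDensity s τ) t where
  integrable := (intervalIntegrable_iff_integrableOn_Ioo_of_le ht.le).2
    (halfIntegral_reflDensity hs ht).1
  differentiableAt := (hasDerivAt_halfIntegral_reflDensity hs ht).differentiableAt

theorem one_div_Gamma_half : 1 / Real.Gamma (1 - 1 / 2) = 1 / √Real.pi := by
  rw [show (1 : ℝ) - 1 / 2 = 1 / 2 by norm_num, Real.Gamma_one_half_eq]

/-- Removes the fractional derivative from the definition of `𝔮`: the time factor becomes the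
explicit nonnegative kernel `p + h / (2 lam)`. -/
theorem rlDeriv_reflDensity {s t : ℝ} (hs : 0 < s) (ht : 0 < t) :
    rlDeriv (1 / 2) (fun τ ↦ reflDensity s τ) t = hitDensity s t := by
  have hpi : √Real.pi ≠ 0 := by positivity
  rw [rlDeriv, (hasDerivAt_halfIntegral_reflDensity hs ht).deriv, one_div_Gamma_half]
  field_simp

/-! ### The density of the inverse process -/

/-- Density at `ℓ` of the inverse process `𝓛(t)`. -/
noncomputable def inverseDensity (lam t ℓ : ℝ) : ℝ :=
  2 * lam * reflDensity (2 * lam * ℓ) (t - ℓ) + hitDensity (2 * lam * ℓ) (t - ℓ)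

theorem inverseDensity_of_le (lam : ℝ) {t ℓ : ℝ} (h : t ≤ ℓ) : inverseDensity lam t ℓ = 0 := by
  rw [inverseDensity, reflDensity_of_nonpos _ (sub_nonpos.2 h),
    hitDensity_of_nonpos _ (sub_nonpos.2 h), mul_zero, add_zero]

theorem inverseDensity_nonneg {lam ℓ : ℝ} (hlam : 0 < lam) (hℓ : 0 ≤ ℓ) (t : ℝ) :
    0 ≤ inverseDensity lam t ℓ :=
  add_nonneg (mul_nonneg (by positivity) (reflDensity_nonneg _ _))
    (hitDensity_nonneg (by positivity) _)

theorem measurable_inverseDensity (lam : ℝ) :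
    Measurable fun x : ℝ × ℝ ↦ inverseDensity lam x.1 x.2 := by
  have h : Measurable fun x : ℝ × ℝ ↦ (2 * lam * x.2, x.1 - x.2) := by fun_prop
  exact ((measurable_reflDensity.comp h).const_mul (2 * lam)).add (measurable_hitDensity.comp h)

/-- The differentiated function is the tail $P(\mathscr L(t)>m)=P(H(m)<(t-m)/(2\lambda)^2)$, which
explains the two terms of the density: one from each occurrence of `m`. -/
theorem hasDerivAt_erfc_inverse (lam : ℝ) {t ℓ : ℝ} (h : ℓ < t) :
    HasDerivAt (fun m ↦ erfc (2 * lam * m / (2 * √(t - m)))) (-inverseDensity lam t ℓ) ℓ := by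
  have hτ : 0 < t - ℓ := sub_pos.2 h
  have h1 : HasDerivAt (fun m ↦ 1 / (2 * √(t - m))) (1 / (4 * (t - ℓ) * √(t - ℓ))) ℓ := by
    have := (hasDerivAt_div_sqrt 1 hτ).comp ℓ ((hasDerivAt_id ℓ).const_sub t)
    exact this.congr_deriv (by ring)
  have h2 : HasDerivAt (fun m ↦ 2 * lam * m / (2 * √(t - m)))
      (2 * lam * (1 / (2 * √(t - ℓ))) + 2 * lam * ℓ * (1 / (4 * (t - ℓ) * √(t - ℓ)))) ℓ := by
    have := ((hasDerivAt_id ℓ).const_mul (2 * lam)).fun_mul h1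
    simpa [div_eq_mul_inv] using this
  refine ((hasDerivAt_erfc _).comp ℓ h2).congr_deriv ?_
  have h3 : √(t - ℓ) ≠ 0 := by positivity
  have h4 : √Real.pi ≠ 0 := by positivity
  rw [inverseDensity, hitDensity, reflDensity, div_pow, mul_pow 2 √(t - ℓ), Real.sq_sqrt hτ.le,
    Real.sqrt_mul Real.pi_pos.le, neg_div, show (2 : ℝ) ^ 2 = 4 by norm_num]
  field_simp
  ring

theorem tendsto_erfc_inverse {lam t : ℝ} (hlam : 0 < lam) (ht : 0 < t) :
    Tendsto (fun m ↦ erfc (2 * lam * m / (2 * √(t - m)))) (𝓝[<] t) (𝓝 0) := by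
  have h1 : Tendsto (fun m : ℝ ↦ t - m) (𝓝[<] t) (𝓝[>] 0) := by
    refine tendsto_nhdsWithin_iff.2 ⟨?_, ?_⟩
    · have : Continuous fun m : ℝ ↦ t - m := by fun_prop
      simpa using (this.tendsto t).mono_left nhdsWithin_le_nhds
    · filter_upwards [self_mem_nhdsWithin] with m hm using sub_pos.2 (mem_Iio.1 hm)
  have h2 := (tendsto_div_sqrt_atTop one_pos).comp h1
  have h3 : Tendsto (fun m : ℝ ↦ 2 * lam * m) (𝓝[<] t) (𝓝 (2 * lam * t)) :=
    (Continuous.tendsto (by fun_prop) t).mono_left nhdsWithin_le_nhds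
  refine tendsto_erfc_atTop.comp ((h3.pos_mul_atTop (by positivity) h2).congr fun m ↦ ?_)
  simp [div_eq_mul_inv]

theorem integral_inverseDensity_Ioi {lam t m : ℝ} (hlam : 0 < lam) (hm : 0 ≤ m) (h : m < t) :
    IntegrableOn (inverseDensity lam t) (Ioi m) ∧
      ∫ ℓ in Ioi m, inverseDensity lam t ℓ = erfc (2 * lam * m / (2 * √(t - m))) := by
  have h1 := integrableOn_Ioo_of_hasDerivAt_nonneg h
    (fun ℓ hℓ ↦ ((hasDerivAt_erfc_inverse lam hℓ.2).neg).congr_deriv (neg_neg _))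
    (fun ℓ hℓ ↦ inverseDensity_nonneg hlam (hm.trans hℓ.1.le) t)
    ((hasDerivAt_erfc_inverse lam h).neg.continuousAt.tendsto.mono_left nhdsWithin_le_nhds)
    (tendsto_erfc_inverse hlam (hm.trans_lt h)).neg
  have hz : ∀ ℓ ∈ Ioi m \ Ioo m t, inverseDensity lam t ℓ = 0 := by
    intro ℓ hℓ
    refine inverseDensity_of_le lam (not_lt.1 fun hlt ↦ hℓ.2 ⟨hℓ.1, hlt⟩)
  constructor
  · exact h1.1.of_forall_sdiff_eq_zero measurableSet_Ioi hz
  · rw [setIntegral_eq_of_subset_of_forall_sdiff_eq_zero measurableSet_Ioi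
      (Ioo_subset_Ioi_self) hz, h1.2]
    simp

theorem integral_inverseDensity {lam t : ℝ} (hlam : 0 < lam) (ht : 0 < t) :
    IntegrableOn (inverseDensity lam t) (Ioi 0) ∧
      ∫ ℓ in Ioi 0, inverseDensity lam t ℓ = 1 := by
  simpa [erfc_zero] using integral_inverseDensity_Ioi hlam le_rfl ht

theorem integrableOn_hitDensity_diag {lam t : ℝ} (hlam : 0 < lam) (ht : 0 < t) :
    IntegrableOn (fun ℓ ↦ hitDensity (2 * lam * ℓ) (t - ℓ)) (Ioi 0) ∧
      ∫ ℓ in Ioi 0, hitDensity (2 * lam * ℓ) (t - ℓ) ≤ 1 := by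
  have hle : ∀ ℓ ∈ Ioi (0 : ℝ), hitDensity (2 * lam * ℓ) (t - ℓ) ≤ inverseDensity lam t ℓ :=
    fun ℓ _ ↦ le_add_of_nonneg_left (mul_nonneg (by positivity) (reflDensity_nonneg _ _))
  have hpos : ∀ ℓ ∈ Ioi (0 : ℝ), 0 ≤ hitDensity (2 * lam * ℓ) (t - ℓ) :=
    fun ℓ hℓ ↦ hitDensity_nonneg (mul_nonneg (by positivity) (le_of_lt hℓ)) _
  have hm : Measurable fun ℓ ↦ hitDensity (2 * lam * ℓ) (t - ℓ) :=
    measurable_hitDensity.comp (by fun_prop : Measurable fun ℓ : ℝ ↦ (2 * lam * ℓ, t - ℓ))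
  have hi := integral_inverseDensity hlam ht
  have h1 : IntegrableOn (fun ℓ ↦ hitDensity (2 * lam * ℓ) (t - ℓ)) (Ioi 0) := by
    refine hi.1.mono' hm.aestronglyMeasurable ?_
    filter_upwards [ae_restrict_mem measurableSet_Ioi] with ℓ hℓ
    rw [Real.norm_of_nonneg (hpos ℓ hℓ)]
    exact hle ℓ hℓ
  exact ⟨h1, (setIntegral_mono_on h1 hi.1 measurableSet_Ioi hle).trans hi.2.le⟩

theorem integrableOn_reflDensity_diag {lam t : ℝ} (hlam : 0 < lam) (ht : 0 < t) :
    IntegrableOn (fun ℓ ↦ reflDensity (2 * lam * ℓ) (t - ℓ)) (Ioi 0) := by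
  have h := ((integral_inverseDensity hlam ht).1.sub
    (integrableOn_hitDensity_diag hlam ht).1).const_mul (2 * lam)⁻¹
  refine h.congr (ae_of_all _ fun ℓ ↦ ?_)
  simp only [inverseDensity, Pi.sub_apply]
  field_simp
  ring

/-- Because `g` vanishes at nonpositive arguments, the shift to the right by `ℓ` adds nothing on
`(0, ℓ]`. -/
theorem integrableOn_comp_sub {g : ℝ → ℝ} {t ℓ : ℝ} (hℓ : 0 ≤ ℓ) (hg : ∀ τ ≤ 0, g τ = 0)
    (hi : IntegrableOn g (Ioo 0 (t - ℓ))) :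
    IntegrableOn (fun r ↦ g (r - ℓ)) (Ioo 0 t) ∧
      ∫ r in Ioo 0 t, g (r - ℓ) = ∫ τ in Ioo 0 (t - ℓ), g τ := by
  have he : (Ioo 0 t).indicator (fun r ↦ g (r - ℓ))
      = fun r ↦ (Ioo 0 (t - ℓ)).indicator g (r - ℓ) := by
    ext r
    by_cases hr : r - ℓ ≤ 0
    · simp [indicator, hg _ hr]
    · have : r ∈ Ioo 0 t ↔ r - ℓ ∈ Ioo 0 (t - ℓ) := by
        constructor <;> rintro ⟨h1, h2⟩ <;> constructor <;> linarith
      simp [indicator, this]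
  constructor
  · rw [← integrable_indicator_iff measurableSet_Ioo, he]
    exact ((integrable_indicator_iff measurableSet_Ioo).2 hi).comp_sub_right ℓ
  · rw [← integral_indicator measurableSet_Ioo, he, integral_sub_right_eq_self
      ((Ioo 0 (t - ℓ)).indicator g), integral_indicator measurableSet_Ioo]

theorem integral_hitDensity_shift {s ℓ t : ℝ} (hs : 0 < s) (hℓ : 0 ≤ ℓ) (h : ℓ < t) :
    ∫ r in Ioo 0 t, hitDensity s (r - ℓ) = erfc (s / (2 * √(t - ℓ))) := by
  have h1 := integral_hitDensity_Ioo hs (sub_pos.2 h)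
  rw [(integrableOn_comp_sub hℓ (fun τ hτ ↦ hitDensity_of_nonpos s hτ) h1.1).2, h1.2]

theorem halfIntegral_hitDensity_shift {s ℓ t : ℝ} (hs : 0 < s) (hℓ : 0 ≤ ℓ) :
    ∫ r in Ioo 0 t, hitDensity s (r - ℓ) / (t - r) ^ (1 / 2 : ℝ)
      = √Real.pi * reflDensity s (t - ℓ) := by
  rcases le_or_gt t ℓ with h | h
  · rw [reflDensity_of_nonpos _ (sub_nonpos.2 h), mul_zero]
    refine setIntegral_eq_zero_of_forall_eq_zero fun r hr ↦ ?_
    rw [hitDensity_of_nonpos _ (by linarith [hr.2]), zero_div]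
  · have h1 := halfIntegral_hitDensity hs (sub_pos.2 h)
    have h2 := integrableOn_comp_sub hℓ
      (fun τ hτ ↦ by rw [hitDensity_of_nonpos s hτ, zero_div]) h1.1
    rw [← h1.2, ← h2.2]
    simp only [sub_sub_sub_cancel_right]

section

/-! ### Relaxation: averages of a smooth function against the inverse process -/

/-- The average `E G(𝓛(t))`. -/
noncomputable def relax (lam : ℝ) (G : ℝ → ℝ) (t : ℝ) : ℝ :=
  ∫ ℓ in Ioi 0, inverseDensity lam t ℓ * G ℓ

/-- The time derivative of `relax lam G`, where `G'` is the derivative of `G`. -/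
noncomputable def relaxRate (lam : ℝ) (G' : ℝ → ℝ) (t : ℝ) : ℝ :=
  ∫ ℓ in Ioi 0, hitDensity (2 * lam * ℓ) (t - ℓ) * G' ℓ

variable {lam t M G₀ : ℝ} {G G' : ℝ → ℝ}

theorem integrableOn_mul_of_bounded {k g : ℝ → ℝ} {S : Set ℝ} (hS : MeasurableSet S)
    (hk : IntegrableOn k S) (hg : AEStronglyMeasurable g (volume.restrict S))
    (hM : ∀ x ∈ S, |g x| ≤ M) : IntegrableOn (fun x ↦ k x * g x) S := by
  refine hk.mul_bdd (c := M) hg ?_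
  filter_upwards [ae_restrict_mem hS] with x hx using hM x hx

theorem abs_relaxRate_le (hlam : 0 < lam) (ht : 0 < t) (hM : ∀ ℓ ∈ Ioi 0, |G' ℓ| ≤ M) :
    |relaxRate lam G' t| ≤ M := by
  have hM0 : 0 ≤ M := (abs_nonneg _).trans (hM 1 (mem_Ioi.2 one_pos))
  have hi := integrableOn_hitDensity_diag hlam ht
  have h : ∀ᵐ ℓ ∂volume.restrict (Ioi 0), ‖hitDensity (2 * lam * ℓ) (t - ℓ) * G' ℓ‖
      ≤ hitDensity (2 * lam * ℓ) (t - ℓ) * M := by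
    filter_upwards [ae_restrict_mem measurableSet_Ioi] with ℓ hℓ
    have hp := hitDensity_nonneg (mul_nonneg (by positivity : 0 ≤ 2 * lam) (le_of_lt hℓ)) (t - ℓ)
    rw [norm_mul, Real.norm_of_nonneg hp]
    exact mul_le_mul_of_nonneg_left (hM ℓ hℓ) hp
  refine (norm_integral_le_of_norm_le (hi.1.mul_const M) h).trans ?_
  rw [integral_mul_const]
  exact mul_le_of_le_one_left hM0 hi.2

/-- With `ℓ = r v` the kernel is $\frac{\lambda v}{1-v}\,e^{-r\lambda^2v^2/(1-v)}/\sqrt{\pi r(1-v)}$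
for `v < 1`, visibly decreasing in `r`. A value at one smaller time thus dominates all later ones.
-/
theorem hitDensity_scale_anti (hlam : 0 < lam) {r r' v : ℝ} (hr : 0 < r) (h : r ≤ r')
    (hv : 0 < v) :
    hitDensity (2 * lam * (r' * v)) (r' - r' * v) ≤ hitDensity (2 * lam * (r * v)) (r - r * v) := by
  have hr' := hr.trans_le h
  rcases le_or_gt 1 v with h1 | h1
  · rw [hitDensity_of_nonpos _ (by nlinarith), hitDensity_of_nonpos _ (by nlinarith)]
  have hv1 : 0 < 1 - v := sub_pos.2 h1
  have hs : ∀ ρ : ℝ, 0 < ρ → hitDensity (2 * lam * (ρ * v)) (ρ - ρ * v)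
      = lam * v / (1 - v) * (Real.exp (-(ρ * (lam ^ 2 * v ^ 2 / (1 - v)))) /
        √(Real.pi * (ρ * (1 - v)))) := by
    intro ρ hρ
    have e1 : ρ - ρ * v = ρ * (1 - v) := by ring
    rw [hitDensity, reflDensity, e1]
    congr 1
    · field_simp
    · congr 2
      field_simp
      ring
  rw [hs r hr, hs r' hr']
  gcongr

theorem relaxRate_eq_scale (hr : 0 < t) : relaxRate lam G' t
    = ∫ v in Ioi 0, t * (hitDensity (2 * lam * (t * v)) (t - t * v) * G' (t * v)) := by
  have h := integral_comp_mul_left_Ioi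
    (fun ℓ ↦ hitDensity (2 * lam * ℓ) (t - ℓ) * G' ℓ) 0 hr
  rw [mul_zero] at h
  rw [integral_const_mul, h, smul_eq_mul, mul_inv_cancel_left₀ hr.ne', relaxRate]

/-- In the variable `v = ℓ / r` the cutoff sits at the fixed point `v = 1`, and the kernel at time
`t / 2` supplies the dominating function. -/
theorem continuousAt_relaxRate (hlam : 0 < lam) (ht : 0 < t) (hc : ContinuousOn G' (Ioi 0))
    (hM : ∀ ℓ ∈ Ioi 0, |G' ℓ| ≤ M) : ContinuousAt (relaxRate lam G') t := by
  have hM0 : 0 ≤ M := (abs_nonneg _).trans (hM 1 (mem_Ioi.2 one_pos))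
  have ht2 : 0 < t / 2 := half_pos ht
  have hcont : ContinuousAt (fun r ↦ ∫ v in Ioi 0,
      r * (hitDensity (2 * lam * (r * v)) (r - r * v) * G' (r * v))) t := by
    refine continuousAt_of_dominated (bound := fun v ↦
      2 * t * (hitDensity (2 * lam * (t / 2 * v)) (t / 2 - t / 2 * v) * M)) ?_ ?_ ?_ ?_
    · filter_upwards [Ioi_mem_nhds ht] with r hr
      refine (AEStronglyMeasurable.mul ?_ ?_).const_mul r
      · exact (measurable_hitDensity.comp (by fun_prop :
          Measurable fun v : ℝ ↦ (2 * lam * (r * v), r - r * v))).aestronglyMeasurable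
      · refine ContinuousOn.aestronglyMeasurable ?_ measurableSet_Ioi
        exact hc.comp (by fun_prop) fun v hv ↦ mem_Ioi.2 (mul_pos hr hv)
    · filter_upwards [Ioo_mem_nhds (half_lt_self ht) (by linarith : t < 2 * t)] with r hr
      have hr0 : 0 < r := ht2.trans hr.1
      filter_upwards [ae_restrict_mem measurableSet_Ioi] with v hv
      have hv0 : 0 < v := hv
      have hp := hitDensity_nonneg (by positivity : 0 ≤ 2 * lam * (r * v)) (r - r * v)
      rw [norm_mul, norm_mul, Real.norm_of_nonneg hr0.le, Real.norm_of_nonneg hp]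
      have h1 := hitDensity_scale_anti hlam ht2 hr.1.le hv0
      have h2 : ‖G' (r * v)‖ ≤ M := hM _ (mem_Ioi.2 (mul_pos hr0 hv0))
      have h3 := hr.2.le
      have h4 := hp.trans h1
      gcongr
    · refine Integrable.const_mul (Integrable.mul_const ?_ M) _
      have h := (integrableOn_Ioi_comp_mul_left_iff
        (fun ℓ ↦ hitDensity (2 * lam * ℓ) (t / 2 - ℓ)) 0 ht2).2
      rw [mul_zero] at h
      exact h (integrableOn_hitDensity_diag hlam ht2).1
    · have hne : ∀ᵐ v : ℝ ∂volume.restrict (Ioi 0), v ≠ 1 :=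
        ae_restrict_of_ae (by simp [ae_iff])
      filter_upwards [ae_restrict_mem measurableSet_Ioi, hne] with v hv hv1
      have h1 : ContinuousAt (fun r ↦ G' (r * v)) t := by
        refine ContinuousAt.comp (f := fun r ↦ r * v) ?_ (by fun_prop)
        exact hc.continuousAt (Ioi_mem_nhds (mul_pos ht hv))
      have h2 : ContinuousAt (fun r ↦ hitDensity (2 * lam * (r * v)) (r - r * v)) t := by
        have hz : t - t * v ≠ 0 := by
          have : t - t * v = t * (1 - v) := by ring
          rw [this]
          exact mul_ne_zero ht.ne' (sub_ne_zero.2 hv1.symm)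
        rcases lt_or_gt_of_ne hz with hneg | hpos
        · have he : (fun r ↦ hitDensity (2 * lam * (r * v)) (r - r * v)) =ᶠ[𝓝 t] fun _ ↦ 0 := by
            have : ContinuousAt (fun r ↦ r - r * v) t := by fun_prop
            filter_upwards [this.eventually (gt_mem_nhds hneg)] with r hr
            exact hitDensity_of_nonpos _ (le_of_lt hr)
          exact he.continuousAt
        · have hs : √(Real.pi * (t - t * v)) ≠ 0 := by positivity
          unfold hitDensity reflDensity
          fun_prop (disch := first | assumption | positivity)
      exact continuousAt_id.mul (h2.mul h1)
  refine hcont.congr ?_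
  filter_upwards [Ioi_mem_nhds ht] with r hr using (relaxRate_eq_scale hr).symm

theorem integrable_prod_mul_hitDensity (hlam : 0 < lam) {w : ℝ → ℝ} (hw : Measurable w)
    (hwi : IntegrableOn w (Ioo 0 t)) (hc : ContinuousOn G' (Ioi 0))
    (hM : ∀ ℓ ∈ Ioi 0, |G' ℓ| ≤ M) :
    Integrable (Function.uncurry fun r ℓ ↦ w r * (hitDensity (2 * lam * ℓ) (r - ℓ) * G' ℓ))
      ((volume.restrict (Ioo 0 t)).prod (volume.restrict (Ioi 0))) := by
  have hM0 : 0 ≤ M := (abs_nonneg _).trans (hM 1 (mem_Ioi.2 one_pos))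
  have hφ : Measurable fun x : ℝ × ℝ ↦ hitDensity (2 * lam * x.2) (x.1 - x.2) :=
    measurable_hitDensity.comp
      (by fun_prop : Measurable fun x : ℝ × ℝ ↦ (2 * lam * x.2, x.1 - x.2))
  have hG' : AEStronglyMeasurable G' (volume.restrict (Ioi 0)) :=
    hc.aestronglyMeasurable measurableSet_Ioi
  have hmeas : AEStronglyMeasurable
      (Function.uncurry fun r ℓ ↦ w r * (hitDensity (2 * lam * ℓ) (r - ℓ) * G' ℓ))
      ((volume.restrict (Ioo 0 t)).prod (volume.restrict (Ioi 0))) :=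
    (hw.comp measurable_fst).aestronglyMeasurable.mul
      (hφ.aestronglyMeasurable.mul hG'.comp_snd)
  refine (integrable_prod_iff hmeas).2 ⟨?_, ?_⟩
  · filter_upwards [ae_restrict_mem measurableSet_Ioo] with r hr
    exact (integrableOn_mul_of_bounded measurableSet_Ioi
      (integrableOn_hitDensity_diag hlam hr.1).1 hG' hM).const_mul (w r)
  · refine (hwi.norm.mul_const M).mono' hmeas.norm.integral_prod_right' ?_
    filter_upwards [ae_restrict_mem measurableSet_Ioo] with r hr
    rw [Real.norm_of_nonneg (integral_nonneg fun _ ↦ norm_nonneg _)]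
    have hi := integrableOn_hitDensity_diag hlam hr.1
    have hle : ∫ ℓ in Ioi 0, ‖w r * (hitDensity (2 * lam * ℓ) (r - ℓ) * G' ℓ)‖
        ≤ ∫ ℓ in Ioi 0, ‖w r‖ * (hitDensity (2 * lam * ℓ) (r - ℓ) * M) := by
      refine integral_mono_of_nonneg (ae_of_all _ fun _ ↦ norm_nonneg _)
        ((hi.1.mul_const M).const_mul _) ?_
      filter_upwards [ae_restrict_mem measurableSet_Ioi] with ℓ hℓ
      have hp := hitDensity_nonneg (mul_nonneg (by positivity : 0 ≤ 2 * lam) (le_of_lt hℓ)) (r - ℓ)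
      rw [norm_mul, norm_mul, Real.norm_of_nonneg hp]
      have h2 : ‖G' ℓ‖ ≤ M := hM ℓ hℓ
      gcongr
    refine hle.trans ?_
    rw [integral_const_mul, integral_mul_const]
    exact mul_le_mul_of_nonneg_left (mul_le_of_le_one_left hM0 hi.2) (norm_nonneg _)

/-- The weight `1` serves to integrate the rate back to the average, and the weight `(t - r)^(-1/2)`
produces the Caputo integral. -/
theorem integral_mul_relaxRate (hlam : 0 < lam) {w : ℝ → ℝ} (hw : Measurable w)
    (hwi : IntegrableOn w (Ioo 0 t)) (hc : ContinuousOn G' (Ioi 0))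
    (hM : ∀ ℓ ∈ Ioi 0, |G' ℓ| ≤ M) :
    IntegrableOn (fun r ↦ w r * relaxRate lam G' r) (Ioo 0 t) ∧
      ∫ r in Ioo 0 t, w r * relaxRate lam G' r
        = ∫ ℓ in Ioi 0, (∫ r in Ioo 0 t, w r * hitDensity (2 * lam * ℓ) (r - ℓ)) * G' ℓ := by
  have hint := integrable_prod_mul_hitDensity hlam hw hwi hc hM
  constructor
  · refine hint.integral_prod_left.congr (ae_of_all _ fun r ↦ ?_)
    simp [relaxRate, integral_const_mul]
  · have h := integral_integral_swap hint
    simp only [integral_const_mul] at h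
    simp only [relaxRate]
    rw [h]
    congr 1 with ℓ
    rw [← integral_mul_const]
    simp only [mul_assoc]

/-- Only `G'` is assumed bounded. The mean value inequality controls `G` on `(0, t)`, which suffices
because the density of the inverse process vanishes beyond `t`. -/
theorem abs_le_of_hasDerivAt_Ioi (hG : ∀ ℓ ∈ Ioi 0, HasDerivAt G (G' ℓ) ℓ)
    (hM : ∀ ℓ ∈ Ioi 0, |G' ℓ| ≤ M) {ℓ : ℝ} (hℓ : ℓ ∈ Ioo 0 t) : |G ℓ| ≤ |G t| + M * t := by
  have hM0 : 0 ≤ M := (abs_nonneg _).trans (hM 1 (mem_Ioi.2 one_pos))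
  have h := (convex_Ioi (0 : ℝ)).norm_image_sub_le_of_norm_hasDerivWithin_le
    (fun x hx ↦ (hG x hx).hasDerivWithinAt) hM (mem_Ioi.2 (hℓ.1.trans hℓ.2)) (mem_Ioi.2 hℓ.1)
  have h1 : ‖ℓ - t‖ ≤ t := by
    rw [Real.norm_eq_abs, abs_le]
    constructor <;> linarith [hℓ.1, hℓ.2]
  have h2 : |G ℓ - G t| ≤ M * t := h.trans (mul_le_mul_of_nonneg_left h1 hM0)
  have := abs_sub_abs_le_abs_sub (G ℓ) (G t)
  linarith

theorem integrableOn_inverseDensity_mul (hlam : 0 < lam) (ht : 0 < t)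
    (hG : ∀ ℓ ∈ Ioi 0, HasDerivAt G (G' ℓ) ℓ) (hM : ∀ ℓ ∈ Ioi 0, |G' ℓ| ≤ M) :
    IntegrableOn (fun ℓ ↦ inverseDensity lam t ℓ * G ℓ) (Ioi 0) := by
  refine IntegrableOn.of_forall_sdiff_eq_zero (s := Ioo 0 t) ?_ measurableSet_Ioi ?_
  · refine integrableOn_mul_of_bounded measurableSet_Ioo
      ((integral_inverseDensity hlam ht).1.mono_set Ioo_subset_Ioi_self)
      (ContinuousOn.aestronglyMeasurable (fun ℓ hℓ ↦ (hG ℓ hℓ.1).continuousAt.continuousWithinAt)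
        measurableSet_Ioo) fun ℓ hℓ ↦ abs_le_of_hasDerivAt_Ioi hG hM hℓ
  · intro ℓ hℓ
    rw [inverseDensity_of_le lam (not_lt.1 fun hlt ↦ hℓ.2 ⟨hℓ.1, hlt⟩), zero_mul]

/-- Integration by parts against the tail gives $G_0+\int_0^tP(\mathscr
L(t)>\ell)\,G'(\ell)\,d\ell$. The tail is itself $\int_0^th(2\lambda\ell,r-\ell)\,dr$, and Fubini
exchanges the two integrals. -/
theorem relax_eq_add_integral (hlam : 0 < lam) (ht : 0 < t)
    (hG : ∀ ℓ ∈ Ioi 0, HasDerivAt G (G' ℓ) ℓ) (hc : ContinuousOn G' (Ioi 0))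
    (hM : ∀ ℓ ∈ Ioi 0, |G' ℓ| ≤ M) (h0 : Tendsto G (𝓝[>] 0) (𝓝 G₀)) :
    relax lam G t = G₀ + ∫ r in Ioo 0 t, relaxRate lam G' r := by
  have hone : IntegrableOn (fun _ : ℝ ↦ (1 : ℝ)) (Ioo 0 t) := by simp
  have hint := integrable_prod_mul_hitDensity hlam measurable_const hone hc hM
  have hrate := (integral_mul_relaxRate hlam measurable_const hone hc hM).2
  simp only [one_mul] at hrate hint
  have hS : ∀ ℓ ∈ Ioo 0 t, ∫ r in Ioo 0 t, hitDensity (2 * lam * ℓ) (r - ℓ)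
      = erfc (2 * lam * ℓ / (2 * √(t - ℓ))) := fun ℓ hℓ ↦
    integral_hitDensity_shift (mul_pos (by positivity) hℓ.1) hℓ.1.le hℓ.2
  have hz : ∀ ℓ ∈ Ioi 0 \ Ioo 0 t,
      (∫ r in Ioo 0 t, hitDensity (2 * lam * ℓ) (r - ℓ)) * G' ℓ = 0 := by
    intro ℓ hℓ
    have hle : t ≤ ℓ := not_lt.1 fun hlt ↦ hℓ.2 ⟨hℓ.1, hlt⟩
    rw [setIntegral_eq_zero_of_forall_eq_zero fun r hr ↦
      hitDensity_of_nonpos _ (by linarith [hr.2]), zero_mul]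
  have hSi : IntegrableOn (fun ℓ ↦ erfc (2 * lam * ℓ / (2 * √(t - ℓ))) * G' ℓ) (Ioo 0 t) := by
    refine IntegrableOn.congr_fun (f := fun ℓ ↦
      (∫ r in Ioo 0 t, hitDensity (2 * lam * ℓ) (r - ℓ)) * G' ℓ) ?_
      (fun ℓ hℓ ↦ by simp only [hS ℓ hℓ]) measurableSet_Ioo
    refine IntegrableOn.mono_set (t := Ioi 0) ?_ Ioo_subset_Ioi_self
    refine hint.integral_prod_right.congr (ae_of_all _ fun ℓ ↦ ?_)
    exact integral_mul_const (G' ℓ) _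
  have hhi := (integrableOn_inverseDensity_mul hlam ht hG hM).mono_set
    (Ioo_subset_Ioi_self : Ioo 0 t ⊆ Ioi 0)
  have hneg : IntegrableOn (fun ℓ ↦ -(inverseDensity lam t ℓ * G ℓ)) (Ioo 0 t) := hhi.neg
  -- The boundary terms are the tail at the endpoints: `0` at `ℓ = t` and `1` at `ℓ = 0`.
  have hparts : ∫ ℓ in (0 : ℝ)..t, (-inverseDensity lam t ℓ * G ℓ
      + erfc (2 * lam * ℓ / (2 * √(t - ℓ))) * G' ℓ) = 0 * G t - 1 * G₀ := by
    refine intervalIntegral.integral_eq_sub_of_hasDerivAt_of_tendsto ht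
      (fun ℓ hℓ ↦ (hasDerivAt_erfc_inverse lam hℓ.2).fun_mul (hG ℓ hℓ.1)) ?_ ?_ ?_
    · rw [intervalIntegrable_iff_integrableOn_Ioo_of_le ht.le]
      simp only [neg_mul]
      exact Integrable.add hneg hSi
    · refine Tendsto.mul ?_ h0
      have := (hasDerivAt_erfc_inverse lam ht).continuousAt.tendsto
      simp only [mul_zero, zero_div, erfc_zero] at this
      exact this.mono_left nhdsWithin_le_nhds
    · exact (tendsto_erfc_inverse hlam ht).mul
        ((hG t ht).continuousAt.tendsto.mono_left nhdsWithin_le_nhds)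
  rw [intervalIntegral.integral_of_le ht.le, integral_Ioc_eq_integral_Ioo] at hparts
  simp only [neg_mul] at hparts
  rw [integral_add hneg hSi, integral_neg] at hparts
  rw [hrate, setIntegral_eq_of_subset_of_forall_sdiff_eq_zero measurableSet_Ioi
    Ioo_subset_Ioi_self hz, setIntegral_congr_fun measurableSet_Ioo
      (fun ℓ hℓ ↦ by simp only [hS ℓ hℓ] : EqOn _ (fun ℓ ↦
        erfc (2 * lam * ℓ / (2 * √(t - ℓ))) * G' ℓ) _), relax,
    setIntegral_eq_of_subset_of_forall_sdiff_eq_zero measurableSet_Ioi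
      (Ioo_subset_Ioi_self : Ioo 0 t ⊆ Ioi 0)]
  · linarith
  · intro ℓ hℓ
    rw [inverseDensity_of_le lam (not_lt.1 fun hlt ↦ hℓ.2 ⟨hℓ.1, hlt⟩), zero_mul]

theorem integrableOn_relaxRate (hlam : 0 < lam) (hc : ContinuousOn G' (Ioi 0))
    (hM : ∀ ℓ ∈ Ioi 0, |G' ℓ| ≤ M) (t : ℝ) : IntegrableOn (relaxRate lam G') (Ioo 0 t) := by
  have hone : IntegrableOn (fun _ : ℝ ↦ (1 : ℝ)) (Ioo 0 t) := by simp
  simpa using (integral_mul_relaxRate hlam measurable_const hone hc hM).1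

theorem hasDerivAt_relax (hlam : 0 < lam) (ht : 0 < t)
    (hG : ∀ ℓ ∈ Ioi 0, HasDerivAt G (G' ℓ) ℓ) (hc : ContinuousOn G' (Ioi 0))
    (hM : ∀ ℓ ∈ Ioi 0, |G' ℓ| ≤ M) (h0 : Tendsto G (𝓝[>] 0) (𝓝 G₀)) :
    HasDerivAt (relax lam G) (relaxRate lam G' t) t := by
  have hcont : ContinuousOn (relaxRate lam G') (Ioi 0) := fun r hr ↦
    (continuousAt_relaxRate hlam hr hc hM).continuousWithinAt
  have hd : HasDerivAt (fun u ↦ G₀ + ∫ r in (0 : ℝ)..u, relaxRate lam G' r)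
      (relaxRate lam G' t) t := by
    refine (intervalIntegral.integral_hasDerivAt_right ?_ ?_
      (continuousAt_relaxRate hlam ht hc hM)).const_add G₀
    · rw [intervalIntegrable_iff_integrableOn_Ioo_of_le ht.le]
      exact integrableOn_relaxRate hlam hc hM t
    · exact hcont.stronglyMeasurableAtFilter isOpen_Ioi t ht
  refine hd.congr_of_eventuallyEq ?_
  filter_upwards [Ioi_mem_nhds ht] with u hu
  rw [relax_eq_add_integral hlam hu hG hc hM h0, intervalIntegral.integral_of_le (le_of_lt hu),
    integral_Ioc_eq_integral_Ioo]

theorem tendsto_relax (hlam : 0 < lam)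
    (hG : ∀ ℓ ∈ Ioi 0, HasDerivAt G (G' ℓ) ℓ) (hc : ContinuousOn G' (Ioi 0))
    (hM : ∀ ℓ ∈ Ioi 0, |G' ℓ| ≤ M) (h0 : Tendsto G (𝓝[>] 0) (𝓝 G₀)) :
    Tendsto (relax lam G) (𝓝[>] 0) (𝓝 G₀) := by
  have hlim : Tendsto (fun t : ℝ ↦ M * t) (𝓝[>] 0) (𝓝 0) := by
    have : Continuous fun t : ℝ ↦ M * t := by fun_prop
    simpa using (this.tendsto 0).mono_left nhdsWithin_le_nhds
  refine tendsto_iff_norm_sub_tendsto_zero.2 (squeeze_zero' (Eventually.of_forall fun _ ↦ norm_nonneg _)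
    ?_ hlim)
  filter_upwards [self_mem_nhdsWithin] with t ht
  have ht0 : 0 < t := ht
  rw [relax_eq_add_integral hlam ht hG hc hM h0, add_sub_cancel_left]
  refine (norm_setIntegral_le_of_norm_le_const (C := M) (by simp) fun r hr ↦
    abs_relaxRate_le hlam hr.1 hM).trans ?_
  simp [ht0.le]

theorem integrableOn_one_div_rpow_half (t : ℝ) :
    IntegrableOn (fun r : ℝ ↦ 1 / (t - r) ^ (1 / 2 : ℝ)) (Ioo 0 t) := by
  rcases le_or_gt t 0 with ht | ht
  · simp [Ioo_eq_empty (not_lt.2 ht)]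
  have h : IntervalIntegrable (fun x : ℝ ↦ x ^ (-(1 / 2) : ℝ)) volume (t - 0) (t - t) :=
    intervalIntegral.intervalIntegrable_rpow' (by norm_num)
  have h2 := h.comp_sub_left t
  simp only [sub_sub_cancel] at h2
  have h3 := (intervalIntegrable_iff_integrableOn_Ioo_of_le ht.le).1 h2
  refine h3.congr_fun (fun r hr ↦ ?_) measurableSet_Ioo
  simp only [Real.rpow_neg (sub_nonneg.2 hr.2.le), one_div]

/-- After Fubini the half-order integral acts on `h` alone and gives `√π p`; the factor `√π` cancels
against `Γ(1/2)`. -/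
theorem hasCaputoDeriv_relax (hlam : 0 < lam) (ht : 0 < t)
    (hG : ∀ ℓ ∈ Ioi 0, HasDerivAt G (G' ℓ) ℓ) (hc : ContinuousOn G' (Ioi 0))
    (hM : ∀ ℓ ∈ Ioi 0, |G' ℓ| ≤ M) (h0 : Tendsto G (𝓝[>] 0) (𝓝 G₀)) :
    HasCaputoDeriv (1 / 2) (relax lam G) t ∧
      caputoDeriv (1 / 2) (relax lam G) t
        = ∫ ℓ in Ioi 0, reflDensity (2 * lam * ℓ) (t - ℓ) * G' ℓ := by
  have hw : Measurable fun r : ℝ ↦ 1 / (t - r) ^ (1 / 2 : ℝ) := by fun_prop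
  have h := integral_mul_relaxRate hlam hw (integrableOn_one_div_rpow_half t) hc hM
  have he : EqOn (fun r ↦ 1 / (t - r) ^ (1 / 2 : ℝ) * relaxRate lam G' r)
      (fun r ↦ deriv (relax lam G) r / (t - r) ^ (1 / 2 : ℝ)) (Ioo 0 t) := by
    intro r hr
    simp only [(hasDerivAt_relax hlam hr.1 hG hc hM h0).deriv]
    ring
  refine ⟨⟨fun r hr ↦ (hasDerivAt_relax hlam hr.1 hG hc hM h0).differentiableAt, ?_⟩, ?_⟩
  · rw [intervalIntegrable_iff_integrableOn_Ioo_of_le ht.le]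
    exact h.1.congr_fun he measurableSet_Ioo
  · rw [caputoDeriv, one_div_Gamma_half, intervalIntegral.integral_of_le ht.le,
      integral_Ioc_eq_integral_Ioo, ← setIntegral_congr_fun measurableSet_Ioo he, h.2,
      ← integral_const_mul]
    refine setIntegral_congr_fun measurableSet_Ioi fun ℓ hℓ ↦ ?_
    have hpi : √Real.pi ≠ 0 := by positivity
    have h2 := halfIntegral_hitDensity_shift (t := t)
      (mul_pos (by positivity : 0 < 2 * lam) hℓ) (le_of_lt hℓ)
    have h3 : ∫ r in Ioo 0 t, 1 / (t - r) ^ (1 / 2 : ℝ) * hitDensity (2 * lam * ℓ) (r - ℓ)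
        = √Real.pi * reflDensity (2 * lam * ℓ) (t - ℓ) := by
      rw [← h2]
      congr 1 with r
      ring
    simp only [h3]
    field_simp

/-- The rate carries the kernel `h` and the Caputo derivative the kernel `p`, and `h + 2 lam p` is
exactly the density of the inverse process. -/
theorem relax_equation (hlam : 0 < lam) (ht : 0 < t)
    (hG : ∀ ℓ ∈ Ioi 0, HasDerivAt G (G' ℓ) ℓ) (hc : ContinuousOn G' (Ioi 0))
    (hM : ∀ ℓ ∈ Ioi 0, |G' ℓ| ≤ M) (h0 : Tendsto G (𝓝[>] 0) (𝓝 G₀)) :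
    deriv (relax lam G) t + 2 * lam * caputoDeriv (1 / 2) (relax lam G) t = relax lam G' t := by
  have hG' : AEStronglyMeasurable G' (volume.restrict (Ioi 0)) :=
    hc.aestronglyMeasurable measurableSet_Ioi
  rw [(hasDerivAt_relax hlam ht hG hc hM h0).deriv, (hasCaputoDeriv_relax hlam ht hG hc hM h0).2,
    relaxRate, ← integral_const_mul, ← integral_add]
  · refine setIntegral_congr_fun measurableSet_Ioi fun ℓ _ ↦ ?_
    simp only [inverseDensity]
    ring
  · exact integrableOn_mul_of_bounded measurableSet_Ioi
      (integrableOn_hitDensity_diag hlam ht).1 hG' hM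
  · exact (integrableOn_mul_of_bounded measurableSet_Ioi
      (integrableOn_reflDensity_diag hlam ht) hG' hM).const_mul _

end

/-! ### Uniqueness of Laplace transforms -/

/-- A bounded, continuous, strictly decreasing function that equals `exp (-x)` for `0 ≤ x`. -/
noncomputable def expNegExt : BoundedContinuousFunction ℝ ℝ :=
  BoundedContinuousFunction.ofNormedAddCommGroup
    (fun x ↦ Real.exp (-max x 0) + (1 - Real.exp (min x 0))) (by fun_prop) 2 (by
      intro x
      have h1 : Real.exp (-max x 0) ≤ 1 := Real.exp_le_one_iff.2 (by simp)
      have h2 : Real.exp (min x 0) ≤ 1 := Real.exp_le_one_iff.2 (by simp)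
      have h3 := Real.exp_pos (-max x 0)
      have h4 := Real.exp_pos (min x 0)
      rw [Real.norm_eq_abs, abs_le]
      constructor <;> linarith)

theorem expNegExt_apply (x : ℝ) :
    expNegExt x = Real.exp (-max x 0) + (1 - Real.exp (min x 0)) := rfl

theorem expNegExt_of_nonneg {x : ℝ} (hx : 0 ≤ x) : expNegExt x = Real.exp (-x) := by
  simp [expNegExt_apply, hx]

theorem strictAnti_expNegExt : StrictAnti expNegExt := by
  intro x y hxy
  simp only [expNegExt_apply]
  rcases lt_or_ge x 0 with hx | hx
  · have h1 : Real.exp (min x 0) < Real.exp (min y 0) := by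
      rw [Real.exp_lt_exp, min_eq_left hx.le]
      exact lt_min hxy hx
    have h2 : Real.exp (-max y 0) ≤ Real.exp (-max x 0) := by
      rw [Real.exp_le_exp]
      exact neg_le_neg (max_le_max_right 0 hxy.le)
    linarith
  · rw [min_eq_right hx, min_eq_right (hx.trans hxy.le), max_eq_left hx,
      max_eq_left (hx.trans hxy.le)]
    simpa using hxy

/-- Polynomials in $e^{-x}$ form a point-separating algebra on the half-line, so their integrals
determine a finite measure. `expNegExt` extends $e^{-x}$ injectively and boundedly to the whole
line, where the separation criterion is applied. -/
theorem ext_of_laplace_nat {P P' : Measure ℝ} [IsFiniteMeasure P] [IsFiniteMeasure P']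
    (hP : ∀ᵐ x ∂P, 0 ≤ x) (hP' : ∀ᵐ x ∂P', 0 ≤ x)
    (h : ∀ n : ℕ, ∫ x, Real.exp (-(n : ℝ) * x) ∂P = ∫ x, Real.exp (-(n : ℝ) * x) ∂P') :
    P = P' := by
  let A : StarSubalgebra ℝ (BoundedContinuousFunction ℝ ℝ) :=
    { Algebra.adjoin ℝ {expNegExt} with
      star_mem' := fun {a} ha ↦ by
        have : star a = a := by ext x; simp
        rwa [this] }
  refine ext_of_forall_mem_subalgebra_integral_eq_of_polish (𝕜 := ℝ) (A := A) ?_ ?_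
  · intro x y hxy
    refine ⟨expNegExt, ⟨expNegExt.toContinuousMap, ?_, rfl⟩, strictAnti_expNegExt.injective.ne hxy⟩
    exact ⟨expNegExt, Algebra.subset_adjoin (mem_singleton _), rfl⟩
  · intro g hg
    have hg' : g ∈ Algebra.adjoin ℝ {expNegExt} := hg
    rw [Algebra.adjoin_singleton_eq_range_aeval] at hg'
    obtain ⟨p, rfl⟩ := hg'
    have key : ∀ Q : Measure ℝ, IsFiniteMeasure Q → (∀ᵐ x ∂Q, 0 ≤ x) →
        ∫ x, (Polynomial.aeval expNegExt p) x ∂Q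
          = ∑ n ∈ p.support, p.coeff n * ∫ x, Real.exp (-(n : ℝ) * x) ∂Q := by
      intro Q _ hQ
      have hval : ∀ x, (Polynomial.aeval expNegExt p) x
          = ∑ n ∈ p.support, p.coeff n * (expNegExt x) ^ n := by
        intro x
        rw [Polynomial.aeval_def, Polynomial.eval₂_eq_sum, Polynomial.sum]
        simp [Algebra.algebraMap_eq_smul_one]
      simp only [hval]
      rw [integral_finsetSum]
      · refine Finset.sum_congr rfl fun n _ ↦ ?_
        rw [integral_const_mul]
        congr 1
        refine integral_congr_ae ?_
        filter_upwards [hQ] with x hx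
        rw [expNegExt_of_nonneg hx, ← Real.exp_nat_mul]
        congr 1
        ring
      · intro n _
        exact ((expNegExt ^ n).integrable Q).const_mul (p.coeff n)
    refine (key P ‹_› hP).trans (Eq.trans ?_ (key P' ‹_› hP').symm)
    simp only [h]

/-- Tilting by $e^{-t}$ makes the densities finite measures, which shifts the integer Laplace
parameters to `n + 1`. Continuity upgrades almost everywhere equality to equality at every point. -/
theorem eqOn_Ioi_of_laplace_nat {f g : ℝ → ℝ} (hf : ContinuousOn f (Ioi 0))
    (hg : ContinuousOn g (Ioi 0)) (hf0 : ∀ t ∈ Ioi 0, 0 ≤ f t) (hg0 : ∀ t ∈ Ioi 0, 0 ≤ g t)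
    (hfi : IntegrableOn (fun t ↦ Real.exp (-1 * t) * f t) (Ioi 0))
    (hgi : IntegrableOn (fun t ↦ Real.exp (-1 * t) * g t) (Ioi 0))
    (h : ∀ n : ℕ, ∫ t in Ioi 0, Real.exp (-((n : ℝ) + 1) * t) * f t
      = ∫ t in Ioi 0, Real.exp (-((n : ℝ) + 1) * t) * g t) :
    EqOn f g (Ioi 0) := by
  have hfin : ∀ k : ℝ → ℝ, IntegrableOn (fun t ↦ Real.exp (-1 * t) * k t) (Ioi 0) →
      IsFiniteMeasure ((volume.restrict (Ioi 0)).withDensity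
        fun t ↦ ENNReal.ofReal (Real.exp (-1 * t) * k t)) :=
    fun k hk ↦ isFiniteMeasure_withDensity_ofReal hk.2
  have hnn : ∀ k : ℝ → ℝ, ∀ᵐ t ∂((volume.restrict (Ioi 0)).withDensity
        fun t ↦ ENNReal.ofReal (Real.exp (-1 * t) * k t)), 0 ≤ t := fun k ↦
    (withDensity_absolutelyContinuous _ _).ae_le
      ((ae_restrict_mem measurableSet_Ioi).mono fun t ht ↦ le_of_lt ht)
  have hval : ∀ k : ℝ → ℝ, IntegrableOn (fun t ↦ Real.exp (-1 * t) * k t) (Ioi 0) →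
      (∀ t ∈ Ioi 0, 0 ≤ k t) → ∀ n : ℕ, ∫ t, Real.exp (-(n : ℝ) * t)
        ∂((volume.restrict (Ioi 0)).withDensity
          fun t ↦ ENNReal.ofReal (Real.exp (-1 * t) * k t))
        = ∫ t in Ioi 0, Real.exp (-((n : ℝ) + 1) * t) * k t := by
    intro k hk hk0 n
    rw [integral_withDensity_eq_integral_toReal_smul₀
      hk.aestronglyMeasurable.aemeasurable.ennreal_ofReal (ae_of_all _ fun _ ↦ ENNReal.ofReal_lt_top)]
    refine setIntegral_congr_fun measurableSet_Ioi fun t ht ↦ ?_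
    rw [ENNReal.toReal_ofReal (mul_nonneg (Real.exp_pos _).le (hk0 t ht)), smul_eq_mul,
      mul_right_comm, ← Real.exp_add]
    ring_nf
  have := hfin f hfi
  have := hfin g hgi
  have heq := ext_of_laplace_nat (hnn f) (hnn g) fun n ↦ by
    rw [hval f hfi hf0, hval g hgi hg0, h]
  have hae := (withDensity_eq_iff hfi.aestronglyMeasurable.aemeasurable.ennreal_ofReal
    hgi.aestronglyMeasurable.aemeasurable.ennreal_ofReal
    hfi.lintegral_lt_top.ne).1 heq
  refine Measure.eqOn_open_of_ae_eq (μ := volume) ?_ isOpen_Ioi hf hg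
  filter_upwards [hae, ae_restrict_mem measurableSet_Ioi] with t ht ht0
  have h1 := (ENNReal.ofReal_eq_ofReal_iff (mul_nonneg (Real.exp_pos _).le (hf0 t ht0))
    (mul_nonneg (Real.exp_pos _).le (hg0 t ht0))).1 ht
  exact mul_left_cancel₀ (Real.exp_ne_zero _) h1

/-! ### The radial heat kernel -/

/-- `exp (-w / (4 ℓ)) / ℓ`, which is up to a constant the planar heat kernel at squared distance `w`
from the origin. -/
noncomputable def heatRadial (w ℓ : ℝ) : ℝ := Real.exp (-(w / (4 * ℓ))) / ℓ

/-- The derivative of `heatRadial w`. -/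
noncomputable def heatRadialDeriv (w ℓ : ℝ) : ℝ :=
  (w / (4 * ℓ ^ 2) - 1 / ℓ) * heatRadial w ℓ

theorem heatRadial_nonneg (w : ℝ) {ℓ : ℝ} (hℓ : 0 < ℓ) : 0 ≤ heatRadial w ℓ := by
  unfold heatRadial; positivity

theorem measurable_heatRadial : Measurable fun x : ℝ × ℝ ↦ heatRadial x.1 x.2 := by
  unfold heatRadial; fun_prop

theorem hasDerivAt_heatRadial (w : ℝ) {ℓ : ℝ} (hℓ : 0 < ℓ) :
    HasDerivAt (heatRadial w) (heatRadialDeriv w ℓ) ℓ := by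
  have h1 : HasDerivAt (fun ℓ : ℝ ↦ -(w / (4 * ℓ))) (w / (4 * ℓ ^ 2)) ℓ := by
    have := ((hasDerivAt_inv hℓ.ne').const_mul (w / 4)).fun_neg
    refine (this.congr_deriv (by field_simp)).congr_of_eventuallyEq (Eventually.of_forall fun x ↦ ?_)
    simp only [div_eq_mul_inv, mul_inv]
    ring
  refine (h1.exp.div (hasDerivAt_id ℓ) hℓ.ne').congr_deriv ?_
  rw [heatRadialDeriv, heatRadial]
  simp only [id]
  field_simp

/-- Source of the heat kernel bounds: with `x = w / (4 ℓ)`, the kernel and its derivative are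
polynomials in `x` times `exp (-x)`, up to powers of `w`. Hence everything stays bounded as `ℓ`
tends to zero when `w > 0`. -/
theorem pow_mul_exp_neg_le (n : ℕ) {x : ℝ} (hx : 0 ≤ x) :
    x ^ n * Real.exp (-x) ≤ n.factorial := by
  have h := Real.pow_div_factorial_le_exp x hx n
  rw [div_le_iff₀ (by positivity)] at h
  rw [Real.exp_neg, ← div_eq_mul_inv, div_le_iff₀ (Real.exp_pos x)]
  linarith

theorem heatRadial_le {w ℓ : ℝ} (hw : 0 < w) (hℓ : 0 < ℓ) : heatRadial w ℓ ≤ 4 / w := by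
  have h := pow_mul_exp_neg_le 1 (by positivity : 0 ≤ w / (4 * ℓ))
  have : heatRadial w ℓ = 4 / w * ((w / (4 * ℓ)) ^ 1 * Real.exp (-(w / (4 * ℓ)))) := by
    rw [heatRadial]; field_simp
  rw [this]
  exact mul_le_of_le_one_right (by positivity) (by simpa using h)

theorem heatRadial_le_mul {w ℓ : ℝ} (hw : 0 < w) (hℓ : 0 < ℓ) :
    heatRadial w ℓ ≤ 32 / w ^ 2 * ℓ := by
  have h := pow_mul_exp_neg_le 2 (by positivity : 0 ≤ w / (4 * ℓ))
  have : heatRadial w ℓ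
      = 16 / w ^ 2 * ℓ * ((w / (4 * ℓ)) ^ 2 * Real.exp (-(w / (4 * ℓ)))) := by
    rw [heatRadial]; field_simp; norm_num
  rw [this]
  calc _ ≤ 16 / w ^ 2 * ℓ * (Nat.factorial 2 : ℕ) := by gcongr
    _ = _ := by norm_num; ring

theorem tendsto_heatRadial {w : ℝ} (hw : 0 < w) : Tendsto (heatRadial w) (𝓝[>] 0) (𝓝 0) := by
  have h : Tendsto (fun ℓ : ℝ ↦ 32 / w ^ 2 * ℓ) (𝓝[>] 0) (𝓝 0) := by
    have : Continuous fun ℓ : ℝ ↦ 32 / w ^ 2 * ℓ := by fun_prop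
    simpa using (this.tendsto 0).mono_left nhdsWithin_le_nhds
  refine squeeze_zero' ?_ ?_ h
  · filter_upwards [self_mem_nhdsWithin] with ℓ hℓ using heatRadial_nonneg w hℓ
  · filter_upwards [self_mem_nhdsWithin] with ℓ hℓ using heatRadial_le_mul hw hℓ

theorem abs_heatRadialDeriv_le {w ℓ : ℝ} (hw : 0 < w) (hℓ : 0 < ℓ) :
    |heatRadialDeriv w ℓ| ≤ 128 / w ^ 2 := by
  have h2 := pow_mul_exp_neg_le 2 (by positivity : 0 ≤ w / (4 * ℓ))
  have h3 := pow_mul_exp_neg_le 3 (by positivity : 0 ≤ w / (4 * ℓ))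
  have e : heatRadialDeriv w ℓ = 16 / w ^ 2 * ((w / (4 * ℓ)) ^ 3 * Real.exp (-(w / (4 * ℓ)))
      - (w / (4 * ℓ)) ^ 2 * Real.exp (-(w / (4 * ℓ)))) := by
    rw [heatRadialDeriv, heatRadial]
    field_simp
    ring
  have p2 : 0 ≤ (w / (4 * ℓ)) ^ 2 * Real.exp (-(w / (4 * ℓ))) := by positivity
  have p3 : 0 ≤ (w / (4 * ℓ)) ^ 3 * Real.exp (-(w / (4 * ℓ))) := by positivity
  rw [e, abs_mul, abs_of_pos (by positivity : 0 < 16 / w ^ 2)]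
  -- The two terms are at most `3! = 6` and `2! = 2`; `8` is their crude sum.
  have hb : |(w / (4 * ℓ)) ^ 3 * Real.exp (-(w / (4 * ℓ)))
      - (w / (4 * ℓ)) ^ 2 * Real.exp (-(w / (4 * ℓ)))| ≤ 8 := by
    norm_num [Nat.factorial] at h2 h3
    rw [abs_le]
    constructor <;> linarith
  calc _ ≤ 16 / w ^ 2 * 8 := by gcongr
    _ = _ := by ring

theorem continuousOn_heatRadialDeriv (w : ℝ) : ContinuousOn (heatRadialDeriv w) (Ioi 0) := by
  unfold heatRadialDeriv heatRadial
  intro ℓ hℓ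
  have : ℓ ≠ 0 := ne_of_gt hℓ
  have h4 : 4 * ℓ ≠ 0 := by positivity
  have h5 : 4 * ℓ ^ 2 ≠ 0 := by positivity
  fun_prop (disch := assumption)

/-! ### The kernel integrated against the law of the planar motion -/

/-- `p_{|B|}(s, t) + (1 / 2λ) ∂^{1/2} p_{|B|}(s, t) / ∂t^{1/2}`. -/
noncomputable def timeKernel (lam s t : ℝ) : ℝ :=
  reflDensity s t + 1 / (2 * lam) * hitDensity s t

theorem timeKernel_nonneg {lam s : ℝ} (hlam : 0 < lam) (hs : 0 ≤ s) (t : ℝ) :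
    0 ≤ timeKernel lam s t :=
  add_nonneg (reflDensity_nonneg s t) (mul_nonneg (by positivity) (hitDensity_nonneg hs t))

/-- The bracket in the definition of `𝔮` is, up to rescaling and shift, the density of the inverse
process; this links the two representations. -/
theorem inverseDensity_eq_timeKernel {lam : ℝ} (hlam : 0 < lam) (t ℓ : ℝ) :
    inverseDensity lam t ℓ = 2 * lam * timeKernel lam (2 * lam * ℓ) (t - ℓ) := by
  rw [inverseDensity, timeKernel]
  field_simp

theorem laplace_timeKernel {lam s μ : ℝ} (hs : 0 < s) (hμ : 0 < μ) :
    IntegrableOn (fun t ↦ Real.exp (-μ * t) * timeKernel lam s t) (Ioi 0) ∧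
      ∫ t in Ioi 0, Real.exp (-μ * t) * timeKernel lam s t
        = (1 / √μ + 1 / (2 * lam)) * Real.exp (-(s * √μ)) := by
  have h1 := laplace_reflDensity hs hμ
  have h2 := laplace_hitDensity hs hμ
  have h3 := h2.1.const_mul (1 / (2 * lam))
  have e : (fun t ↦ Real.exp (-μ * t) * timeKernel lam s t) = fun t ↦
      Real.exp (-μ * t) * reflDensity s t
        + 1 / (2 * lam) * (Real.exp (-μ * t) * hitDensity s t) := by
    ext t; rw [timeKernel]; ring
  rw [e]
  refine ⟨h1.1.add h3, ?_⟩
  rw [integral_add h1.1 h3, integral_const_mul, h1.2, h2.2]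
  ring

theorem reflDensity_le_mul {s r₀ r T : ℝ} (h0 : 0 < r₀) (h1 : r₀ ≤ r) (h2 : r ≤ T) :
    reflDensity s r ≤ T / r₀ * reflDensity s T := by
  have hr := h0.trans_le h1
  have hT := hr.trans_le h2
  have hle : Real.exp (-s ^ 2 / (4 * r)) ≤ Real.exp (-s ^ 2 / (4 * T)) := by
    rw [Real.exp_le_exp, neg_div, neg_div]
    gcongr
  have h3 : √(Real.pi * T) ≤ T / r₀ * √(Real.pi * r) := by
    have h4 : 1 ≤ T / r₀ := (one_le_div h0).2 (h1.trans h2)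
    refine Real.sqrt_le_iff.2 ⟨by positivity, ?_⟩
    rw [mul_pow, Real.sq_sqrt (by positivity)]
    calc Real.pi * T = T / r₀ * (Real.pi * r₀) := by field_simp
      _ ≤ (T / r₀) ^ 2 * (Real.pi * r) := by
        gcongr
        exact le_self_pow₀ h4 two_ne_zero
  rw [reflDensity, reflDensity, div_le_iff₀ (by positivity)]
  calc _ ≤ Real.exp (-s ^ 2 / (4 * T)) := hle
    _ = Real.exp (-s ^ 2 / (4 * T)) / √(Real.pi * T) * √(Real.pi * T) := by field_simp
    _ ≤ Real.exp (-s ^ 2 / (4 * T)) / √(Real.pi * T) * (T / r₀ * √(Real.pi * r)) := by gcongr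
    _ = _ := by ring

/-- A comparison uniform in `s`: a later time controls earlier ones. It serves both to pass from
almost every time to every time and to dominate near a given time. -/
theorem timeKernel_le_mul {lam s r₀ r T : ℝ} (hlam : 0 < lam) (hs : 0 ≤ s) (h0 : 0 < r₀)
    (h1 : r₀ ≤ r) (h2 : r ≤ T) :
    timeKernel lam s r ≤ (T / r₀) ^ 2 * timeKernel lam s T := by
  have hr := h0.trans_le h1
  have hT := hr.trans_le h2
  have h3 := reflDensity_le_mul (s := s) h0 h1 h2
  have h4 : 1 ≤ T / r₀ := (one_le_div h0).2 (h1.trans h2)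
  have hp := reflDensity_nonneg s T
  have h5 : reflDensity s r ≤ (T / r₀) ^ 2 * reflDensity s T :=
    h3.trans (mul_le_mul_of_nonneg_right (le_self_pow₀ h4 two_ne_zero) hp)
  have h6 : hitDensity s r ≤ (T / r₀) ^ 2 * hitDensity s T := by
    have h7 : s / (2 * r) ≤ T / r₀ * (s / (2 * T)) := by
      have : T / r₀ * (s / (2 * T)) = s / (2 * r₀) := by field_simp
      rw [this]
      gcongr
    rw [hitDensity, hitDensity]
    calc _ ≤ (T / r₀ * (s / (2 * T))) * (T / r₀ * reflDensity s T) := by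
          have := reflDensity_nonneg s r
          gcongr
      _ = _ := by ring
  have h8 := mul_le_mul_of_nonneg_left h6 (by positivity : 0 ≤ 1 / (2 * lam))
  rw [timeKernel, timeKernel]
  linarith

theorem continuousAt_timeKernel (lam s : ℝ) {t : ℝ} (ht : 0 < t) :
    ContinuousAt (timeKernel lam s) t := by
  have hs : √(Real.pi * t) ≠ 0 := by positivity
  have h4 : 4 * t ≠ 0 := by positivity
  have h2 : 2 * t ≠ 0 := by positivity
  unfold timeKernel hitDensity reflDensity
  fun_prop (disch := assumption)

/-! ### Laplace transforms in time of the two representations of `𝔮`. -/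

section

theorem integrableOn_Ioi_comp_sub {g : ℝ → ℝ} {ℓ : ℝ} (hℓ : 0 ≤ ℓ) (hg : ∀ τ ≤ 0, g τ = 0)
    (hi : IntegrableOn g (Ioi 0)) :
    IntegrableOn (fun r ↦ g (r - ℓ)) (Ioi 0) ∧
      ∫ r in Ioi 0, g (r - ℓ) = ∫ τ in Ioi 0, g τ := by
  have he : (Ioi 0).indicator (fun r ↦ g (r - ℓ)) = fun r ↦ (Ioi 0).indicator g (r - ℓ) := by
    ext r
    by_cases hr : r - ℓ ≤ 0
    · simp [indicator, hg _ hr]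
    · have h1 : 0 < r := by linarith
      have h2 : ℓ < r := by linarith
      simp [indicator, h1, h2]
  constructor
  · rw [← integrable_indicator_iff measurableSet_Ioi, he]
    exact ((integrable_indicator_iff measurableSet_Ioi).2 hi).comp_sub_right ℓ
  · rw [← integral_indicator measurableSet_Ioi, he, integral_sub_right_eq_self
      ((Ioi 0).indicator g), integral_indicator measurableSet_Ioi]

variable {lam w μ : ℝ}

theorem timeKernel_of_nonpos (lam s : ℝ) {t : ℝ} (ht : t ≤ 0) : timeKernel lam s t = 0 := by
  rw [timeKernel, reflDensity_of_nonpos _ ht, hitDensity_of_nonpos _ ht, mul_zero, add_zero]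

/-- The time shift by `ℓ` contributes $e^{-\mu\ell}$ and the level $2\lambda\ell$ contributes
$e^{-2\lambda\ell\sqrt\mu}$. -/
theorem laplace_inverseDensity {ℓ : ℝ} (hlam : 0 < lam) (hμ : 0 < μ) (hℓ : 0 < ℓ) :
    IntegrableOn (fun t ↦ Real.exp (-μ * t) * inverseDensity lam t ℓ) (Ioi 0) ∧
      ∫ t in Ioi 0, Real.exp (-μ * t) * inverseDensity lam t ℓ
        = 2 * lam * (1 / √μ + 1 / (2 * lam)) * Real.exp (-((μ + 2 * lam * √μ) * ℓ)) := by
  have h1 := laplace_timeKernel (lam := lam) (by positivity : 0 < 2 * lam * ℓ) hμ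
  have h2 := integrableOn_Ioi_comp_sub hℓ.le
    (fun τ hτ ↦ by rw [timeKernel_of_nonpos _ _ hτ, mul_zero]) h1.1
  have e : (fun t ↦ Real.exp (-μ * t) * inverseDensity lam t ℓ) = fun t ↦
      (2 * lam * Real.exp (-μ * ℓ)) *
        (Real.exp (-μ * (t - ℓ)) * timeKernel lam (2 * lam * ℓ) (t - ℓ)) := by
    ext t
    have : Real.exp (-μ * t) = Real.exp (-μ * ℓ) * Real.exp (-μ * (t - ℓ)) := by
      rw [← Real.exp_add]; ring_nf
    rw [inverseDensity_eq_timeKernel hlam, this]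
    ring
  rw [e]
  refine ⟨h2.1.const_mul _, ?_⟩
  rw [integral_const_mul, h2.2, h1.2]
  have : Real.exp (-((μ + 2 * lam * √μ) * ℓ))
      = Real.exp (-μ * ℓ) * Real.exp (-(2 * lam * ℓ * √μ)) := by
    rw [← Real.exp_add]; ring_nf
  rw [this]
  ring

theorem integrableOn_exp_mul_heatRadial {b : ℝ} (hb : 0 < b) (hw : 0 < w) :
    IntegrableOn (fun ℓ ↦ Real.exp (-(b * ℓ)) * heatRadial w ℓ) (Ioi 0) := by
  refine integrableOn_mul_of_bounded measurableSet_Ioi ?_ ?_ (M := 4 / w) ?_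
  · simpa using integrableOn_exp_mul_Ioi (neg_lt_zero.2 hb) 0
  · exact (measurable_heatRadial.comp measurable_prodMk_left).aestronglyMeasurable
  · intro ℓ hℓ
    rw [abs_of_nonneg (heatRadial_nonneg w hℓ)]
    exact heatRadial_le hw hℓ

theorem laplace_relax_heatRadial (hlam : 0 < lam) (hμ : 0 < μ) (hw : 0 < w) :
    IntegrableOn (fun t ↦ Real.exp (-μ * t) * relax lam (heatRadial w) t) (Ioi 0) ∧
      ∫ t in Ioi 0, Real.exp (-μ * t) * relax lam (heatRadial w) t
        = 2 * lam * (1 / √μ + 1 / (2 * lam)) *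
          ∫ ℓ in Ioi 0, Real.exp (-((μ + 2 * lam * √μ) * ℓ)) * heatRadial w ℓ := by
  have hval : ∀ ℓ ∈ Ioi (0 : ℝ),
      ∫ t in Ioi 0, Real.exp (-μ * t) * inverseDensity lam t ℓ * heatRadial w ℓ
        = 2 * lam * (1 / √μ + 1 / (2 * lam)) *
          (Real.exp (-((μ + 2 * lam * √μ) * ℓ)) * heatRadial w ℓ) := by
    intro ℓ hℓ
    rw [integral_mul_const, (laplace_inverseDensity hlam hμ hℓ).2]
    ring
  have hint : Integrable (Function.uncurry fun ℓ t ↦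
      Real.exp (-μ * t) * inverseDensity lam t ℓ * heatRadial w ℓ)
      ((volume.restrict (Ioi 0)).prod (volume.restrict (Ioi 0))) := by
    refine integrable_prod_restrict_of_nonneg measurableSet_Ioi measurableSet_Ioi ?_ ?_ ?_ ?_
    · have h1 := (measurable_inverseDensity lam).comp measurable_swap
      have h2 : Measurable fun x : ℝ × ℝ ↦ heatRadial w x.1 :=
        (measurable_heatRadial.comp measurable_prodMk_left).comp measurable_fst
      have h3 : Measurable fun x : ℝ × ℝ ↦ Real.exp (-μ * x.2) := by fun_prop
      exact (h3.mul h1).mul h2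
    · intro ℓ hℓ t _
      exact mul_nonneg (mul_nonneg (Real.exp_pos _).le
        (inverseDensity_nonneg hlam (le_of_lt hℓ) t)) (heatRadial_nonneg w hℓ)
    · intro ℓ hℓ
      exact (laplace_inverseDensity hlam hμ hℓ).1.mul_const _
    · refine IntegrableOn.congr_fun ?_ (fun ℓ hℓ ↦ (hval ℓ hℓ).symm) measurableSet_Ioi
      exact (integrableOn_exp_mul_heatRadial (by positivity) hw).const_mul _
  have hinner : ∀ t, ∫ ℓ in Ioi 0, Real.exp (-μ * t) * inverseDensity lam t ℓ * heatRadial w ℓ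
      = Real.exp (-μ * t) * relax lam (heatRadial w) t := by
    intro t
    simp only [mul_assoc]
    rw [integral_const_mul, relax]
  constructor
  · exact hint.integral_prod_right.congr (ae_of_all _ hinner)
  · rw [← integral_congr_ae (ae_of_all _ hinner), ← integral_integral_swap hint,
      setIntegral_congr_fun measurableSet_Ioi hval, integral_const_mul]

/-! ### The integral over the two branches of `s = (u + w / u) / 2` -/

/-- The integrand of `𝔮` in the variable `u`, up to a constant. -/
noncomputable def branchIntegrand (lam w t u : ℝ) : ℝ :=
  Real.exp (-(lam * u)) * timeKernel lam ((u + w / u) / 2) t / u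

theorem branchIntegrand_nonneg (hlam : 0 < lam) (hw : 0 < w) (t : ℝ) {u : ℝ} (hu : 0 < u) :
    0 ≤ branchIntegrand lam w t u :=
  div_nonneg (mul_nonneg (Real.exp_pos _).le (timeKernel_nonneg hlam (by positivity) t)) hu.le

theorem measurable_branchIntegrand (lam w : ℝ) :
    Measurable fun x : ℝ × ℝ ↦ branchIntegrand lam w x.2 x.1 := by
  unfold branchIntegrand timeKernel hitDensity reflDensity
  fun_prop

/-- Under $u=2\sqrt\mu\,\ell$ the exponents become $\lambda u=2\lambda\sqrt\mu\,\ell$,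
$u\sqrt\mu/2=\mu\ell$ and $w\sqrt\mu/(2u)=w/(4\ell)$, the last being that of the heat kernel. -/
theorem exp_branch_comp_mul (hμ : 0 < μ) {ℓ : ℝ} (hℓ : 0 < ℓ) :
    Real.exp (-(lam * (2 * √μ * ℓ))) *
        Real.exp (-((2 * √μ * ℓ + w / (2 * √μ * ℓ)) / 2 * √μ)) / (2 * √μ * ℓ)
      = (2 * √μ)⁻¹ * (Real.exp (-((μ + 2 * lam * √μ) * ℓ)) * heatRadial w ℓ) := by
  have h1 : √μ ≠ 0 := by positivity
  have h2 : √μ * √μ = μ := Real.mul_self_sqrt hμ.le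
  rw [heatRadial, ← Real.exp_add, mul_div_assoc', ← Real.exp_add]
  have : -(lam * (2 * √μ * ℓ)) + -((2 * √μ * ℓ + w / (2 * √μ * ℓ)) / 2 * √μ)
      = -((μ + 2 * lam * √μ) * ℓ) + -(w / (4 * ℓ)) := by
    have h3 : w / (2 * √μ * ℓ) / 2 * √μ = w / (4 * ℓ) := by field_simp; norm_num
    linear_combination (-ℓ) * h2 - h3
  rw [this]
  field_simp

theorem integral_exp_branch (hlam : 0 < lam) (hμ : 0 < μ) (hw : 0 < w) :
    IntegrableOn (fun u ↦ Real.exp (-(lam * u)) * Real.exp (-((u + w / u) / 2 * √μ)) / u) (Ioi 0) ∧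
      ∫ u in Ioi 0, Real.exp (-(lam * u)) * Real.exp (-((u + w / u) / 2 * √μ)) / u
        = ∫ ℓ in Ioi 0, Real.exp (-((μ + 2 * lam * √μ) * ℓ)) * heatRadial w ℓ := by
  have hb : 0 < 2 * √μ := by positivity
  have h1 := integrableOn_Ioi_comp_mul_left_iff
    (fun u ↦ Real.exp (-(lam * u)) * Real.exp (-((u + w / u) / 2 * √μ)) / u) 0 hb
  have h2 := integral_comp_mul_left_Ioi
    (fun u ↦ Real.exp (-(lam * u)) * Real.exp (-((u + w / u) / 2 * √μ)) / u) 0 hb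
  rw [mul_zero] at h1 h2
  have he : EqOn (fun ℓ ↦ (2 * √μ)⁻¹ * (Real.exp (-((μ + 2 * lam * √μ) * ℓ)) * heatRadial w ℓ))
      (fun ℓ ↦ Real.exp (-(lam * (2 * √μ * ℓ))) *
        Real.exp (-((2 * √μ * ℓ + w / (2 * √μ * ℓ)) / 2 * √μ)) / (2 * √μ * ℓ)) (Ioi 0) :=
    fun ℓ hℓ ↦ (exp_branch_comp_mul hμ hℓ).symm
  constructor
  · refine h1.1 (IntegrableOn.congr_fun ?_ he measurableSet_Ioi)
    exact (integrableOn_exp_mul_heatRadial (by positivity) hw).const_mul _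
  · rw [← setIntegral_congr_fun measurableSet_Ioi he, integral_const_mul, smul_eq_mul] at h2
    exact (mul_left_cancel₀ (inv_ne_zero hb.ne') h2).symm

theorem integrable_prod_branchIntegrand (hlam : 0 < lam) (hμ : 0 < μ) (hw : 0 < w) :
    Integrable (Function.uncurry fun u t ↦ Real.exp (-μ * t) * branchIntegrand lam w t u)
        ((volume.restrict (Ioi 0)).prod (volume.restrict (Ioi 0))) ∧
      ∫ t in Ioi 0, Real.exp (-μ * t) * ∫ u in Ioi 0, branchIntegrand lam w t u
        = (1 / √μ + 1 / (2 * lam)) *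
          ∫ ℓ in Ioi 0, Real.exp (-((μ + 2 * lam * √μ) * ℓ)) * heatRadial w ℓ := by
  have hs : ∀ u ∈ Ioi (0 : ℝ), 0 < (u + w / u) / 2 := fun u hu ↦ by
    have : 0 < u := hu
    positivity
  have he : ∀ u : ℝ, (fun t ↦ Real.exp (-μ * t) * branchIntegrand lam w t u) = fun t ↦
      (Real.exp (-(lam * u)) / u) * (Real.exp (-μ * t) * timeKernel lam ((u + w / u) / 2) t) := by
    intro u
    ext t
    rw [branchIntegrand]
    ring
  have hval : ∀ u ∈ Ioi (0 : ℝ), ∫ t in Ioi 0, Real.exp (-μ * t) * branchIntegrand lam w t u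
      = (1 / √μ + 1 / (2 * lam)) *
        (Real.exp (-(lam * u)) * Real.exp (-((u + w / u) / 2 * √μ)) / u) := by
    intro u hu
    rw [he, integral_const_mul, (laplace_timeKernel (hs u hu) hμ).2]
    ring
  have hE := integral_exp_branch hlam hμ hw
  have hint : Integrable (Function.uncurry fun u t ↦
      Real.exp (-μ * t) * branchIntegrand lam w t u)
      ((volume.restrict (Ioi 0)).prod (volume.restrict (Ioi 0))) := by
    refine integrable_prod_restrict_of_nonneg measurableSet_Ioi measurableSet_Ioi ?_ ?_ ?_ ?_
    · have h3 : Measurable fun x : ℝ × ℝ ↦ Real.exp (-μ * x.2) := by fun_prop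
      exact h3.mul (measurable_branchIntegrand lam w)
    · intro u hu t _
      exact mul_nonneg (Real.exp_pos _).le (branchIntegrand_nonneg hlam hw t hu)
    · intro u hu
      rw [he]
      exact (laplace_timeKernel (hs u hu) hμ).1.const_mul _
    · refine IntegrableOn.congr_fun ?_ (fun u hu ↦ (hval u hu).symm) measurableSet_Ioi
      exact hE.1.const_mul _
  refine ⟨hint, ?_⟩
  simp only [← integral_const_mul]
  rw [← integral_integral_swap hint, setIntegral_congr_fun measurableSet_Ioi hval,
    integral_const_mul, hE.2, integral_const_mul]

theorem branchIntegrand_le_mul (hlam : 0 < lam) (hw : 0 < w) {r₀ r T u : ℝ} (hu : 0 < u)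
    (h0 : 0 < r₀) (h1 : r₀ ≤ r) (h2 : r ≤ T) :
    branchIntegrand lam w r u ≤ (T / r₀) ^ 2 * branchIntegrand lam w T u := by
  have h := timeKernel_le_mul (s := (u + w / u) / 2) hlam (by positivity) h0 h1 h2
  rw [branchIntegrand, branchIntegrand, mul_div_assoc', mul_left_comm]
  gcongr

/-- Fubini gives integrability only for almost every time. Some such `T` lies beyond `t`, and
comparison with it settles `t`. -/
theorem integrableOn_branchIntegrand (hlam : 0 < lam) (hw : 0 < w) {t : ℝ} (ht : 0 < t) :
    IntegrableOn (branchIntegrand lam w t) (Ioi 0) := by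
  have hint := (integrable_prod_branchIntegrand hlam one_pos hw).1
  have hae := hint.swap.prod_right_ae
  have hae' : ∀ᵐ T ∂volume.restrict (Ioi t), IntegrableOn (branchIntegrand lam w T) (Ioi 0) := by
    filter_upwards [ae_restrict_of_ae_restrict_of_subset (Ioi_subset_Ioi ht.le) hae] with T hT
    have h2 := hT.const_mul (Real.exp (-1 * T))⁻¹
    refine h2.congr (ae_of_all _ fun u ↦ ?_)
    simp
  have hne : (ae (volume.restrict (Ioi t))).NeBot := by
    rw [ae_neBot]
    simp
  obtain ⟨T, hT, htT⟩ := (hae'.and (ae_restrict_mem measurableSet_Ioi)).exists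
  have hm : AEStronglyMeasurable (branchIntegrand lam w t) (volume.restrict (Ioi 0)) :=
    ((measurable_branchIntegrand lam w).comp measurable_prodMk_right).aestronglyMeasurable
  refine (hT.const_mul ((T / t) ^ 2)).mono' hm ?_
  filter_upwards [ae_restrict_mem measurableSet_Ioi] with u hu
  rw [Real.norm_of_nonneg (branchIntegrand_nonneg hlam hw t hu)]
  exact branchIntegrand_le_mul hlam hw hu ht le_rfl (le_of_lt htT)

theorem continuousOn_integral_branchIntegrand (hlam : 0 < lam) (hw : 0 < w) :
    ContinuousOn (fun t ↦ ∫ u in Ioi 0, branchIntegrand lam w t u) (Ioi 0) := by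
  intro t ht
  have ht0 : 0 < t := ht
  refine ContinuousAt.continuousWithinAt ?_
  refine continuousAt_of_dominated
    (bound := fun u ↦ (2 * t / (t / 2)) ^ 2 * branchIntegrand lam w (2 * t) u) ?_ ?_ ?_ ?_
  · exact Eventually.of_forall fun r ↦
      ((measurable_branchIntegrand lam w).comp measurable_prodMk_right).aestronglyMeasurable
  · filter_upwards [Ioo_mem_nhds (half_lt_self ht0) (by linarith : t < 2 * t)] with r hr
    filter_upwards [ae_restrict_mem measurableSet_Ioi] with u hu
    rw [Real.norm_of_nonneg (branchIntegrand_nonneg hlam hw r hu)]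
    exact branchIntegrand_le_mul hlam hw hu (half_pos ht0) hr.1.le hr.2.le
  · exact (integrableOn_branchIntegrand hlam hw (by positivity)).const_mul _
  · filter_upwards with u
    have := continuousAt_timeKernel lam ((u + w / u) / 2) ht0
    exact (this.const_mul _).div_const _

/-- Both sides are nonnegative, continuous in `t`, and share the Laplace transform
$2\lambda\bigl(\frac1{\sqrt\mu}+\frac1{2\lambda}\bigr)\int_0^\infty
e^{-(\mu+2\lambda\sqrt\mu)\ell}\,e^{-w/(4\ell)}\,\frac{d\ell}{\ell}$. -/
theorem relax_heatRadial_eq (hlam : 0 < lam) (hw : 0 < w) {t : ℝ} (ht : 0 < t) :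
    relax lam (heatRadial w) t = 2 * lam * ∫ u in Ioi 0, branchIntegrand lam w t u := by
  have hlap : ∀ μ : ℝ, 0 < μ →
      ∫ t in Ioi 0, Real.exp (-μ * t) * relax lam (heatRadial w) t
        = ∫ t in Ioi 0, Real.exp (-μ * t) *
            (2 * lam * ∫ u in Ioi 0, branchIntegrand lam w t u) := by
    intro μ hμ
    simp only [mul_left_comm _ (2 * lam)]
    rw [(laplace_relax_heatRadial hlam hμ hw).2, integral_const_mul,
      (integrable_prod_branchIntegrand hlam hμ hw).2]
    ring
  refine eqOn_Ioi_of_laplace_nat (g := fun t ↦ 2 * lam * ∫ u in Ioi 0, branchIntegrand lam w t u)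
    ?_ ?_ ?_ ?_ (laplace_relax_heatRadial hlam one_pos hw).1 ?_
    (fun n ↦ hlap _ (by positivity)) ht
  · intro t ht
    exact (hasDerivAt_relax hlam ht (fun ℓ hℓ ↦ hasDerivAt_heatRadial w hℓ)
      (continuousOn_heatRadialDeriv w) (fun ℓ hℓ ↦ abs_heatRadialDeriv_le hw hℓ)
      (tendsto_heatRadial hw)).continuousAt.continuousWithinAt
  · exact (continuousOn_integral_branchIntegrand hlam hw).const_mul _
  · intro t _
    exact setIntegral_nonneg measurableSet_Ioi fun ℓ hℓ ↦
      mul_nonneg (inverseDensity_nonneg hlam (le_of_lt hℓ) t) (heatRadial_nonneg w hℓ)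
  · intro t _
    exact mul_nonneg (by positivity) (setIntegral_nonneg measurableSet_Ioi fun u hu ↦
      branchIntegrand_nonneg hlam hw t hu)
  · have h := (integrable_prod_branchIntegrand hlam one_pos hw).1.integral_prod_right
    refine (h.const_mul (2 * lam)).congr (ae_of_all _ fun t ↦ ?_)
    simp only [integral_const_mul, Function.uncurry]
    ring

end

section

variable {lam c w t : ℝ}

theorem hasDerivAt_branch {u : ℝ} (hu : 0 < u) :
    HasDerivAt (fun u : ℝ ↦ (u + w / u) / 2) ((1 - w / u ^ 2) / 2) u := by
  have h := ((hasDerivAt_id u).add ((hasDerivAt_inv hu.ne').const_mul w)).div_const 2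
  refine (h.congr_deriv ?_).congr_of_eventuallyEq (Eventually.of_forall fun x ↦ ?_)
  · simp [div_eq_mul_inv, sub_eq_add_neg]
  · simp [div_eq_mul_inv]

/-- Consequently $s\pm\sqrt{s^2-w}$ are the numbers $u$ and $w/u$ in some order: $u$ is the larger
root when $u>\sqrt w$ and the smaller when $u<\sqrt w$. -/
theorem sqrt_branch {u : ℝ} (hu : 0 < u) : √(((u + w / u) / 2) ^ 2 - w) = |u - w / u| / 2 := by
  have : ((u + w / u) / 2) ^ 2 - w = ((u - w / u) / 2) ^ 2 := by field_simp; ring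
  rw [this, Real.sqrt_sq_eq_abs, abs_div, abs_two]

theorem eq_of_branch_eq {u v : ℝ} (hu : 0 < u) (hv : 0 < v) (hne : u * v ≠ w)
    (h : (u + w / u) / 2 = (v + w / v) / 2) : u = v := by
  have h1 : (u - v) * (u * v - w) = 0 := by
    field_simp at h
    linear_combination h
  rcases mul_eq_zero.1 h1 with h2 | h2
  · linarith
  · exact absurd (sub_eq_zero.1 h2) hne

theorem div_lt_self_iff_sqrt_lt {u : ℝ} (hu : 0 < u) : w / u < u ↔ √w < u := by
  rw [div_lt_iff₀ hu, Real.sqrt_lt' hu, sq]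

theorem sqrt_lt_branch {u : ℝ} (hu : 0 < u) (hw : 0 < w) (hne : u ≠ √w) :
    √w < (u + w / u) / 2 := by
  rw [Real.sqrt_lt' (by positivity)]
  have : ((u + w / u) / 2) ^ 2 - w = ((u - w / u) / 2) ^ 2 := by field_simp; ring
  have h2 : u - w / u ≠ 0 := by
    intro h
    apply hne
    rw [sub_eq_zero, eq_div_iff hu.ne'] at h
    rw [← h, Real.sqrt_mul_self hu.le]
  have : 0 < ((u - w / u) / 2) ^ 2 := by positivity
  linarith

theorem image_branch_Ioi (hw : 0 < w) :
    (fun u : ℝ ↦ (u + w / u) / 2) '' Ioi √w = Ioi √w := by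
  have hs : 0 < √w := Real.sqrt_pos.2 hw
  ext s
  constructor
  · rintro ⟨u, hu, rfl⟩
    exact sqrt_lt_branch (hs.trans hu) hw (ne_of_gt hu)
  · intro hs'
    have h0 : 0 < s := hs.trans hs'
    have h1 : 0 < s ^ 2 - w := by
      have := (Real.sqrt_lt' h0).1 hs'
      linarith
    have h2 : √(s ^ 2 - w) ^ 2 = s ^ 2 - w := Real.sq_sqrt h1.le
    have h3 : 0 ≤ √(s ^ 2 - w) := Real.sqrt_nonneg _
    -- The larger root of $u^2-2su+w=0$.
    refine ⟨s + √(s ^ 2 - w), lt_of_lt_of_le hs' (le_add_of_nonneg_right h3), ?_⟩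
    have h4 : w / (s + √(s ^ 2 - w)) = s - √(s ^ 2 - w) := by
      rw [div_eq_iff (by positivity)]
      linear_combination h2
    simp only [h4]
    ring

theorem image_branch_Ioo (hw : 0 < w) :
    (fun u : ℝ ↦ (u + w / u) / 2) '' Ioo 0 √w = Ioi √w := by
  have hs : 0 < √w := Real.sqrt_pos.2 hw
  ext s
  constructor
  · rintro ⟨u, hu, rfl⟩
    exact sqrt_lt_branch hu.1 hw (ne_of_lt hu.2)
  · intro hs'
    rw [← image_branch_Ioi hw] at hs'
    obtain ⟨u, hu, rfl⟩ := hs'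
    have hu0 : 0 < u := hs.trans hu
    -- The involution `u ↦ w / u` fixes `s` and exchanges the two branches.
    refine ⟨w / u, ⟨by positivity, ?_⟩, ?_⟩
    · rw [div_lt_iff₀ hu0]
      nlinarith [Real.mul_self_sqrt hw.le, mem_Ioi.1 hu]
    · simp only
      field_simp
      ring

theorem injOn_branch_Ioi (hw : 0 < w) :
    InjOn (fun u : ℝ ↦ (u + w / u) / 2) (Ioi √w) := by
  intro u hu v hv h
  have hs : 0 < √w := Real.sqrt_pos.2 hw
  refine eq_of_branch_eq (hs.trans hu) (hs.trans hv) (ne_of_gt ?_) h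
  nlinarith [Real.mul_self_sqrt hw.le, mem_Ioi.1 hu, mem_Ioi.1 hv]

theorem injOn_branch_Ioo (hw : 0 < w) :
    InjOn (fun u : ℝ ↦ (u + w / u) / 2) (Ioo 0 √w) := by
  intro u hu v hv h
  refine eq_of_branch_eq hu.1 hv.1 (ne_of_lt ?_) h
  have := mul_lt_mul'' hu.2 hv.2 hu.1.le hv.1.le
  rwa [Real.mul_self_sqrt hw.le] at this

/-- The summand of the law of the planar motion belonging to the branch of sign `e`, times the
time kernel. -/
noncomputable def branchTerm (lam w t e s : ℝ) : ℝ :=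
  Real.exp (-(lam * (s + e * √(s ^ 2 - w)))) * timeKernel lam s t / √(s ^ 2 - w)

/-- Here `e` is the sign of `u - w / u`. The Jacobian is $|u-w/u|/(2u)$, and its numerator cancels
the singular factor $\sqrt{s^2-w}$. -/
theorem abs_deriv_mul_branchTerm {u e : ℝ} (hu : 0 < u) (hne : u - w / u ≠ 0)
    (he : e * |u - w / u| = u - w / u) :
    |(1 - w / u ^ 2) / 2| • branchTerm lam w t e ((u + w / u) / 2) = branchIntegrand lam w t u := by
  have h1 : |(1 - w / u ^ 2) / 2| = |u - w / u| / 2 / u := by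
    have : (1 - w / u ^ 2) / 2 = (u - w / u) / 2 / u := by field_simp
    rw [this, abs_div, abs_div, abs_two, abs_of_pos hu]
  have h2 : (u + w / u) / 2 + e * (|u - w / u| / 2) = u := by
    linear_combination he / 2
  have h3 : |u - w / u| ≠ 0 := abs_ne_zero.2 hne
  rw [h1, branchTerm, sqrt_branch hu, h2, branchIntegrand, smul_eq_mul]
  generalize |u - w / u| = v at h3
  field_simp

theorem branchTerm_Ioi (hlam : 0 < lam) (hw : 0 < w) (ht : 0 < t) :
    IntegrableOn (branchTerm lam w t 1) (Ioi √w) ∧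
      ∫ s in Ioi √w, branchTerm lam w t 1 s = ∫ u in Ioi √w, branchIntegrand lam w t u := by
  have hs : 0 < √w := Real.sqrt_pos.2 hw
  have hd : ∀ u ∈ Ioi √w, HasDerivWithinAt (fun u : ℝ ↦ (u + w / u) / 2)
      ((1 - w / u ^ 2) / 2) (Ioi √w) u :=
    fun u hu ↦ (hasDerivAt_branch (hs.trans hu)).hasDerivWithinAt
  have he : EqOn (fun u ↦ |(1 - w / u ^ 2) / 2| • branchTerm lam w t 1 ((u + w / u) / 2))
      (branchIntegrand lam w t) (Ioi √w) := by
    intro u hu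
    have hu0 : 0 < u := hs.trans hu
    have h1 : 0 < u - w / u := sub_pos.2 ((div_lt_self_iff_sqrt_lt hu0).2 hu)
    exact abs_deriv_mul_branchTerm hu0 h1.ne' (by rw [one_mul, abs_of_pos h1])
  have h1 := integrableOn_image_iff_integrableOn_abs_deriv_smul measurableSet_Ioi hd
    (injOn_branch_Ioi hw) (branchTerm lam w t 1)
  have h2 := integral_image_eq_integral_abs_deriv_smul measurableSet_Ioi hd
    (injOn_branch_Ioi hw) (branchTerm lam w t 1)
  rw [image_branch_Ioi hw] at h1 h2
  constructor
  · refine h1.2 (IntegrableOn.congr_fun ?_ he.symm measurableSet_Ioi)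
    exact (integrableOn_branchIntegrand hlam hw ht).mono_set (Ioi_subset_Ioi hs.le)
  · rw [h2, setIntegral_congr_fun measurableSet_Ioi he]

theorem branchTerm_Ioo (hlam : 0 < lam) (hw : 0 < w) (ht : 0 < t) :
    IntegrableOn (branchTerm lam w t (-1)) (Ioi √w) ∧
      ∫ s in Ioi √w, branchTerm lam w t (-1) s
        = ∫ u in Ioo 0 √w, branchIntegrand lam w t u := by
  have hd : ∀ u ∈ Ioo 0 √w, HasDerivWithinAt (fun u : ℝ ↦ (u + w / u) / 2)
      ((1 - w / u ^ 2) / 2) (Ioo 0 √w) u :=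
    fun u hu ↦ (hasDerivAt_branch hu.1).hasDerivWithinAt
  have he : EqOn (fun u ↦ |(1 - w / u ^ 2) / 2| • branchTerm lam w t (-1) ((u + w / u) / 2))
      (branchIntegrand lam w t) (Ioo 0 √w) := by
    intro u hu
    have h1 : u - w / u < 0 := by
      rw [sub_neg, lt_div_iff₀ hu.1, ← sq]
      exact (Real.lt_sqrt hu.1.le).1 hu.2
    exact abs_deriv_mul_branchTerm hu.1 h1.ne (by rw [abs_of_neg h1]; ring)
  have h1 := integrableOn_image_iff_integrableOn_abs_deriv_smul measurableSet_Ioo hd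
    (injOn_branch_Ioo hw) (branchTerm lam w t (-1))
  have h2 := integral_image_eq_integral_abs_deriv_smul measurableSet_Ioo hd
    (injOn_branch_Ioo hw) (branchTerm lam w t (-1))
  rw [image_branch_Ioo hw] at h1 h2
  constructor
  · refine h1.2 (IntegrableOn.congr_fun ?_ he.symm measurableSet_Ioo)
    exact (integrableOn_branchIntegrand hlam hw ht).mono_set Ioo_subset_Ioi_self
  · rw [h2, setIntegral_congr_fun measurableSet_Ioo he]

/-! ### The composed law as an average of heat kernels -/

theorem composedIntegrand_eq (hc : 0 < c) {z : ℝ × ℝ} (ht : 0 < t)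
    (hz : z.1 ^ 2 + z.2 ^ 2 = c ^ 2 * w) {s : ℝ} (hs : 0 < s) :
    composedIntegrand lam c z t s = if √w < s then
      lam / (2 * Real.pi * c ^ 2) * (branchTerm lam w t (-1) s + branchTerm lam w t 1 s) else 0 := by
  have hc2 : 0 < c ^ 2 := by positivity
  have hiff : z.1 ^ 2 + z.2 ^ 2 < c ^ 2 * s ^ 2 ↔ √w < s := by
    rw [hz, mul_lt_mul_iff_right₀ hc2, Real.sqrt_lt' hs]
  rw [composedIntegrand, modifiedLaw, rlDeriv_reflDensity hs ht, ← timeKernel]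
  by_cases h : √w < s
  · rw [if_pos (hiff.2 h), if_pos h, hz, ← mul_sub, Real.sqrt_mul hc2.le, Real.sqrt_sq hc.le]
    have hpos : 0 < s ^ 2 - w := sub_pos.2 ((Real.sqrt_lt' hs).1 h)
    have hv : √(s ^ 2 - w) ≠ 0 := by positivity
    have e1 : lam / c * (c * √(s ^ 2 - w)) = lam * √(s ^ 2 - w) := by field_simp
    rw [e1, branchTerm, branchTerm]
    generalize √(s ^ 2 - w) = v at hv
    have e2 : Real.exp (-(lam * (s + -1 * v))) = Real.exp (-lam * s) * Real.exp (lam * v) := by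
      rw [← Real.exp_add]; ring_nf
    have e3 : Real.exp (-(lam * (s + 1 * v))) = Real.exp (-lam * s) * Real.exp (-(lam * v)) := by
      rw [← Real.exp_add]; ring_nf
    rw [e2, e3]
    field_simp
  · rw [if_neg (fun h' ↦ h (hiff.1 h')), if_neg h, zero_mul]

/-- The exponentials with `e = -1` and `e = 1` cover `u < √w` and `u > √w`, so together they give
the integral over all `u > 0`. The constant is $\frac{\lambda}{2\pi c^2}\cdot\frac1{2\lambda}$. -/
theorem composedLaw_eq_relax (hlam : 0 < lam) (hc : 0 < c) (hw : 0 < w) {z : ℝ × ℝ} (ht : 0 < t)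
    (hz : z.1 ^ 2 + z.2 ^ 2 = c ^ 2 * w) :
    IntegrableOn (composedIntegrand lam c z t) (Ioi 0) ∧
      composedLaw lam c z t = 1 / (4 * Real.pi * c ^ 2) * relax lam (heatRadial w) t := by
  have hs : 0 < √w := Real.sqrt_pos.2 hw
  have h1 := branchTerm_Ioi hlam hw ht
  have h2 := branchTerm_Ioo hlam hw ht
  have hN := integrableOn_branchIntegrand hlam hw ht
  have heq : EqOn (fun s ↦ lam / (2 * Real.pi * c ^ 2) *
      (branchTerm lam w t (-1) s + branchTerm lam w t 1 s)) (composedIntegrand lam c z t)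
      (Ioi √w) := by
    intro s hs'
    rw [composedIntegrand_eq hc ht hz (hs.trans hs'), if_pos (mem_Ioi.1 hs')]
  have hzero : ∀ s ∈ Ioi 0 \ Ioi √w, composedIntegrand lam c z t s = 0 := by
    intro s hs'
    rw [composedIntegrand_eq hc ht hz hs'.1, if_neg (fun h ↦ hs'.2 (mem_Ioi.2 h))]
  have hi : IntegrableOn (composedIntegrand lam c z t) (Ioi √w) :=
    IntegrableOn.congr_fun ((h2.1.add h1.1).const_mul _) heq measurableSet_Ioi
  refine ⟨hi.of_forall_sdiff_eq_zero measurableSet_Ioi hzero, ?_⟩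
  rw [composedLaw, setIntegral_eq_of_subset_of_forall_sdiff_eq_zero measurableSet_Ioi
    (Ioi_subset_Ioi hs.le) hzero, ← setIntegral_congr_fun measurableSet_Ioi heq,
    integral_const_mul, integral_add h2.1 h1.1, h1.2, h2.2, relax_heatRadial_eq hlam hw ht,
    ← Ioc_union_Ioi_eq_Ioi hs.le, setIntegral_union (Ioc_disjoint_Ioi le_rfl) measurableSet_Ioi
      (hN.mono_set Ioc_subset_Ioi_self) (hN.mono_set (Ioi_subset_Ioi hs.le)),
    integral_Ioc_eq_integral_Ioo]
  field_simp
  ring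

end

/-! ### The pointwise equation: smoothness and Laplacian of the radial profile. -/

section

variable {lam c w t M G₀ : ℝ} {G G' f : ℝ → ℝ}

/-- Agreement at positive times is enough: derivatives there are local, and the Caputo integral only
sees `(0, t]`. -/
theorem solves_of_eqOn_relax (hlam : 0 < lam) (ht : 0 < t)
    (hG : ∀ ℓ ∈ Ioi 0, HasDerivAt G (G' ℓ) ℓ) (hc : ContinuousOn G' (Ioi 0))
    (hM : ∀ ℓ ∈ Ioi 0, |G' ℓ| ≤ M) (h0 : Tendsto G (𝓝[>] 0) (𝓝 G₀))
    (hf : EqOn f (relax lam G) (Ioi 0)) :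
    DifferentiableAt ℝ f t ∧ HasCaputoDeriv (1 / 2) f t ∧
      deriv f t + 2 * lam * caputoDeriv (1 / 2) f t = relax lam G' t := by
  have hd : ∀ r ∈ Ioi (0 : ℝ), HasDerivAt f (relaxRate lam G' r) r := fun r hr ↦
    (hasDerivAt_relax hlam hr hG hc hM h0).congr_of_eventuallyEq
      (hf.eventuallyEq_of_mem (Ioi_mem_nhds hr))
  have hde : ∀ r ∈ Ioi (0 : ℝ), deriv f r = deriv (relax lam G) r := fun r hr ↦ by
    rw [(hd r hr).deriv, (hasDerivAt_relax hlam hr hG hc hM h0).deriv]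
  have hC := hasCaputoDeriv_relax hlam ht hG hc hM h0
  refine ⟨(hd t ht).differentiableAt, ⟨fun r hr ↦ (hd r hr.1).differentiableAt, ?_⟩, ?_⟩
  · refine hC.1.integrable.congr fun r hr ↦ ?_
    rw [uIoc_of_le ht.le] at hr
    simp only [hde r hr.1]
  · rw [← relax_equation hlam ht hG hc hM h0, hde t ht, caputoDeriv, caputoDeriv,
      intervalIntegral.integral_of_le ht.le, intervalIntegral.integral_of_le ht.le,
      setIntegral_congr_fun measurableSet_Ioc (fun r hr ↦ by simp only [hde r hr.1] :
        EqOn _ (fun r ↦ deriv (relax lam G) r / (t - r) ^ (1 / 2 : ℝ)) _)]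

/-- The mixing measure of the radial profile of the composed law. -/
noncomputable def mixMeasure (lam t : ℝ) : Measure ℝ :=
  (volume.restrict (Ioi 0)).withDensity fun ℓ ↦ ENNReal.ofReal (inverseDensity lam t ℓ / ℓ)

theorem measurable_inverseDensity_right (lam t : ℝ) : Measurable (inverseDensity lam t) := by
  unfold inverseDensity hitDensity reflDensity
  fun_prop

theorem measurable_ofReal_inverseDensity_div (lam t : ℝ) :
    Measurable fun ℓ ↦ ENNReal.ofReal (inverseDensity lam t ℓ / ℓ) :=
  ((measurable_inverseDensity_right lam t).div measurable_id).ennreal_ofReal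

theorem toReal_inverseDensity_div (hlam : 0 < lam) (t : ℝ) {ℓ : ℝ} (hℓ : 0 < ℓ) :
    (ENNReal.ofReal (inverseDensity lam t ℓ / ℓ)).toReal = inverseDensity lam t ℓ / ℓ :=
  ENNReal.toReal_ofReal (div_nonneg (inverseDensity_nonneg hlam hℓ.le t) hℓ.le)

theorem integral_mixMeasure (hlam : 0 < lam) (t : ℝ) (g : ℝ → ℝ) :
    ∫ ℓ, g ℓ ∂mixMeasure lam t = ∫ ℓ in Ioi 0, inverseDensity lam t ℓ / ℓ * g ℓ := by
  rw [mixMeasure, integral_withDensity_eq_integral_toReal_smul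
    (measurable_ofReal_inverseDensity_div lam t) (ae_of_all _ fun _ ↦ ENNReal.ofReal_lt_top)]
  refine setIntegral_congr_fun measurableSet_Ioi fun ℓ hℓ ↦ ?_
  simp only [toReal_inverseDensity_div hlam t hℓ, smul_eq_mul]

theorem integrable_exp_mixMeasure (hlam : 0 < lam) (ht : 0 < t) {x : ℝ} (hx : x < 0) :
    Integrable (fun ℓ ↦ Real.exp (x * (1 / (4 * ℓ)))) (mixMeasure lam t) := by
  rw [mixMeasure, integrable_withDensity_iff_integrable_smul'
    (measurable_ofReal_inverseDensity_div lam t) (ae_of_all _ fun _ ↦ ENNReal.ofReal_lt_top)]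
  have hw : 0 < -x := neg_pos.2 hx
  refine (integrableOn_inverseDensity_mul hlam ht (fun ℓ hℓ ↦ hasDerivAt_heatRadial (-x) hℓ)
    (fun ℓ hℓ ↦ abs_heatRadialDeriv_le hw hℓ)).congr_fun (fun ℓ hℓ ↦ ?_) measurableSet_Ioi
  simp only [toReal_inverseDensity_div hlam t hℓ, smul_eq_mul, heatRadial]
  have : -(-x / (4 * ℓ)) = x * (1 / (4 * ℓ)) := by ring
  rw [this]
  ring

theorem mem_interior_integrableExpSet (hlam : 0 < lam) (ht : 0 < t) {x : ℝ} (hx : x < 0) :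
    x ∈ interior (integrableExpSet (fun ℓ : ℝ ↦ 1 / (4 * ℓ)) (mixMeasure lam t)) :=
  mem_interior.2 ⟨Iio 0, fun _ hy ↦ integrable_exp_mixMeasure hlam ht hy, isOpen_Iio, hx⟩

/-- Reading the profile as a moment generating function gives analyticity in `w > 0`, with moments
as derivatives. The mixing measure is infinite, since its density behaves like a multiple of `1 / ℓ`
near zero, but negative arguments stay integrable. -/
theorem mgf_mixMeasure (hlam : 0 < lam) (w t : ℝ) :
    mgf (fun ℓ : ℝ ↦ 1 / (4 * ℓ)) (mixMeasure lam t) (-w) = relax lam (heatRadial w) t := by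
  rw [mgf, integral_mixMeasure hlam, relax]
  refine setIntegral_congr_fun measurableSet_Ioi fun ℓ hℓ ↦ ?_
  simp only [heatRadial]
  have : -w * (1 / (4 * ℓ)) = -(w / (4 * ℓ)) := by ring
  rw [this]
  ring

/-- The `n`-th moment entering the `n`-th derivative of the radial profile. -/
noncomputable def mixMoment (lam t : ℝ) (n : ℕ) (w : ℝ) : ℝ :=
  ∫ ℓ, (1 / (4 * ℓ)) ^ n * Real.exp (-w * (1 / (4 * ℓ))) ∂mixMeasure lam t

theorem hasDerivAt_mixMoment (hlam : 0 < lam) (ht : 0 < t) (hw : 0 < w) (n : ℕ) :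
    HasDerivAt (mixMoment lam t n) (-mixMoment lam t (n + 1) w) w := by
  have h := hasDerivAt_integral_pow_mul_exp_real
    (mem_interior_integrableExpSet hlam ht (neg_lt_zero.2 hw)) n
  have h2 := h.comp w (hasDerivAt_neg w)
  exact h2.congr_deriv (by rw [mixMoment]; ring)

theorem mixMoment_zero (hlam : 0 < lam) (w t : ℝ) :
    mixMoment lam t 0 w = relax lam (heatRadial w) t := by
  rw [← mgf_mixMeasure hlam, mixMoment, mgf]
  simp

/-- With $X=1/(4\ell)$ one has $w/(4\ell^2)-1/\ell=4wX^2-4X$. As the profile $W$ has $W'=-\mathbb E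
X(\cdot)$ and $W''=\mathbb E X^2(\cdot)$ under the mixing measure, this is the radial operator
$4wW''+4W'$. -/
theorem relax_heatRadialDeriv (hlam : 0 < lam) (ht : 0 < t) (hw : 0 < w) :
    relax lam (heatRadialDeriv w) t
      = 4 * w * mixMoment lam t 2 w - 4 * mixMoment lam t 1 w := by
  have hi := fun n ↦ integrable_pow_mul_exp_of_mem_interior_integrableExpSet
    (mem_interior_integrableExpSet hlam ht (neg_lt_zero.2 hw)) n
  rw [mixMoment, mixMoment, ← integral_const_mul, ← integral_const_mul,
    ← integral_sub ((hi 2).const_mul _) ((hi 1).const_mul _), integral_mixMeasure hlam, relax]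
  refine setIntegral_congr_fun measurableSet_Ioi fun ℓ hℓ ↦ ?_
  have hℓ' : ℓ ≠ 0 := ne_of_gt hℓ
  simp only [heatRadialDeriv, heatRadial]
  have : -w * (1 / (4 * ℓ)) = -(w / (4 * ℓ)) := by ring
  rw [this]
  field_simp

theorem contDiffAt_relax_heatRadial (hlam : 0 < lam) (ht : 0 < t) (hw : 0 < w) :
    ContDiffAt ℝ 2 (fun w ↦ relax lam (heatRadial w) t) w := by
  have h := (analyticAt_mgf (mem_interior_integrableExpSet hlam ht (neg_lt_zero.2 hw))).contDiffAt
    (n := 2)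
  have h2 : ContDiffAt ℝ 2 (fun w ↦ mgf (fun ℓ : ℝ ↦ 1 / (4 * ℓ)) (mixMeasure lam t) (-w)) w :=
    h.comp w contDiffAt_id.neg
  simpa only [mgf_mixMeasure hlam] using h2

theorem iteratedDeriv_two_comp_sq {F W W₁ W₂ : ℝ → ℝ} {b x : ℝ}
    (hW : ∀ w ∈ Ioi 0, HasDerivAt W (W₁ w) w) (hW₁ : ∀ w ∈ Ioi 0, HasDerivAt W₁ (W₂ w) w)
    (hF : F =ᶠ[𝓝 x] fun y ↦ W ((y ^ 2 + b) / c ^ 2)) (hx : 0 < (x ^ 2 + b) / c ^ 2) :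
    iteratedDeriv 2 F x = W₂ ((x ^ 2 + b) / c ^ 2) * (2 * x / c ^ 2) ^ 2
      + W₁ ((x ^ 2 + b) / c ^ 2) * (2 / c ^ 2) := by
  have hq : ∀ y : ℝ, HasDerivAt (fun y : ℝ ↦ (y ^ 2 + b) / c ^ 2) (2 * y / c ^ 2) y := by
    intro y
    simpa using ((hasDerivAt_pow 2 y).add_const b).div_const (c ^ 2)
  have hev : ∀ᶠ y in 𝓝 x, 0 < (y ^ 2 + b) / c ^ 2 :=
    (hq x).continuousAt.eventually (lt_mem_nhds hx)
  have h1 : deriv F =ᶠ[𝓝 x] fun y ↦ W₁ ((y ^ 2 + b) / c ^ 2) * (2 * y / c ^ 2) := by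
    refine hF.deriv.trans ?_
    filter_upwards [hev] with y hy
    exact ((hW _ hy).comp y (hq y)).deriv
  have h2 : HasDerivAt (fun y ↦ W₁ ((y ^ 2 + b) / c ^ 2) * (2 * y / c ^ 2))
      (W₂ ((x ^ 2 + b) / c ^ 2) * (2 * x / c ^ 2) * (2 * x / c ^ 2)
        + W₁ ((x ^ 2 + b) / c ^ 2) * (2 / c ^ 2)) x := by
    refine ((hW₁ _ hx).comp x (hq x)).mul ?_
    simpa using ((hasDerivAt_id x).const_mul 2).div_const (c ^ 2)
  rw [iteratedDeriv_succ, iteratedDeriv_one, h1.deriv_eq, h2.deriv]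
  ring

theorem normSq_pos {z : ℝ × ℝ} (hz : z ≠ 0) : 0 < z.1 ^ 2 + z.2 ^ 2 := by
  have : z.1 ≠ 0 ∨ z.2 ≠ 0 := by
    by_contra! h
    exact hz (Prod.ext h.1 h.2)
  rcases this with h | h <;> positivity

theorem composedLaw_eq_relax_of_ne (hlam : 0 < lam) (hc : 0 < c) (ht : 0 < t) {z : ℝ × ℝ}
    (hz : z ≠ 0) : composedLaw lam c z t
      = 1 / (4 * Real.pi * c ^ 2) * relax lam (heatRadial ((z.1 ^ 2 + z.2 ^ 2) / c ^ 2)) t := by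
  have h := normSq_pos hz
  exact (composedLaw_eq_relax hlam hc (by positivity) ht (by field_simp)).2

theorem composedLaw_eventuallyEq (hlam : 0 < lam) (hc : 0 < c) (ht : 0 < t) {z : ℝ × ℝ}
    (hz : z ≠ 0) : (fun y ↦ composedLaw lam c y t) =ᶠ[𝓝 z] fun y ↦ 1 / (4 * Real.pi * c ^ 2) *
      relax lam (heatRadial ((y.1 ^ 2 + y.2 ^ 2) / c ^ 2)) t := by
  filter_upwards [isOpen_ne.mem_nhds hz] with y hy using composedLaw_eq_relax_of_ne hlam hc ht hy

/-- For a function $W(|z|^2/c^2)$ the two second derivatives add up to $(4wW''+4W')/c^2$, matching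
`relax_heatRadialDeriv`. -/
theorem laplacian_composedLaw (hlam : 0 < lam) (hc : 0 < c) (ht : 0 < t) {z : ℝ × ℝ}
    (hz : z ≠ 0) : c ^ 2 * laplacian (fun y ↦ composedLaw lam c y t) z
      = 1 / (4 * Real.pi * c ^ 2) *
        relax lam (heatRadialDeriv ((z.1 ^ 2 + z.2 ^ 2) / c ^ 2)) t := by
  have hn := normSq_pos hz
  have hw : 0 < (z.1 ^ 2 + z.2 ^ 2) / c ^ 2 := by positivity
  have hE := composedLaw_eventuallyEq hlam hc ht hz
  simp only [← mixMoment_zero hlam] at hE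
  have hW : ∀ w ∈ Ioi (0 : ℝ), HasDerivAt (fun w ↦ 1 / (4 * Real.pi * c ^ 2) * mixMoment lam t 0 w)
      (1 / (4 * Real.pi * c ^ 2) * -mixMoment lam t 1 w) w := fun w hw ↦
    (hasDerivAt_mixMoment hlam ht hw 0).const_mul _
  have hW₁ : ∀ w ∈ Ioi (0 : ℝ), HasDerivAt
      (fun w ↦ 1 / (4 * Real.pi * c ^ 2) * -mixMoment lam t 1 w)
      (1 / (4 * Real.pi * c ^ 2) * mixMoment lam t 2 w) w := fun w hw ↦
    ((hasDerivAt_mixMoment hlam ht hw 1).neg.const_mul _).congr_deriv (by rw [neg_neg])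
  have h1 : (fun x ↦ composedLaw lam c (x, z.2) t) =ᶠ[𝓝 z.1] fun x ↦ 1 / (4 * Real.pi * c ^ 2) *
      mixMoment lam t 0 ((x ^ 2 + z.2 ^ 2) / c ^ 2) := by
    have : Tendsto (fun x : ℝ ↦ (x, z.2)) (𝓝 z.1) (𝓝 z) :=
      Continuous.tendsto (by fun_prop : Continuous fun x : ℝ ↦ (x, z.2)) z.1
    exact this.eventually hE
  have h2 : (fun y ↦ composedLaw lam c (z.1, y) t) =ᶠ[𝓝 z.2] fun y ↦ 1 / (4 * Real.pi * c ^ 2) *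
      mixMoment lam t 0 ((y ^ 2 + z.1 ^ 2) / c ^ 2) := by
    have : Tendsto (fun y : ℝ ↦ (z.1, y)) (𝓝 z.2) (𝓝 z) :=
      Continuous.tendsto (by fun_prop : Continuous fun y : ℝ ↦ (z.1, y)) z.2
    filter_upwards [this.eventually hE] with y hy
    rw [hy, add_comm (y ^ 2)]
  have hw' : 0 < (z.2 ^ 2 + z.1 ^ 2) / c ^ 2 := by rwa [add_comm]
  rw [laplacian, iteratedDeriv_two_comp_sq hW hW₁ h1 hw, iteratedDeriv_two_comp_sq hW hW₁ h2 hw',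
    relax_heatRadialDeriv hlam ht hw, add_comm (z.2 ^ 2)]
  field_simp
  ring

/-- The relaxation equation applied to the heat kernel at a fixed point `z ≠ 0`, where it starts
from zero and has bounded derivative in `ℓ`. -/
theorem solvesAt_composedLaw (hlam : 0 < lam) (hc : 0 < c) {z : ℝ × ℝ} (hz : z ≠ 0)
    (ht : 0 < t) : SolvesAt lam c (composedLaw lam c) z t := by
  have hn := normSq_pos hz
  have hw : 0 < (z.1 ^ 2 + z.2 ^ 2) / c ^ 2 := by positivity
  have hmul : ∀ (g : ℝ → ℝ) (r : ℝ), relax lam (fun ℓ ↦ 1 / (4 * Real.pi * c ^ 2) * g ℓ) r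
      = 1 / (4 * Real.pi * c ^ 2) * relax lam g r := by
    intro g r
    rw [relax, relax, ← integral_const_mul]
    congr 1 with ℓ
    ring
  obtain ⟨h1, h2, h3⟩ := solves_of_eqOn_relax (f := composedLaw lam c z)
    (G₀ := 1 / (4 * Real.pi * c ^ 2) * 0)
    (M := 1 / (4 * Real.pi * c ^ 2) * (128 / ((z.1 ^ 2 + z.2 ^ 2) / c ^ 2) ^ 2)) hlam ht
    (fun ℓ hℓ ↦ (hasDerivAt_heatRadial ((z.1 ^ 2 + z.2 ^ 2) / c ^ 2) hℓ).const_mul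
      (1 / (4 * Real.pi * c ^ 2)))
    ((continuousOn_heatRadialDeriv _).const_mul _)
    (fun ℓ hℓ ↦ by
      rw [abs_mul, abs_of_pos (by positivity : 0 < 1 / (4 * Real.pi * c ^ 2))]
      exact mul_le_mul_of_nonneg_left (abs_heatRadialDeriv_le hw hℓ) (by positivity))
    ((tendsto_heatRadial hw).const_mul _)
    (fun r hr ↦ by rw [hmul, composedLaw_eq_relax_of_ne hlam hc hr hz])
  refine ⟨h1, h2, ?_, ?_⟩
  · refine ContDiffAt.congr_of_eventuallyEq ?_ (composedLaw_eventuallyEq hlam hc ht hz)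
    refine contDiffAt_const.mul ?_
    refine ContDiffAt.comp (g := fun w ↦ relax lam (heatRadial w) t) z
      (contDiffAt_relax_heatRadial hlam ht hw) ?_
    exact ((contDiff_fst.pow 2).add (contDiff_snd.pow 2)).contDiffAt.div_const _
  · rw [h3, hmul, laplacian_composedLaw hlam hc ht hz]

end

section

variable {lam c t : ℝ}

/-! ### The planar heat kernel and heat averages -/

/-- The planar Gaussian density with characteristic function `exp (-c² ‖ξ‖²)`. -/
noncomputable def gaussPlane (c : ℝ) (y : ℝ × ℝ) : ℝ :=
  1 / (4 * Real.pi * c ^ 2) *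
    (Real.exp (-(1 / (4 * c ^ 2)) * y.1 ^ 2) * Real.exp (-(1 / (4 * c ^ 2)) * y.2 ^ 2))

/-- The heat kernel at time `c² ℓ`. -/
noncomputable def heatKernel (c ℓ : ℝ) (z : ℝ × ℝ) : ℝ :=
  1 / (4 * Real.pi * c ^ 2) * heatRadial ((z.1 ^ 2 + z.2 ^ 2) / c ^ 2) ℓ

/-- The heat semigroup at time `c² ℓ`, applied to `φ` and evaluated at the origin. -/
noncomputable def heatAvg (c : ℝ) (φ : ℝ × ℝ → ℝ) (ℓ : ℝ) : ℝ :=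
  ∫ y, gaussPlane c y * φ (√ℓ • y)

theorem gaussPlane_nonneg (c : ℝ) (y : ℝ × ℝ) : 0 ≤ gaussPlane c y := by
  unfold gaussPlane; positivity

theorem continuous_gaussPlane (c : ℝ) : Continuous (gaussPlane c) := by
  unfold gaussPlane; fun_prop

theorem integrable_gaussPlane (hc : 0 < c) : Integrable (gaussPlane c) := by
  have h := integrable_exp_neg_mul_sq (by positivity : 0 < 1 / (4 * c ^ 2))
  exact (h.mul_prod h).const_mul _

theorem integral_gaussPlane (hc : 0 < c) : ∫ y, gaussPlane c y = 1 := by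
  unfold gaussPlane
  rw [integral_const_mul, Measure.volume_eq_prod,
    integral_prod_mul (fun x : ℝ ↦ Real.exp (-(1 / (4 * c ^ 2)) * x ^ 2))
      (fun x : ℝ ↦ Real.exp (-(1 / (4 * c ^ 2)) * x ^ 2)), integral_gaussian,
    Real.mul_self_sqrt (by positivity)]
  field_simp

theorem integrable_fst_mul_gaussPlane (hc : 0 < c) : Integrable fun y ↦ y.1 * gaussPlane c y := by
  have h := integrable_exp_neg_mul_sq (by positivity : 0 < 1 / (4 * c ^ 2))
  have h' := integrable_mul_exp_neg_mul_sq (by positivity : 0 < 1 / (4 * c ^ 2))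
  refine ((h'.mul_prod h).const_mul (1 / (4 * Real.pi * c ^ 2))).congr (ae_of_all _ fun y ↦ ?_)
  simp only [gaussPlane]
  ring

theorem integrable_snd_mul_gaussPlane (hc : 0 < c) : Integrable fun y ↦ y.2 * gaussPlane c y := by
  have h := integrable_exp_neg_mul_sq (by positivity : 0 < 1 / (4 * c ^ 2))
  have h' := integrable_mul_exp_neg_mul_sq (by positivity : 0 < 1 / (4 * c ^ 2))
  refine ((h.mul_prod h').const_mul (1 / (4 * Real.pi * c ^ 2))).congr (ae_of_all _ fun y ↦ ?_)
  simp only [gaussPlane]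
  ring

theorem integrable_gaussPlane_mul (hc : 0 < c) {g : ℝ × ℝ → ℝ} (hg : Continuous g) {C : ℝ}
    (hC : ∀ y, |g y| ≤ C) : Integrable fun y ↦ gaussPlane c y * g y :=
  (integrable_gaussPlane hc).mul_bdd (c := C) hg.aestronglyMeasurable (ae_of_all _ hC)

theorem abs_heatAvg_le (hc : 0 < c) {φ : ℝ × ℝ → ℝ} {C : ℝ} (hC : ∀ y, |φ y| ≤ C) (ℓ : ℝ) :
    |heatAvg c φ ℓ| ≤ C := by
  have h : ∀ᵐ y ∂(volume : Measure (ℝ × ℝ)), ‖gaussPlane c y * φ (√ℓ • y)‖ ≤ gaussPlane c y * C :=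
    ae_of_all _ fun y ↦ by
      rw [norm_mul, Real.norm_of_nonneg (gaussPlane_nonneg c y)]
      exact mul_le_mul_of_nonneg_left (hC _) (gaussPlane_nonneg c y)
  have := norm_integral_le_of_norm_le ((integrable_gaussPlane hc).mul_const C) h
  rwa [integral_mul_const, integral_gaussPlane hc, one_mul] at this

theorem continuous_heatAvg (hc : 0 < c) {φ : ℝ × ℝ → ℝ} (hφ : Continuous φ) {C : ℝ}
    (hC : ∀ y, |φ y| ≤ C) : Continuous (heatAvg c φ) := by
  have hg := continuous_gaussPlane c
  refine continuous_of_dominated (bound := fun y ↦ gaussPlane c y * C) (fun ℓ ↦ ?_) (fun ℓ ↦ ?_)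
    ((integrable_gaussPlane hc).mul_const C) (ae_of_all _ fun y ↦ by fun_prop)
  · exact (by fun_prop : Continuous fun y : ℝ × ℝ ↦
      gaussPlane c y * φ (√ℓ • y)).aestronglyMeasurable
  · filter_upwards with y
    rw [norm_mul, Real.norm_of_nonneg (gaussPlane_nonneg c y)]
    exact mul_le_mul_of_nonneg_left (hC _) (gaussPlane_nonneg c y)

theorem heatAvg_zero (hc : 0 < c) (φ : ℝ × ℝ → ℝ) : heatAvg c φ 0 = φ 0 := by
  simp [heatAvg, integral_mul_const, integral_gaussPlane hc]

/-- Self-similarity of the heat kernel; the factor `ℓ⁻¹` cancels the planar volume factor of the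
dilation by `√ℓ`. -/
theorem heatKernel_smul (hc : 0 < c) {ℓ : ℝ} (hℓ : 0 < ℓ) (y : ℝ × ℝ) :
    heatKernel c ℓ (√ℓ • y) = ℓ⁻¹ * gaussPlane c y := by
  have h : -((((√ℓ • y).1 ^ 2 + (√ℓ • y).2 ^ 2) / c ^ 2) / (4 * ℓ))
      = -(1 / (4 * c ^ 2)) * y.1 ^ 2 + -(1 / (4 * c ^ 2)) * y.2 ^ 2 := by
    simp only [Prod.smul_fst, Prod.smul_snd, smul_eq_mul, mul_pow, Real.sq_sqrt hℓ.le]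
    field_simp
    ring
  rw [heatKernel, heatRadial, h, Real.exp_add, gaussPlane]
  ring

theorem integral_heatKernel_mul (hc : 0 < c) {ℓ : ℝ} (hℓ : 0 < ℓ) (φ : ℝ × ℝ → ℝ) :
    ∫ z, heatKernel c ℓ z * φ z = heatAvg c φ ℓ := by
  have h := Measure.integral_comp_smul volume (fun z ↦ heatKernel c ℓ z * φ z) √ℓ
  have hd : Module.finrank ℝ (ℝ × ℝ) = 2 := by simp
  rw [hd, Real.sq_sqrt hℓ.le, abs_of_pos (inv_pos.2 hℓ), smul_eq_mul] at h
  simp only [heatKernel_smul hc hℓ, mul_assoc] at h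
  rw [integral_const_mul] at h
  exact (mul_left_cancel₀ (inv_ne_zero hℓ.ne') h).symm

theorem heatKernel_nonneg (c : ℝ) {ℓ : ℝ} (hℓ : 0 < ℓ) (z : ℝ × ℝ) : 0 ≤ heatKernel c ℓ z :=
  mul_nonneg (by positivity) (heatRadial_nonneg _ hℓ)

theorem measurable_heatKernel (c : ℝ) :
    Measurable fun x : ℝ × (ℝ × ℝ) ↦ heatKernel c x.1 x.2 := by
  unfold heatKernel heatRadial; fun_prop

theorem integrable_heatKernel (hc : 0 < c) {ℓ : ℝ} (hℓ : 0 < ℓ) : Integrable (heatKernel c ℓ) := by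
  have h := integrable_comp_smul_iff volume (heatKernel c ℓ) (Real.sqrt_pos.2 hℓ).ne'
  refine h.1 ?_
  simp only [heatKernel_smul hc hℓ]
  exact (integrable_gaussPlane hc).const_mul _

/-! ### Averages of test functions against the composed law -/

theorem integrable_prod_heatKernel (hlam : 0 < lam) (hc : 0 < c) (ht : 0 < t)
    {φ : ℝ × ℝ → ℝ} (hφ : Continuous φ) {C : ℝ} (hC : ∀ y, |φ y| ≤ C) :
    Integrable (Function.uncurry fun ℓ z ↦ inverseDensity lam t ℓ * (heatKernel c ℓ z * φ z))
      ((volume.restrict (Ioi 0)).prod volume) := by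
  have hK := measurable_heatKernel c
  have hm : AEStronglyMeasurable (Function.uncurry fun ℓ z ↦
      inverseDensity lam t ℓ * (heatKernel c ℓ z * φ z)) ((volume.restrict (Ioi 0)).prod volume) :=
    (((measurable_inverseDensity_right lam t).comp measurable_fst).mul
      (hK.mul (hφ.measurable.comp measurable_snd))).aestronglyMeasurable
  have hb : ∀ ℓ ∈ Ioi (0 : ℝ), Integrable fun z ↦ heatKernel c ℓ z * φ z := fun ℓ hℓ ↦
    (integrable_heatKernel hc hℓ).mul_bdd (c := C) hφ.aestronglyMeasurable (ae_of_all _ hC)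
  refine (integrable_prod_iff hm).2 ⟨?_, ?_⟩
  · filter_upwards [ae_restrict_mem measurableSet_Ioi] with ℓ hℓ
    exact (hb ℓ hℓ).const_mul (inverseDensity lam t ℓ)
  · refine ((integral_inverseDensity hlam ht).1.mul_const C).mono' hm.norm.integral_prod_right' ?_
    filter_upwards [ae_restrict_mem measurableSet_Ioi] with ℓ hℓ
    have hp := inverseDensity_nonneg hlam (le_of_lt hℓ) t
    rw [Real.norm_of_nonneg (integral_nonneg fun _ ↦ norm_nonneg _)]
    have e : ∀ z, ‖(Function.uncurry fun ℓ z ↦ inverseDensity lam t ℓ * (heatKernel c ℓ z * φ z))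
        (ℓ, z)‖ = inverseDensity lam t ℓ * (heatKernel c ℓ z * |φ z|) := by
      intro z
      simp only [Function.uncurry]
      rw [norm_mul, norm_mul, Real.norm_of_nonneg hp,
        Real.norm_of_nonneg (heatKernel_nonneg c hℓ z), Real.norm_eq_abs]
    simp only [e]
    rw [integral_const_mul, integral_heatKernel_mul hc hℓ fun z ↦ |φ z|]
    refine mul_le_mul_of_nonneg_left ((le_abs_self _).trans (abs_heatAvg_le hc ?_ ℓ)) hp
    simpa using hC

theorem composedLaw_eq_integral_heatKernel (hlam : 0 < lam) (hc : 0 < c) (ht : 0 < t) {z : ℝ × ℝ}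
    (hz : z ≠ 0) :
    composedLaw lam c z t = ∫ ℓ in Ioi 0, inverseDensity lam t ℓ * heatKernel c ℓ z := by
  rw [composedLaw_eq_relax_of_ne hlam hc ht hz, relax, ← integral_const_mul]
  congr 1 with ℓ
  rw [heatKernel]
  ring

theorem ae_composedLaw_mul (hlam : 0 < lam) (hc : 0 < c) (ht : 0 < t) (φ : ℝ × ℝ → ℝ) :
    (fun z ↦ ∫ ℓ in Ioi 0, inverseDensity lam t ℓ * (heatKernel c ℓ z * φ z))
      =ᵐ[volume] fun z ↦ composedLaw lam c z t * φ z := by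
  have hne : ∀ᵐ z : ℝ × ℝ, z ≠ 0 := by simp [ae_iff]
  filter_upwards [hne] with z hz
  rw [composedLaw_eq_integral_heatKernel hlam hc ht hz, ← integral_mul_const]
  simp only [mul_assoc]

theorem pairing_composedLaw (hlam : 0 < lam) (hc : 0 < c) (ht : 0 < t)
    {φ : ℝ × ℝ → ℝ} (hφ : Continuous φ) {C : ℝ} (hC : ∀ y, |φ y| ≤ C) :
    Integrable (fun z ↦ composedLaw lam c z t * φ z) ∧
      pairing (composedLaw lam c) φ t = relax lam (heatAvg c φ) t := by
  have hint := integrable_prod_heatKernel hlam hc ht hφ hC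
  have hae := ae_composedLaw_mul hlam hc ht φ
  refine ⟨hint.integral_prod_right.congr hae, ?_⟩
  rw [pairing, ← integral_congr_ae hae, ← integral_integral_swap hint, relax]
  refine setIntegral_congr_fun measurableSet_Ioi fun ℓ hℓ ↦ ?_
  simp only [integral_const_mul, integral_heatKernel_mul hc hℓ]

theorem integrable_composedLaw (hlam : 0 < lam) (hc : 0 < c) (ht : 0 < t) :
    Integrable fun z ↦ composedLaw lam c z t := by
  simpa using (pairing_composedLaw hlam hc ht (φ := fun _ ↦ 1) continuous_const (C := 1)
    (by simp)).1

end

section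

variable {lam c t : ℝ} {φ : ℝ × ℝ → ℝ}

/-! ### The heat equation for averages of test functions -/

theorem hasFDerivAt_gaussPlane (hc : 0 < c) (y : ℝ × ℝ) :
    HasFDerivAt (gaussPlane c) ((-(gaussPlane c y / (2 * c ^ 2))) •
      (y.1 • ContinuousLinearMap.fst ℝ ℝ ℝ + y.2 • ContinuousLinearMap.snd ℝ ℝ ℝ)) y := by
  have h1 := ((hasFDerivAt_fst (𝕜 := ℝ) (p := y)).pow 2).const_mul (-(1 / (4 * c ^ 2)))
  have h2 := ((hasFDerivAt_snd (𝕜 := ℝ) (p := y)).pow 2).const_mul (-(1 / (4 * c ^ 2)))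
  refine ((h1.exp.mul h2.exp).const_mul (1 / (4 * Real.pi * c ^ 2))).congr_fderiv ?_
  ext <;> simp [gaussPlane] <;> field_simp <;> ring

theorem fderiv_gaussPlane (hc : 0 < c) (y v : ℝ × ℝ) :
    fderiv ℝ (gaussPlane c) y v
      = -((y.1 * v.1 + y.2 * v.2) * gaussPlane c y / (2 * c ^ 2)) := by
  rw [(hasFDerivAt_gaussPlane hc y).fderiv]
  simp
  ring

theorem exists_bound_of_hasCompactSupport {g : ℝ × ℝ → ℝ} (hg : Continuous g)
    (hs : HasCompactSupport g) : ∃ C, ∀ y, |g y| ≤ C :=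
  hs.exists_bound_of_continuous hg

/-- Gaussian integration by parts: the linear factor is produced by differentiating the density
along `v`, and the chain rule supplies the factor `r`. -/
theorem integral_coord_mul_gaussPlane (hc : 0 < c) {g : ℝ × ℝ → ℝ} (hg : ContDiff ℝ 1 g)
    (hs : HasCompactSupport g) (r : ℝ) (v : ℝ × ℝ) :
    ∫ y : ℝ × ℝ, (y.1 * v.1 + y.2 * v.2) * gaussPlane c y * g (r • y)
      = 2 * c ^ 2 * r * ∫ y, gaussPlane c y * fderiv ℝ g (r • y) v := by
  obtain ⟨C, hC⟩ := exists_bound_of_hasCompactSupport hg.continuous hs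
  have hg' : Continuous fun y ↦ fderiv ℝ g y v :=
    (hg.continuous_fderiv one_ne_zero).clm_apply continuous_const
  obtain ⟨C', hC'⟩ := exists_bound_of_hasCompactSupport hg' (hs.fderiv_apply (𝕜 := ℝ) v)
  have hsm : Continuous fun y : ℝ × ℝ ↦ r • y := by fun_prop
  have hd : ∀ y, HasFDerivAt (fun y ↦ g (r • y)) (r • fderiv ℝ g (r • y)) y := by
    intro y
    have h1 := (hg.differentiable one_ne_zero (r • y)).hasFDerivAt
    have h2 : HasFDerivAt (fun y : ℝ × ℝ ↦ r • y) (r • ContinuousLinearMap.id ℝ (ℝ × ℝ)) y :=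
      (hasFDerivAt_id y).const_smul r
    refine (h1.comp y h2).congr_fderiv ?_
    ext <;> simp
  have hfd : ∀ y, fderiv ℝ (fun y ↦ g (r • y)) y v = r * fderiv ℝ g (r • y) v := by
    intro y
    rw [(hd y).fderiv]
    simp
  have hcoord : Integrable fun y : ℝ × ℝ ↦ (y.1 * v.1 + y.2 * v.2) * gaussPlane c y := by
    refine (((integrable_fst_mul_gaussPlane hc).const_mul v.1).add
      ((integrable_snd_mul_gaussPlane hc).const_mul v.2)).congr (ae_of_all _ fun y ↦ ?_)
    simp only [Pi.add_apply]
    ring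
  have hi1 : Integrable fun y : ℝ × ℝ ↦
      (y.1 * v.1 + y.2 * v.2) * gaussPlane c y * g (r • y) :=
    hcoord.mul_bdd (c := C) (hg.continuous.comp hsm).aestronglyMeasurable
      (ae_of_all _ fun y ↦ hC _)
  have hparts := integral_mul_fderiv_eq_neg_fderiv_mul_of_integrable (𝕜 := ℝ)
    (μ := (volume : Measure (ℝ × ℝ))) (f := gaussPlane c) (g := fun y ↦ g (r • y)) (v := v)
    ?_ ?_ ?_ (fun y _ ↦ (hasFDerivAt_gaussPlane hc y).differentiableAt)
    (fun y _ ↦ (hd y).differentiableAt)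
  · simp only [hfd, fderiv_gaussPlane hc] at hparts
    have e1 : ∀ y : ℝ × ℝ, gaussPlane c y * (r * fderiv ℝ g (r • y) v)
        = r * (gaussPlane c y * fderiv ℝ g (r • y) v) := fun y ↦ by ring
    have e2 : ∀ y : ℝ × ℝ, -((y.1 * v.1 + y.2 * v.2) * gaussPlane c y / (2 * c ^ 2)) * g (r • y)
        = -(1 / (2 * c ^ 2)) * ((y.1 * v.1 + y.2 * v.2) * gaussPlane c y * g (r • y)) :=
      fun y ↦ by ring
    simp only [e1, e2] at hparts
    rw [integral_const_mul, integral_const_mul] at hparts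
    have e3 : ∀ I : ℝ, 2 * c ^ 2 * -(-(1 / (2 * c ^ 2)) * I) = I := fun I ↦ by field_simp
    rw [mul_assoc, hparts, e3]
  · refine (hi1.const_mul (-(1 / (2 * c ^ 2)))).congr (ae_of_all _ fun y ↦ ?_)
    simp only [fderiv_gaussPlane hc]
    ring
  · simp only [hfd]
    refine integrable_gaussPlane_mul hc (continuous_const.mul (hg'.comp hsm)) (C := |r| * C')
      fun y ↦ ?_
    rw [abs_mul]
    exact mul_le_mul_of_nonneg_left (hC' _) (abs_nonneg r)
  · exact integrable_gaussPlane_mul hc (hg.continuous.comp hsm) fun y ↦ hC _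

theorem deriv_fst_eq_fderiv {g : ℝ × ℝ → ℝ} (hg : Differentiable ℝ g) (z : ℝ × ℝ) :
    deriv (fun x ↦ g (x, z.2)) z.1 = fderiv ℝ g z (1, 0) := by
  have h : HasDerivAt (fun x : ℝ ↦ (x, z.2)) (1, 0) z.1 :=
    (hasDerivAt_id z.1).prodMk (hasDerivAt_const z.1 z.2)
  exact ((hg z).hasFDerivAt.comp_hasDerivAt z.1 h).deriv

theorem deriv_snd_eq_fderiv {g : ℝ × ℝ → ℝ} (hg : Differentiable ℝ g) (z : ℝ × ℝ) :
    deriv (fun y ↦ g (z.1, y)) z.2 = fderiv ℝ g z (0, 1) := by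
  have h : HasDerivAt (fun y : ℝ ↦ (z.1, y)) (0, 1) z.2 :=
    (hasDerivAt_const z.2 z.1).prodMk (hasDerivAt_id z.2)
  exact ((hg z).hasFDerivAt.comp_hasDerivAt z.2 h).deriv

theorem contDiff_fderiv_apply_const (hφ : ContDiff ℝ (⊤ : ℕ∞) φ) (v : ℝ × ℝ) :
    ContDiff ℝ (⊤ : ℕ∞) fun z ↦ fderiv ℝ φ z v :=
  (hφ.fderiv_right (m := (⊤ : ℕ∞)) (by simp)).clm_apply contDiff_const

theorem differentiable_of_smooth (hφ : ContDiff ℝ (⊤ : ℕ∞) φ) : Differentiable ℝ φ :=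
  hφ.differentiable (by simp)

theorem laplacian_eq_fderiv (hφ : ContDiff ℝ (⊤ : ℕ∞) φ) (z : ℝ × ℝ) :
    laplacian φ z = fderiv ℝ (fun y ↦ fderiv ℝ φ y (1, 0)) z (1, 0)
      + fderiv ℝ (fun y ↦ fderiv ℝ φ y (0, 1)) z (0, 1) := by
  have hd := differentiable_of_smooth hφ
  have e1 : deriv (fun x ↦ φ (x, z.2)) = fun x ↦ fderiv ℝ φ (x, z.2) (1, 0) := by
    ext x
    exact deriv_fst_eq_fderiv hd (x, z.2)
  have e2 : deriv (fun y ↦ φ (z.1, y)) = fun y ↦ fderiv ℝ φ (z.1, y) (0, 1) := by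
    ext y
    exact deriv_snd_eq_fderiv hd (z.1, y)
  rw [laplacian, iteratedDeriv_succ, iteratedDeriv_one, iteratedDeriv_succ, iteratedDeriv_one,
    e1, e2]
  congr 1
  · exact deriv_fst_eq_fderiv (differentiable_of_smooth (contDiff_fderiv_apply_const hφ _)) z
  · exact deriv_snd_eq_fderiv (differentiable_of_smooth (contDiff_fderiv_apply_const hφ _)) z

theorem continuous_laplacian (hφ : ContDiff ℝ (⊤ : ℕ∞) φ) : Continuous (laplacian φ) := by
  rw [funext (laplacian_eq_fderiv hφ)]
  exact (contDiff_fderiv_apply_const (contDiff_fderiv_apply_const hφ _) _).continuous.add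
    (contDiff_fderiv_apply_const (contDiff_fderiv_apply_const hφ _) _).continuous

theorem exists_bound_laplacian (hφ : ContDiff ℝ (⊤ : ℕ∞) φ) (hs : HasCompactSupport φ) :
    ∃ C, ∀ z, |laplacian φ z| ≤ C := by
  refine exists_bound_of_hasCompactSupport (continuous_laplacian hφ) ?_
  rw [funext (laplacian_eq_fderiv hφ)]
  exact ((hs.fderiv_apply (𝕜 := ℝ) _).fderiv_apply (𝕜 := ℝ) _).add
    ((hs.fderiv_apply (𝕜 := ℝ) _).fderiv_apply (𝕜 := ℝ) _)

theorem fderiv_apply_eq_add (z y : ℝ × ℝ) :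
    fderiv ℝ φ z y = y.1 * fderiv ℝ φ z (1, 0) + y.2 * fderiv ℝ φ z (0, 1) := by
  conv_lhs => rw [show y = y.1 • ((1 : ℝ), (0 : ℝ)) + y.2 • ((0 : ℝ), (1 : ℝ)) by ext <;> simp]
  rw [map_add, map_smul, map_smul, smul_eq_mul, smul_eq_mul]

/-- Differentiation under the integral gives
$\frac1{2\sqrt\ell}\,y\cdot\nabla\varphi(\sqrt\ell\,y)$. Gaussian integration by parts replaces `y`
by $2c^2\sqrt\ell\,\nabla$, leaving $c^2\Delta\varphi$. -/
theorem hasDerivAt_heatAvg (hc : 0 < c) (hφ : ContDiff ℝ (⊤ : ℕ∞) φ) (hs : HasCompactSupport φ)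
    {ℓ : ℝ} (hℓ : 0 < ℓ) :
    HasDerivAt (heatAvg c φ) (c ^ 2 * heatAvg c (laplacian φ) ℓ) ℓ := by
  have hd := differentiable_of_smooth hφ
  have hc1 := contDiff_fderiv_apply_const hφ (1, 0)
  have hc2 := contDiff_fderiv_apply_const hφ (0, 1)
  have hs1 : HasCompactSupport fun z ↦ fderiv ℝ φ z (1, 0) := hs.fderiv_apply (𝕜 := ℝ) _
  have hs2 : HasCompactSupport fun z ↦ fderiv ℝ φ z (0, 1) := hs.fderiv_apply (𝕜 := ℝ) _
  obtain ⟨C, hC⟩ := exists_bound_of_hasCompactSupport hφ.continuous hs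
  obtain ⟨C₁, hC₁⟩ := exists_bound_of_hasCompactSupport hc1.continuous hs1
  obtain ⟨C₂, hC₂⟩ := exists_bound_of_hasCompactSupport hc2.continuous hs2
  have hg := continuous_gaussPlane c
  have hcφ := hφ.continuous
  have hsℓ : 0 < √ℓ := Real.sqrt_pos.2 hℓ
  have hi1 : Integrable fun y : ℝ × ℝ ↦ y.1 * gaussPlane c y * fderiv ℝ φ (√ℓ • y) (1, 0) :=
    (integrable_fst_mul_gaussPlane hc).mul_bdd (c := C₁)
      (hc1.continuous.comp (by fun_prop)).aestronglyMeasurable (ae_of_all _ fun y ↦ hC₁ _)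
  have hi2 : Integrable fun y : ℝ × ℝ ↦ y.2 * gaussPlane c y * fderiv ℝ φ (√ℓ • y) (0, 1) :=
    (integrable_snd_mul_gaussPlane hc).mul_bdd (c := C₂)
      (hc2.continuous.comp (by fun_prop)).aestronglyMeasurable (ae_of_all _ fun y ↦ hC₂ _)
  -- Staying in `r > ℓ / 2` keeps the factor `1 / (2 √r)` bounded.
  have hderiv := hasDerivAt_integral_of_dominated_loc_of_deriv_le
    (μ := (volume : Measure (ℝ × ℝ))) (x₀ := ℓ) (s := Ioi (ℓ / 2))
    (F := fun r y ↦ gaussPlane c y * φ (√r • y))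
    (F' := fun r y ↦ 1 / (2 * √r) * (y.1 * gaussPlane c y * fderiv ℝ φ (√r • y) (1, 0)
      + y.2 * gaussPlane c y * fderiv ℝ φ (√r • y) (0, 1)))
    (bound := fun y ↦ 1 / (2 * √(ℓ / 2)) *
      (|y.1 * gaussPlane c y| * C₁ + |y.2 * gaussPlane c y| * C₂))
    (Ioi_mem_nhds (half_lt_self hℓ)) ?_ ?_ ?_ ?_ ?_ ?_
  · refine hderiv.2.congr_deriv ?_
    have h1 := integral_coord_mul_gaussPlane hc (hc1.of_le (by simp)) hs1 √ℓ (1, 0)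
    have h2 := integral_coord_mul_gaussPlane hc (hc2.of_le (by simp)) hs2 √ℓ (0, 1)
    simp only [mul_one, mul_zero, add_zero, zero_add] at h1 h2
    rw [integral_const_mul, integral_add hi1 hi2, h1, h2, heatAvg]
    simp only [laplacian_eq_fderiv hφ, mul_add]
    rw [integral_add]
    · field_simp
    · obtain ⟨C', hC'⟩ := exists_bound_of_hasCompactSupport
        (contDiff_fderiv_apply_const hc1 (1, 0)).continuous (hs1.fderiv_apply (𝕜 := ℝ) _)
      exact integrable_gaussPlane_mul hc
        ((contDiff_fderiv_apply_const hc1 (1, 0)).continuous.comp (by fun_prop)) fun y ↦ hC' _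
    · obtain ⟨C', hC'⟩ := exists_bound_of_hasCompactSupport
        (contDiff_fderiv_apply_const hc2 (0, 1)).continuous (hs2.fderiv_apply (𝕜 := ℝ) _)
      exact integrable_gaussPlane_mul hc
        ((contDiff_fderiv_apply_const hc2 (0, 1)).continuous.comp (by fun_prop)) fun y ↦ hC' _
  · exact Eventually.of_forall fun r ↦ (by fun_prop : Continuous fun y : ℝ × ℝ ↦
      gaussPlane c y * φ (√r • y)).aestronglyMeasurable
  · exact integrable_gaussPlane_mul hc (hcφ.comp (by fun_prop)) fun y ↦ hC _
  · exact ((hi1.add hi2).const_mul _).aestronglyMeasurable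
  · refine ae_of_all _ fun y r hr ↦ ?_
    have hr0 : 0 < r := (half_pos hℓ).trans hr
    have hle : √(ℓ / 2) ≤ √r := Real.sqrt_le_sqrt (le_of_lt hr)
    have hp : 0 < √(ℓ / 2) := by positivity
    rw [norm_mul, Real.norm_of_nonneg (by positivity : 0 ≤ 1 / (2 * √r))]
    have h3 : ‖y.1 * gaussPlane c y * fderiv ℝ φ (√r • y) (1, 0)
        + y.2 * gaussPlane c y * fderiv ℝ φ (√r • y) (0, 1)‖
        ≤ |y.1 * gaussPlane c y| * C₁ + |y.2 * gaussPlane c y| * C₂ := by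
      refine (norm_add_le _ _).trans (add_le_add ?_ ?_)
      · rw [norm_mul]
        exact mul_le_mul_of_nonneg_left (hC₁ _) (norm_nonneg _)
      · rw [norm_mul]
        exact mul_le_mul_of_nonneg_left (hC₂ _) (norm_nonneg _)
    gcongr
  · exact (((integrable_fst_mul_gaussPlane hc).abs.mul_const C₁).add
      ((integrable_snd_mul_gaussPlane hc).abs.mul_const C₂)).const_mul _
  · refine ae_of_all _ fun y r hr ↦ ?_
    have hr0 : 0 < r := (half_pos hℓ).trans hr
    have h1 : HasDerivAt (fun r : ℝ ↦ √r • y) ((1 / (2 * √r)) • y) r :=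
      ((hasDerivAt_id r).sqrt hr0.ne').smul_const y
    have h2 := ((hd (√r • y)).hasFDerivAt.comp_hasDerivAt r h1).const_mul (gaussPlane c y)
    refine h2.congr_deriv ?_
    rw [map_smul, fderiv_apply_eq_add, smul_eq_mul]
    ring

/-- The relaxation equation with `G` the heat average of `φ`: then `G'` is `c²` times the heat
average of the Laplacian, and the limit of `G` at zero is `φ 0`. -/
theorem solvesWeakly_composedLaw (hlam : 0 < lam) (hc : 0 < c) :
    SolvesWeakly lam c (composedLaw lam c) := by
  have key : ∀ φ : ℝ × ℝ → ℝ, ContDiff ℝ (⊤ : ℕ∞) φ → HasCompactSupport φ →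
      Tendsto (pairing (composedLaw lam c) φ) (𝓝[>] 0) (𝓝 (φ 0)) ∧ ∀ t, 0 < t →
      DifferentiableAt ℝ (pairing (composedLaw lam c) φ) t ∧
      HasCaputoDeriv (1 / 2) (pairing (composedLaw lam c) φ) t ∧
      deriv (pairing (composedLaw lam c) φ) t
        + 2 * lam * caputoDeriv (1 / 2) (pairing (composedLaw lam c) φ) t
        = c ^ 2 * pairing (composedLaw lam c) (laplacian φ) t := by
    intro φ hφ hs
    obtain ⟨C, hC⟩ := exists_bound_of_hasCompactSupport hφ.continuous hs
    obtain ⟨C', hC'⟩ := exists_bound_laplacian hφ hs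
    have hG : ∀ ℓ ∈ Ioi (0 : ℝ), HasDerivAt (heatAvg c φ)
        (c ^ 2 * heatAvg c (laplacian φ) ℓ) ℓ := fun ℓ hℓ ↦ hasDerivAt_heatAvg hc hφ hs hℓ
    have hcont : ContinuousOn (fun ℓ ↦ c ^ 2 * heatAvg c (laplacian φ) ℓ) (Ioi 0) :=
      ((continuous_heatAvg hc (continuous_laplacian hφ) hC').const_mul _).continuousOn
    have hM : ∀ ℓ ∈ Ioi (0 : ℝ), |c ^ 2 * heatAvg c (laplacian φ) ℓ| ≤ c ^ 2 * C' := by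
      intro ℓ _
      rw [abs_mul, abs_of_pos (by positivity : 0 < c ^ 2)]
      exact mul_le_mul_of_nonneg_left (abs_heatAvg_le hc hC' ℓ) (by positivity)
    have h0 : Tendsto (heatAvg c φ) (𝓝[>] 0) (𝓝 (φ 0)) := by
      have := ((continuous_heatAvg hc hφ.continuous hC).tendsto 0).mono_left
        (nhdsWithin_le_nhds (s := Ioi 0))
      rwa [heatAvg_zero hc] at this
    have hf : EqOn (pairing (composedLaw lam c) φ) (relax lam (heatAvg c φ)) (Ioi 0) :=
      fun t ht ↦ (pairing_composedLaw hlam hc ht hφ.continuous hC).2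
    refine ⟨(tendsto_relax hlam hG hcont hM h0).congr' ?_, fun t ht ↦ ?_⟩
    · filter_upwards [self_mem_nhdsWithin] with t ht using (hf ht).symm
    · obtain ⟨h1, h2, h3⟩ := solves_of_eqOn_relax hlam ht hG hcont hM h0 hf
      refine ⟨h1, h2, h3.trans ?_⟩
      rw [(pairing_composedLaw hlam hc ht (continuous_laplacian hφ) hC').2, relax, relax,
        ← integral_const_mul]
      congr 1 with ℓ
      ring
  exact ⟨fun t ht ↦ (integrable_composedLaw hlam hc ht).locallyIntegrable,
    fun φ hφ hs t ht ↦ ((key φ hφ hs).2 t ht).1, fun φ hφ hs t ht ↦ ((key φ hφ hs).2 t ht).2.1,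
    fun φ hφ hs t ht ↦ ((key φ hφ hs).2 t ht).2.2, fun φ hφ hs ↦ (key φ hφ hs).1⟩

end

section

variable {Ω : Type*} [MeasurableSpace Ω] {P : Measure Ω}
  {H : ℝ≥0 → Ω → ℝ} {lam t : ℝ}

/-! ### The law of the inverse process -/

theorem integral_withDensity_ofReal {X : Type*} [MeasurableSpace X] {μ : Measure X} {f : X → ℝ}
    (hf : AEMeasurable f μ) (h0 : ∀ᵐ x ∂μ, 0 ≤ f x) (g : X → ℝ) :
    ∫ x, g x ∂μ.withDensity (fun x ↦ ENNReal.ofReal (f x)) = ∫ x, f x * g x ∂μ := by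
  rw [integral_withDensity_eq_integral_toReal_smul₀ hf.ennreal_ofReal
    (ae_of_all _ fun x ↦ ENNReal.ofReal_lt_top)]
  refine integral_congr_ae (h0.mono fun x hx ↦ ?_)
  simp only [ENNReal.toReal_ofReal hx, smul_eq_mul]

theorem isProbabilityMeasure_withDensity_ofReal {X : Type*} [MeasurableSpace X] {μ : Measure X}
    {f : X → ℝ} (hf : Integrable f μ) (h0 : ∀ᵐ x ∂μ, 0 ≤ f x) (h1 : ∫ x, f x ∂μ = 1) :
    IsProbabilityMeasure (μ.withDensity fun x ↦ ENNReal.ofReal (f x)) := by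
  refine ⟨?_⟩
  rw [withDensity_apply _ MeasurableSet.univ, Measure.restrict_univ,
    ← ofReal_integral_eq_lintegral_ofReal hf h0, h1, ENNReal.ofReal_one]

theorem IsStableSubordinator.nonneg {ν : ℝ} (hH : IsStableSubordinator ν H P) :
    ∀ᵐ ω ∂P, ∀ s, 0 ≤ H s ω := by
  filter_upwards [hH.zero, hH.mono] with ω h0 hm s
  exact h0 ▸ hm (zero_le)

theorem IsStableSubordinator.map_eq [IsProbabilityMeasure P]
    (hH : IsStableSubordinator (1 / 2) H P) {s : ℝ≥0}
    (hs : 0 < s) :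
    P.map (H s) = (volume.restrict (Ioi 0)).withDensity
      fun x ↦ ENNReal.ofReal (hitDensity s x) := by
  have hs' : (0 : ℝ) < s := hs
  have hm : Measurable (hitDensity (s : ℝ)) := by
    unfold hitDensity reflDensity; fun_prop
  have h0 : ∀ᵐ x ∂(volume.restrict (Ioi (0 : ℝ))), 0 ≤ hitDensity s x :=
    ae_of_all _ fun x ↦ hitDensity_nonneg hs'.le x
  have hi := integral_hitDensity_Ioi hs'
  have := isProbabilityMeasure_withDensity_ofReal hi.1 h0 hi.2
  have := Measure.isProbabilityMeasure_map (μ := P) (hH.measurable s).aemeasurable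
  refine ext_of_laplace_nat ?_ ?_ fun n ↦ ?_
  · refine (ae_map_iff (hH.measurable s).aemeasurable measurableSet_Ici).2 ?_
    filter_upwards [hH.nonneg] with ω h using h s
  · refine withDensity_absolutelyContinuous _ _ ?_
    exact (ae_restrict_mem measurableSet_Ioi).mono fun x hx ↦ le_of_lt hx
  · rw [integral_map (hH.measurable s).aemeasurable (by fun_prop),
      integral_withDensity_ofReal hm.aemeasurable h0]
    have hl := hH.laplace 0 s (zero_le) n n.cast_nonneg
    have he : ∫ ω, Real.exp (-(n : ℝ) * H s ω) ∂P
        = ∫ ω, Real.exp (-(n : ℝ) * (H s ω - H 0 ω)) ∂P :=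
      integral_congr_ae (hH.zero.mono fun ω h ↦ by simp only [h, sub_zero])
    rw [he, hl, ← Real.sqrt_eq_rpow]
    -- The parameter `0` is total mass and is treated apart, since `laplace_hitDensity` requires a
    -- positive parameter.
    rcases n.eq_zero_or_pos with rfl | hn
    · simp [hi.2]
    · have := (laplace_hitDensity hs' (Nat.cast_pos.2 hn : (0 : ℝ) < n)).2
      simp_rw [mul_comm (hitDensity _ _)]
      rw [this]
      simp

theorem IsStableSubordinator.measure_lt [IsProbabilityMeasure P]
    (hH : IsStableSubordinator (1 / 2) H P) {s : ℝ≥0}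
    (hs : 0 < s) {x : ℝ} (hx : 0 < x) :
    P {ω | H s ω < x} = ENNReal.ofReal (erfc (s / (2 * √x))) := by
  have h : P {ω | H s ω < x} = P.map (H s) (Iio x) :=
    (Measure.map_apply (hH.measurable s) measurableSet_Iio).symm
  have hi := integral_hitDensity_Ioo (s := s) hs hx
  rw [h, hH.map_eq hs, withDensity_apply _ measurableSet_Iio,
    Measure.restrict_restrict measurableSet_Iio, Iio_inter_Ioi,
    ← ofReal_integral_eq_lintegral_ofReal hi.1
      (ae_of_all _ fun x ↦ hitDensity_nonneg s.coe_nonneg x), hi.2]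

/-- Right-continuity lets the inequality pass to the infimum, and monotonicity carries it to larger
times. The level `t > 0` excludes `s = 0`, so positivity in the defining set costs nothing. -/
theorem inverseTime_le_iff {Ω : Type*} {H : ℝ≥0 → Ω → ℝ} {ω : Ω} (ht : 0 < t) (h0 : H 0 ω = 0)
    (hm : Monotone fun s ↦ H s ω) (hr : ∀ s, ContinuousWithinAt (fun r ↦ H r ω) (Ici s) s)
    (ℓ : ℝ≥0) : inverseTime lam H t ω ≤ ℓ ↔ t ≤ ℓ + (2 * lam) ^ 2 * H ℓ ω := by
  set S := {s : ℝ≥0 | 0 < s ∧ t ≤ (s : ℝ) + (2 * lam) ^ 2 * H s ω} with hS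
  have hup : ∀ {a b : ℝ≥0}, a ≤ b →
      (a : ℝ) + (2 * lam) ^ 2 * H a ω ≤ b + (2 * lam) ^ 2 * H b ω := fun {a b} hab ↦ by
    have := hm hab
    have h2 : (a : ℝ) ≤ b := hab
    gcongr
  have hne : S.Nonempty := by
    refine ⟨t.toNNReal, Real.toNNReal_pos.2 ht, ?_⟩
    have h1 : 0 ≤ H t.toNNReal ω := h0 ▸ hm zero_le
    rw [Real.coe_toNNReal _ ht.le]
    have : 0 ≤ (2 * lam) ^ 2 * H t.toNNReal ω := by positivity
    linarith
  constructor
  · intro h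
    have hc : ContinuousWithinAt (fun r : ℝ≥0 ↦ (r : ℝ) + (2 * lam) ^ 2 * H r ω) (Ici ℓ) ℓ :=
      NNReal.continuous_coe.continuousWithinAt.add ((hr ℓ).const_mul _)
    have hc' := hc.mono (Ioi_subset_Ici_self : Ioi ℓ ⊆ Ici ℓ)
    refine ge_of_tendsto hc' ?_
    filter_upwards [self_mem_nhdsWithin] with r hrr
    obtain ⟨a, ha, har⟩ := exists_lt_of_csInf_lt hne (lt_of_le_of_lt h hrr)
    exact ha.2.trans (hup har.le)
  · intro h
    refine csInf_le (OrderBot.bddBelow _) ⟨?_, h⟩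
    rcases eq_or_lt_of_le (zero_le : 0 ≤ ℓ) with rfl | h'
    · simp [h0] at h; linarith
    · exact h'

theorem IsStableSubordinator.inverseTime_le_iff {ν : ℝ} (hH : IsStableSubordinator ν H P)
    (lam : ℝ) (ht : 0 < t) :
    ∀ᵐ ω ∂P, ∀ ℓ : ℝ≥0, inverseTime lam H t ω ≤ ℓ ↔ t ≤ ℓ + (2 * lam) ^ 2 * H ℓ ω := by
  filter_upwards [hH.zero, hH.mono, hH.rightCont] with ω h0 hm hr ℓ
  exact PlanarTelegraph.inverseTime_le_iff ht h0 hm hr ℓ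

open Classical in
/-- A measurable functional of the path of the subordinator that recovers the inverse process. -/
noncomputable def pathInverse (lam t : ℝ) (h : ℝ≥0 → ℝ) : ℝ :=
  ⨅ q : ℚ≥0, if t ≤ (q : ℝ≥0) + (2 * lam) ^ 2 * h q then ((q : ℝ≥0) : ℝ) else t

theorem measurable_pathInverse (lam t : ℝ) : Measurable (pathInverse lam t) := by
  refine Measurable.iInf fun q ↦ Measurable.ite ?_ measurable_const measurable_const
  exact measurableSet_le measurable_const (by fun_prop)

/-- Rational times suffice by density, and the default value `t` is harmless because `𝓛(t) ≤ t`: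
nonnegativity of `H` makes `s = t` admissible. Dependence on countably many coordinates gives
measurability for the path σ-algebra, as needed to use independence. -/
theorem IsStableSubordinator.pathInverse_eq {ν : ℝ} (hH : IsStableSubordinator ν H P)
    (lam : ℝ) (ht : 0 < t) :
    ∀ᵐ ω ∂P, pathInverse lam t (fun s ↦ H s ω) = inverseTime lam H t ω := by
  filter_upwards [hH.inverseTime_le_iff lam ht, hH.nonneg] with ω h h0
  have hb : BddBelow (range fun q : ℚ≥0 ↦ if t ≤ (q : ℝ≥0) + (2 * lam) ^ 2 * H q ω
      then ((q : ℝ≥0) : ℝ) else t) :=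
    ⟨0, by rintro _ ⟨q, rfl⟩; dsimp only; split_ifs; exacts [NNReal.coe_nonneg _, ht.le]⟩
  apply le_antisymm
  · refine le_of_forall_gt fun x hx ↦ ?_
    obtain ⟨q, hq1, hq2⟩ := exists_rat_btwn hx
    have hq0 : (0 : ℚ) ≤ q := by exact_mod_cast (NNReal.coe_nonneg _).trans hq1.le
    lift q to ℚ≥0 using hq0
    have hcast : (((q : ℚ≥0) : ℝ≥0) : ℝ) = ((q : ℚ) : ℝ) := by norm_cast
    rw [← hcast] at hq1 hq2
    have hle : inverseTime lam H t ω ≤ (q : ℝ≥0) := hq1.le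
    refine lt_of_le_of_lt (ciInf_le hb q) ?_
    simp only [if_pos ((h q).1 hle)]
    exact hq2
  · refine le_ciInf fun q ↦ ?_
    split_ifs with hq
    · exact_mod_cast (h q).2 hq
    · have : inverseTime lam H t ω ≤ t.toNNReal := by
        refine (h _).2 ?_
        rw [Real.coe_toNNReal _ ht.le]
        have := mul_nonneg (sq_nonneg (2 * lam)) (h0 t.toNNReal)
        linarith
      have h2 : (inverseTime lam H t ω : ℝ) ≤ (t.toNNReal : ℝ) := this
      rwa [Real.coe_toNNReal _ ht.le] at h2

theorem ext_of_Ioi {μ ν : Measure ℝ} [IsProbabilityMeasure μ] [IsProbabilityMeasure ν]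
    (h : ∀ a, μ (Ioi a) = ν (Ioi a)) : μ = ν := by
  refine Measure.ext_of_Iic μ ν fun a ↦ ?_
  rw [← compl_Ioi, prob_compl_eq_one_sub measurableSet_Ioi,
    prob_compl_eq_one_sub measurableSet_Ioi, h]

theorem aemeasurable_inverseTime (hH : IsStableSubordinator (1 / 2) H P) (lam : ℝ) (ht : 0 < t) :
    AEMeasurable (fun ω ↦ (inverseTime lam H t ω : ℝ)) P :=
  ((measurable_pathInverse lam t).comp
    (measurable_pi_lambda _ fun s ↦ hH.measurable s)).aemeasurable.congr
    (hH.pathInverse_eq lam ht)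

theorem isProbabilityMeasure_inverseDensity (hlam : 0 < lam) (ht : 0 < t) :
    IsProbabilityMeasure ((volume.restrict (Ioi 0)).withDensity
      fun ℓ ↦ ENNReal.ofReal (inverseDensity lam t ℓ)) :=
  isProbabilityMeasure_withDensity_ofReal (integral_inverseDensity hlam ht).1
    ((ae_restrict_mem measurableSet_Ioi).mono fun _ hℓ ↦
      inverseDensity_nonneg hlam (le_of_lt hℓ) t) (integral_inverseDensity hlam ht).2

theorem measure_inverseTime_gt [IsProbabilityMeasure P]
    (hH : IsStableSubordinator (1 / 2) H P) (hlam : 0 < lam)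
    (ht : 0 < t) (a : ℝ≥0) :
    P {ω | a < inverseTime lam H t ω}
      = ENNReal.ofReal (∫ ℓ in Ioi (a : ℝ), inverseDensity lam t ℓ) := by
  have h : P {ω | a < inverseTime lam H t ω} = P {ω | a + (2 * lam) ^ 2 * H a ω < t} := by
    refine measure_congr ?_
    filter_upwards [hH.inverseTime_le_iff lam ht] with ω h
    exact propext ((not_le.symm.trans (not_congr (h a))).trans not_le)
  rw [h]
  rcases lt_or_ge (a : ℝ) t with hat | hat
  · rw [(integral_inverseDensity_Ioi hlam a.coe_nonneg hat).2]
    -- At `a = 0` the variable `H 0` is degenerate and has no density, so this case is separate.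
    rcases eq_or_lt_of_le (zero_le : 0 ≤ a) with rfl | ha
    · have : P {ω | ((0 : ℝ≥0) : ℝ) + (2 * lam) ^ 2 * H 0 ω < t} = P univ :=
        measure_congr (eventuallyEq_univ.2 (hH.zero.mono fun ω h ↦ by simpa [h] using ht))
      rw [this, measure_univ]
      simp [erfc_zero]
    · have hx : 0 < (t - a) / (2 * lam) ^ 2 := div_pos (sub_pos.2 hat) (by positivity)
      have hset : {ω | (a : ℝ) + (2 * lam) ^ 2 * H a ω < t}
          = {ω | H a ω < (t - a) / (2 * lam) ^ 2} := by
        ext ω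
        simp only [mem_ofPred_eq]
        rw [lt_div_iff₀ (by positivity)]
        constructor <;> intro <;> linarith
      rw [hset, hH.measure_lt ha hx, Real.sqrt_div (sub_pos.2 hat).le,
        Real.sqrt_sq (by positivity)]
      congr 2
      field_simp
  · have hz : ∫ ℓ in Ioi (a : ℝ), inverseDensity lam t ℓ = 0 :=
      setIntegral_eq_zero_of_forall_eq_zero fun ℓ hℓ ↦
        inverseDensity_of_le lam (hat.trans (le_of_lt hℓ))
    rw [hz, ENNReal.ofReal_zero]
    refine measure_eq_zero_iff_ae_notMem.2 (hH.nonneg.mono fun ω h0 ↦ ?_)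
    have := mul_nonneg (sq_nonneg (2 * lam)) (h0 a)
    rw [mem_ofPred_eq]
    linarith

theorem map_inverseTime [IsProbabilityMeasure P]
    (hH : IsStableSubordinator (1 / 2) H P) (hlam : 0 < lam) (ht : 0 < t) :
    P.map (fun ω ↦ (inverseTime lam H t ω : ℝ)) = (volume.restrict (Ioi 0)).withDensity
      fun ℓ ↦ ENNReal.ofReal (inverseDensity lam t ℓ) := by
  have hL := aemeasurable_inverseTime hH lam ht
  have := isProbabilityMeasure_inverseDensity hlam ht
  have := Measure.isProbabilityMeasure_map hL
  have hpos : ∀ a : ℝ≥0, P.map (fun ω ↦ (inverseTime lam H t ω : ℝ)) (Ioi (a : ℝ))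
      = ((volume.restrict (Ioi 0)).withDensity
        fun ℓ ↦ ENNReal.ofReal (inverseDensity lam t ℓ)) (Ioi (a : ℝ)) := fun a ↦ by
    have hs : (fun ω ↦ (inverseTime lam H t ω : ℝ)) ⁻¹' Ioi (a : ℝ)
        = {ω | a < inverseTime lam H t ω} := by ext ω; simp
    have ha : Ioi (a : ℝ) ⊆ Ioi 0 := Ioi_subset_Ioi a.coe_nonneg
    rw [Measure.map_apply_of_aemeasurable hL measurableSet_Ioi, hs,
      measure_inverseTime_gt hH hlam ht, withDensity_apply _ measurableSet_Ioi,
      Measure.restrict_restrict measurableSet_Ioi, inter_eq_left.2 ha,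
      ofReal_integral_eq_lintegral_ofReal ((integral_inverseDensity hlam ht).1.mono_set ha)]
    exact (ae_restrict_mem measurableSet_Ioi).mono fun ℓ hℓ ↦
      inverseDensity_nonneg hlam (le_of_lt (ha hℓ)) t
  refine ext_of_Ioi fun a ↦ ?_
  rcases le_or_gt 0 a with ha | ha
  · exact hpos ⟨a, ha⟩
  · have key : ∀ μ : Measure ℝ, IsProbabilityMeasure μ → μ (Ioi 0) = 1 → μ (Ioi a) = 1 :=
      fun μ _ h ↦ le_antisymm prob_le_one (h ▸ measure_mono (Ioi_subset_Ioi ha.le))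
    have h1 : ((volume.restrict (Ioi 0)).withDensity
        fun ℓ ↦ ENNReal.ofReal (inverseDensity lam t ℓ)) (Ioi 0) = 1 := by
      rw [withDensity_apply _ measurableSet_Ioi, Measure.restrict_restrict measurableSet_Ioi,
        inter_self, ← ofReal_integral_eq_lintegral_ofReal (integral_inverseDensity hlam ht).1,
        (integral_inverseDensity hlam ht).2, ENNReal.ofReal_one]
      exact (ae_restrict_mem measurableSet_Ioi).mono fun ℓ hℓ ↦
        inverseDensity_nonneg hlam (le_of_lt hℓ) t
    rw [key _ inferInstance h1, key _ inferInstance ((hpos 0).trans (by simpa using h1))]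

end

section

variable {Ω : Type*} [MeasurableSpace Ω] {P : Measure Ω} {B : ℝ≥0 → Ω → ℝ × ℝ}
  {H : ℝ≥0 → Ω → ℝ} {lam c t : ℝ} {φ : ℝ × ℝ → ℝ}

/-! ### The law of the time-changed Brownian motion -/

theorem gaussianReal_prod_eq (hc : 0 < c) :
    (gaussianReal 0 (2 * (c ^ 2).toNNReal)).prod (gaussianReal 0 (2 * (c ^ 2).toNNReal))
      = volume.withDensity fun y ↦ ENNReal.ofReal (gaussPlane c y) := by
  have hc2 : 0 < c ^ 2 := by positivity
  have hv : 2 * (c ^ 2).toNNReal ≠ 0 := by simp [hc.ne']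
  rw [gaussianReal_of_var_ne_zero _ hv,
    prod_withDensity (measurable_gaussianPDF _ _) (measurable_gaussianPDF _ _)]
  congr 1
  ext y
  rw [gaussianPDF, gaussianPDF, ← ENNReal.ofReal_mul (gaussianPDFReal_nonneg _ _ _)]
  congr 1
  have h2 : ((2 * (c ^ 2).toNNReal : ℝ≥0) : ℝ) = 2 * c ^ 2 := by
    rw [NNReal.coe_mul, Real.coe_toNNReal _ hc2.le]; rfl
  have h3 : (√(2 * Real.pi * (2 * c ^ 2)))⁻¹ * (√(2 * Real.pi * (2 * c ^ 2)))⁻¹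
      = 1 / (4 * Real.pi * c ^ 2) := by
    rw [← mul_inv, Real.mul_self_sqrt (by positivity), one_div]
    congr 1
    ring
  rw [gaussianPDFReal, gaussianPDFReal, h2, gaussPlane, mul_mul_mul_comm, h3]
  congr 3 <;> · field_simp; ring

theorem hasLaw_of_div_sqrt_two {X : Ω → ℝ} {s : ℝ≥0}
    (h : HasLaw (fun ω ↦ X ω / √2) (gaussianReal 0 s) P) :
    P.map X = gaussianReal 0 (2 * s) := by
  have h2 : (√2 : ℝ) ≠ 0 := by positivity
  have he : X = (√2 * ·) ∘ fun ω ↦ X ω / √2 := by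
    ext ω; simp only [Function.comp]; field_simp
  rw [he, ← AEMeasurable.map_map_of_aemeasurable (by fun_prop) h.aemeasurable, h.map_eq,
    gaussianReal_map_const_mul, mul_zero]
  congr 2
  ext
  simp

theorem IsPlanarBrownian.map_eq [IsProbabilityMeasure P] (hB : IsPlanarBrownian B P) (s : ℝ≥0) :
    P.map (B s) = (gaussianReal 0 (2 * s)).prod (gaussianReal 0 (2 * s)) := by
  have hi : IndepFun (fun ω ↦ (B s ω).1) (fun ω ↦ (B s ω).2) P :=
    hB.indep.comp (measurable_pi_apply s) (measurable_pi_apply s)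
  have h := (indepFun_iff_map_prod_eq_prod_map_map (hB.measurable s).fst.aemeasurable
    (hB.measurable s).snd.aemeasurable).1 hi
  rw [hasLaw_of_div_sqrt_two (hB.fst.hasLaw_eval s),
    hasLaw_of_div_sqrt_two (hB.snd.hasLaw_eval s)] at h
  exact h

theorem IsPlanarBrownian.integral_eq [IsProbabilityMeasure P] (hB : IsPlanarBrownian B P)
    (hc : 0 < c) (hφ : Continuous φ) (ℓ : ℝ≥0) :
    ∫ ω, φ (B ((c ^ 2).toNNReal * ℓ) ω) ∂P = heatAvg c φ ℓ := by
  have hs : gaussianReal 0 (2 * ((c ^ 2).toNNReal * ℓ))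
      = (gaussianReal 0 (2 * (c ^ 2).toNNReal)).map (√(ℓ : ℝ) * ·) := by
    rw [gaussianReal_map_const_mul, mul_zero]
    congr 1
    ext
    simp
    ring
  have hm : Measurable fun x : ℝ ↦ √(ℓ : ℝ) * x := by fun_prop
  have hg : Measurable fun y ↦ gaussPlane c y := (continuous_gaussPlane c).measurable
  have hcont : Continuous fun y : ℝ × ℝ ↦ Prod.map (√(ℓ : ℝ) * ·) (√(ℓ : ℝ) * ·) y := by
    unfold Prod.map; fun_prop
  rw [← integral_map (hB.measurable _).aemeasurable hφ.aestronglyMeasurable, hB.map_eq, hs,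
    Measure.map_prod_map _ _ hm hm, gaussianReal_prod_eq hc,
    integral_map hcont.measurable.aemeasurable hφ.aestronglyMeasurable,
    integral_withDensity_ofReal hg.aemeasurable (ae_of_all _ (gaussPlane_nonneg c))]
  rfl

/-- Independence and Fubini allow the random time to be frozen. Countably many values make
evaluation of the path jointly measurable, with no appeal to path regularity. -/
theorem IsPlanarBrownian.integral_comp_countable [IsProbabilityMeasure P]
    (hB : IsPlanarBrownian B P) (hc : 0 < c) (hφ : Continuous φ) {C : ℝ} (hC : ∀ y, |φ y| ≤ C)
    {K : Ω → ℕ} (hK : Measurable K) (hi : IndepFun (fun ω s ↦ B s ω) K P) (τ : ℕ → ℝ≥0) :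
    ∫ ω, φ (B ((c ^ 2).toNNReal * τ (K ω)) ω) ∂P = ∫ ω, heatAvg c φ (τ (K ω)) ∂P := by
  have hBm : Measurable fun ω s ↦ B s ω := measurable_pi_lambda _ hB.measurable
  set f : (ℝ≥0 → ℝ × ℝ) × ℕ → ℝ := fun x ↦ φ (x.1 ((c ^ 2).toNNReal * τ x.2)) with hf
  have hfm : Measurable f := measurable_from_prod_countable_left fun k ↦
    hφ.measurable.comp (measurable_pi_apply ((c ^ 2).toNNReal * τ k))
  have := Measure.isProbabilityMeasure_map (μ := P) hBm.aemeasurable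
  have := Measure.isProbabilityMeasure_map (μ := P) hK.aemeasurable
  have h1 : ∫ ω, φ (B ((c ^ 2).toNNReal * τ (K ω)) ω) ∂P
      = ∫ x, f x ∂((P.map fun ω s ↦ B s ω).prod (P.map K)) := by
    rw [← (indepFun_iff_map_prod_eq_prod_map_map hBm.aemeasurable hK.aemeasurable).1 hi,
      integral_map (hBm.prodMk hK).aemeasurable hfm.aestronglyMeasurable]
  have hint : Integrable f ((P.map fun ω s ↦ B s ω).prod (P.map K)) :=
    Integrable.of_bound hfm.aestronglyMeasurable C (ae_of_all _ fun x ↦ hC _)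
  rw [h1, integral_prod_symm _ hint,
    integral_map hK.aemeasurable (by
      exact (measurable_of_countable _).aestronglyMeasurable)]
  congr 1
  ext ω
  rw [← hB.integral_eq hc hφ]
  exact integral_map hBm.aemeasurable (f := fun b ↦ f (b, K ω))
    (hfm.comp measurable_prodMk_right).aestronglyMeasurable

theorem IsPlanarBrownian.continuous [IsProbabilityMeasure P] (hB : IsPlanarBrownian B P) :
    ∀ᵐ ω ∂P, Continuous fun s ↦ B s ω := by
  filter_upwards [hB.fst.cont, hB.snd.cont] with ω h1 h2
  have h : (√2 : ℝ) ≠ 0 := by positivity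
  have he : (fun s ↦ B s ω) = fun s ↦ ((B s ω).1 / √2 * √2, (B s ω).2 / √2 * √2) := by
    ext s <;> simp only <;> field_simp
  rw [he]
  fun_prop

/-- Approximation of the inverse process from above by a process with values in `(n⁻¹) ℕ`. -/
noncomputable def gridTime (lam t : ℝ) (H : ℝ≥0 → Ω → ℝ) (n : ℕ) (ω : Ω) : ℝ≥0 :=
  (⌈pathInverse lam t (fun s ↦ H s ω) * n⌉₊ : ℝ≥0) / n

/-- The grid value $\lceil n\mathscr L\rceil/n$ exceeds $\mathscr L$ by less than $1/n$. The term `n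
= 0` is zero by the division convention and does not affect the limit. -/
theorem tendsto_gridTime (hH : IsStableSubordinator (1 / 2) H P) (lam : ℝ) (ht : 0 < t) :
    ∀ᵐ ω ∂P, Tendsto (fun n ↦ gridTime lam t H n ω) atTop (𝓝 (inverseTime lam H t ω)) := by
  filter_upwards [hH.pathInverse_eq lam ht] with ω h
  rw [← NNReal.tendsto_coe]
  have := (tendsto_nat_ceil_mul_div_atTop (R := ℝ)
    (inverseTime lam H t ω).coe_nonneg).comp tendsto_natCast_atTop_atTop
  refine this.congr fun n ↦ ?_
  simp [gridTime, h]

theorem measurable_ceil_pathInverse (hH : IsStableSubordinator (1 / 2) H P) (lam t : ℝ) (n : ℕ) :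
    Measurable fun ω ↦ ⌈pathInverse lam t (fun s ↦ H s ω) * n⌉₊ :=
  Nat.measurable_ceil.comp (((measurable_pathInverse lam t).comp
    (measurable_pi_lambda _ fun s ↦ hH.measurable s)).mul_const _)

theorem integral_gridTime [IsProbabilityMeasure P] (hB : IsPlanarBrownian B P)
    (hH : IsStableSubordinator (1 / 2) H P)
    (hi : IndepFun (fun ω s ↦ B s ω) (fun ω s ↦ H s ω) P) (hc : 0 < c) (lam t : ℝ)
    (hφ : Continuous φ) {C : ℝ} (hC : ∀ y, |φ y| ≤ C) (n : ℕ) :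
    ∫ ω, φ (B ((c ^ 2).toNNReal * gridTime lam t H n ω) ω) ∂P
      = ∫ ω, heatAvg c φ (gridTime lam t H n ω) ∂P := by
  have hm : Measurable fun h : ℝ≥0 → ℝ ↦ ⌈pathInverse lam t h * n⌉₊ :=
    Nat.measurable_ceil.comp ((measurable_pathInverse lam t).mul_const _)
  exact hB.integral_comp_countable hc hφ hC (measurable_ceil_pathInverse hH lam t n)
    (hi.comp measurable_id hm) fun k ↦ (k : ℝ≥0) / n

theorem tendsto_timeChanged [IsProbabilityMeasure P] (hB : IsPlanarBrownian B P)
    (hH : IsStableSubordinator (1 / 2) H P) (lam c : ℝ) (ht : 0 < t) :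
    ∀ᵐ ω ∂P, Tendsto (fun n ↦ B ((c ^ 2).toNNReal * gridTime lam t H n ω) ω) atTop
      (𝓝 (timeChanged lam c B H t ω)) := by
  filter_upwards [hB.continuous, tendsto_gridTime hH lam ht] with ω h1 h2
  exact (h1.tendsto _).comp (h2.const_mul _)

theorem measurable_comp_countable {E : Type*} [MeasurableSpace E] {X : ℝ≥0 → Ω → E}
    (hX : ∀ s, Measurable (X s)) {K : Ω → ℕ} (hK : Measurable K) (τ : ℕ → ℝ≥0) :
    Measurable fun ω ↦ X (τ (K ω)) ω := by
  have hf : Measurable fun x : Ω × ℕ ↦ X (τ x.2) x.1 :=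
    measurable_from_prod_countable_left fun k ↦ hX (τ k)
  exact hf.comp (measurable_id.prodMk hK)

theorem measurable_grid (hB : IsPlanarBrownian B P) (hH : IsStableSubordinator (1 / 2) H P)
    (lam c t : ℝ) (n : ℕ) :
    Measurable fun ω ↦ B ((c ^ 2).toNNReal * gridTime lam t H n ω) ω := by
  unfold gridTime
  exact measurable_comp_countable hB.measurable (measurable_ceil_pathInverse hH lam t n)
    fun k ↦ (c ^ 2).toNNReal * ((k : ℝ≥0) / n)

theorem aemeasurable_timeChanged [IsProbabilityMeasure P] (hB : IsPlanarBrownian B P)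
    (hH : IsStableSubordinator (1 / 2) H P) (lam c : ℝ) (ht : 0 < t) :
    AEMeasurable (timeChanged lam c B H t) P :=
  aemeasurable_of_tendsto_metrizable_ae atTop
    (fun n ↦ (measurable_grid hB hH lam c t n).aemeasurable) (tendsto_timeChanged hB hH lam c ht)

/-- The frozen-time identity holds on each grid. Dominated convergence passes to the limit on both
sides, by path continuity of `B` and continuity of the heat average; the law of the inverse process
then gives the integral. -/
theorem integral_timeChanged [IsProbabilityMeasure P] (hB : IsPlanarBrownian B P)
    (hH : IsStableSubordinator (1 / 2) H P)
    (hi : IndepFun (fun ω s ↦ B s ω) (fun ω s ↦ H s ω) P) (hlam : 0 < lam) (hc : 0 < c)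
    (ht : 0 < t) (hφ : Continuous φ) {C : ℝ} (hC : ∀ y, |φ y| ≤ C) :
    ∫ ω, φ (timeChanged lam c B H t ω) ∂P = relax lam (heatAvg c φ) t := by
  have hcont := continuous_heatAvg hc hφ hC
  have h1 : Tendsto (fun n ↦ ∫ ω, φ (B ((c ^ 2).toNNReal * gridTime lam t H n ω) ω) ∂P) atTop
      (𝓝 (∫ ω, φ (timeChanged lam c B H t ω) ∂P)) :=
    tendsto_integral_of_dominated_convergence (fun _ ↦ C)
      (fun n ↦ (hφ.measurable.comp (measurable_grid hB hH lam c t n)).aestronglyMeasurable)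
      (integrable_const C) (fun n ↦ ae_of_all _ fun ω ↦ hC _)
      ((tendsto_timeChanged hB hH lam c ht).mono fun ω h ↦ (hφ.tendsto _).comp h)
  have hgm : ∀ n, Measurable fun ω ↦ (gridTime lam t H n ω : ℝ) := fun n ↦ by
    have := measurable_ceil_pathInverse hH lam t n
    unfold gridTime
    push_cast
    exact (measurable_from_nat.comp this).div_const _
  have h2 : Tendsto (fun n ↦ ∫ ω, heatAvg c φ (gridTime lam t H n ω) ∂P) atTop
      (𝓝 (∫ ω, heatAvg c φ (inverseTime lam H t ω) ∂P)) :=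
    tendsto_integral_of_dominated_convergence (fun _ ↦ C)
      (fun n ↦ (hcont.measurable.comp (hgm n)).aestronglyMeasurable)
      (integrable_const C) (fun n ↦ ae_of_all _ fun ω ↦ abs_heatAvg_le hc hC _)
      ((tendsto_gridTime hH lam ht).mono fun ω h ↦
        (hcont.tendsto _).comp (NNReal.tendsto_coe.2 h))
  simp_rw [integral_gridTime hB hH hi hc lam t hφ hC] at h1
  rw [tendsto_nhds_unique h1 h2,
    ← integral_map (aemeasurable_inverseTime hH lam ht) hcont.aestronglyMeasurable,
    map_inverseTime hH hlam ht,
    integral_withDensity_ofReal (measurable_inverseDensity_right lam t).aemeasurable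
      ((ae_restrict_mem measurableSet_Ioi).mono fun ℓ hℓ ↦
        inverseDensity_nonneg hlam (le_of_lt hℓ) t)]
  rfl

theorem integrableOn_composedIntegrand (hlam : 0 < lam) (hc : 0 < c) {z : ℝ × ℝ} (hz : z ≠ 0)
    (ht : 0 < t) : IntegrableOn (composedIntegrand lam c z t) (Ioi 0) :=
  (composedLaw_eq_relax hlam hc (w := (z.1 ^ 2 + z.2 ^ 2) / c ^ 2)
    (div_pos (normSq_pos hz) (by positivity)) ht (by field_simp)).1

theorem composedLaw_nonneg (hlam : 0 < lam) (hc : 0 < c) {z : ℝ × ℝ} (hz : z ≠ 0)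
    (ht : 0 < t) : 0 ≤ composedLaw lam c z t := by
  rw [(composedLaw_eq_relax hlam hc (w := (z.1 ^ 2 + z.2 ^ 2) / c ^ 2)
    (div_pos (normSq_pos hz) (by positivity)) ht (by field_simp)).2]
  refine mul_nonneg (by positivity) (setIntegral_nonneg measurableSet_Ioi fun ℓ hℓ ↦ ?_)
  exact mul_nonneg (inverseDensity_nonneg hlam (le_of_lt hℓ) t) (heatRadial_nonneg _ hℓ)

/-- Bounded continuous functions determine a finite measure, and for each of them both laws give the
relaxed heat average of `φ`. -/
theorem hasLaw_timeChanged [IsProbabilityMeasure P] (hB : IsPlanarBrownian B P)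
    (hH : IsStableSubordinator (1 / 2) H P)
    (hi : IndepFun (fun ω s ↦ B s ω) (fun ω s ↦ H s ω) P) (hlam : 0 < lam) (hc : 0 < c)
    (ht : 0 < t) :
    HasLaw (timeChanged lam c B H t)
      (volume.withDensity fun z ↦ ENNReal.ofReal (composedLaw lam c z t)) P := by
  have hm := aemeasurable_timeChanged hB hH lam c ht
  have hint := integrable_composedLaw hlam hc ht
  have h0 : ∀ᵐ z ∂(volume : Measure (ℝ × ℝ)), 0 ≤ composedLaw lam c z t :=
    (Measure.ae_ne volume 0).mono fun z hz ↦ composedLaw_nonneg hlam hc hz ht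
  have := isFiniteMeasure_withDensity_ofReal hint.2
  have := Measure.isProbabilityMeasure_map hm
  refine ⟨hm, ext_of_forall_integral_eq_of_IsFiniteMeasure fun φ ↦ ?_⟩
  have hC : ∀ y, |φ y| ≤ ‖φ‖ := φ.norm_coe_le_norm
  rw [integral_map hm φ.continuous.aestronglyMeasurable,
    integral_timeChanged hB hH hi hlam hc ht φ.continuous hC,
    integral_withDensity_ofReal hint.aemeasurable h0,
    ← (pairing_composedLaw hlam hc ht φ.continuous hC).2]
  rfl

end

end PlanarTelegraph

theorem mainTheorem4 (lam c : ℝ) (hlam : 0 < lam) (hc : 0 < c) :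
    -- the function `𝔮` is well defined and nonnegative away from the origin
    (∀ s t : ℝ, 0 < s → 0 < t →
      PlanarTelegraph.HasRLDeriv (1 / 2) (fun τ ↦ PlanarTelegraph.reflDensity s τ) t) ∧
    (∀ z : ℝ × ℝ, z ≠ 0 → ∀ t : ℝ, 0 < t →
      IntegrableOn (PlanarTelegraph.composedIntegrand lam c z t) (Ioi 0) volume ∧
        0 ≤ PlanarTelegraph.composedLaw lam c z t) ∧
    -- it satisfies the equation, pointwise off the origin and weakly on the whole plane
    (∀ z : ℝ × ℝ, z ≠ 0 → ∀ t : ℝ, 0 < t →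
      PlanarTelegraph.SolvesAt lam c (PlanarTelegraph.composedLaw lam c) z t) ∧
    PlanarTelegraph.SolvesWeakly lam c (PlanarTelegraph.composedLaw lam c) ∧
    -- it is the law of the time-changed planar Brownian motion
    (∀ (Ω : Type*) [MeasurableSpace Ω] (P : Measure Ω) [IsProbabilityMeasure P]
      (B : ℝ≥0 → Ω → ℝ × ℝ) (H : ℝ≥0 → Ω → ℝ),
      PlanarTelegraph.IsPlanarBrownian B P →
      PlanarTelegraph.IsStableSubordinator (1 / 2) H P →
      IndepFun (fun ω s ↦ B s ω) (fun ω s ↦ H s ω) P →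
      ∀ t : ℝ, 0 < t →
        HasLaw (PlanarTelegraph.timeChanged lam c B H t)
          (volume.withDensity
            (fun z ↦ ENNReal.ofReal (PlanarTelegraph.composedLaw lam c z t))) P) := by
  refine ⟨fun s t hs ht ↦ PlanarTelegraph.hasRLDeriv_reflDensity hs ht,
    fun z hz t ht ↦ ⟨PlanarTelegraph.integrableOn_composedIntegrand hlam hc hz ht,
      PlanarTelegraph.composedLaw_nonneg hlam hc hz ht⟩,
    fun z hz t ht ↦ PlanarTelegraph.solvesAt_composedLaw hlam hc hz ht,
    PlanarTelegraph.solvesWeakly_composedLaw hlam hc, ?_⟩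
  intro Ω _ P _ B H hB hH hi t ht
  exact PlanarTelegraph.hasLaw_timeChanged hB hH hi hlam hc ht
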